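/- Let $d,n,L\ge 1$ and $k\ge 2$ be integers, and let $S=((x^1,y^1),\dots,(x^n,y^n))$ be a sample with $x^i\in\mathbb R^d$ and labels $y^i\in\{1,\dots,k\}$. Let $\phi:\mathbb R\to\mathbb R$ be positive homogeneous ($\phi(\alpha z)=\alpha\phi(z)$ for $\alpha>0$), $1$-Lipschitz, with $\phi(0)=0$. For real matrices $W_\ell\in\mathbb R^{d_\ell\times d_{\ell-1}}$, $1\le \ell\le L$, with $d_0=d$, $d_L=k$ and arbitrary hidden widths $d_1,\dots,d_{L-1}$, let $f(x;W)=W_L\phi(W_{L-1}\phi(\cdots\phi(W_1x)))$, with $\phi$ acting entrywise. Let $1\le q\le 2$ and $\frac1q+\frac1{q^*}=1$. Put $w^{(q)}_{j_0}=\big(\frac1n\sum_{i=1}^n|x^i_{j_0}|^{q^*}\big)^{1/q^*}$ if $q>1$ and $w^{(1)}_{j_0}=\max_i|x^i_{j_0}|$. The $q$-path variation and the $q$-path distribution of $W$ are $$\mathscr V_q(W)=\sum_{j_0,\dots,j_L}w^{(q)}_{j_0}\prod_{\ell=1}^L\big|W_\ell[j_\ell,j_{\ell-1}]\big|,\qquad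 p^{(q)}_{j_0,\dots,j_L}=\frac{w^{(q)}_{j_0}\prod_{\ell=1}^L|W_\ell[j_\ell,j_{\ell-1}]|}{\mathscr V_q(W)},$$ and the $q$-path complexity is $\zeta_q(W)=\frac1L\big(1+\sum_{\ell=1}^{L-1}e^{\frac12H_{1/2}(p^{(q)}_\ell)}\big)$, where $p^{(q)}_\ell$ is the marginal of $p^{(q)}$ on the index $j_\ell$ and $H_{1/2}(p)=2\log\sum_j\sqrt{p_j}$ is the Rényi entropy of order $1/2$. (If $\mathscr V_q(W)=0$, then $p^{(q)}$ is not defined, and we set $\zeta_q(W)=1$.) For $\gamma>0$ let $R_\gamma(z)=0$ for $z<-\gamma$, $R_\gamma(z)=1+z/\gamma$ for $-\gamma\le z\le 0$, and $R_\gamma(z)=1$ for $z>0$. Let $\mathcal M(v,y)=v_y-\max_{j\ne y}v_j$ for $v\in\mathbb R^k$. For real numbers $\mathscr V,\zeta$ let $$\mathcal F_\gamma(\mathscr V,\zeta)=\big\{(x,y)\mapsto R_\gamma\big(-\mathcal M(f(x;W),y)\big)\;:\;\mathscr V_q(W)\le\mathscr V,\ \zeta_q(W)\le\zeta\big\},$$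 where $W$ ranges over all weights as above, with $L$, $d$, $k$, $\phi$ fixed and all hidden widths allowed. For a class $\mathcal F$ of real functions of $(x,y)$ and $\epsilon>0$, let $\mathcal N_2(\epsilon,\mathcal F,S)$ be the least cardinality of a set $\mathcal G$ of real functions of $(x,y)$ such that every $f\in\mathcal F$ has some $g\in\mathcal G$ with $\big(\frac1n\sum_{i=1}^n|f(x^i,y^i)-g(x^i,y^i)|^2\big)^{1/2}\le\epsilon$. Then for all $\epsilon,\gamma>0$, $1\le q\le 2$ and all real $\mathscr V,\zeta$, with $\log 0=-\infty$, $$\log\mathcal N_2\big(\epsilon,\mathcal F_\gamma(\mathscr V,\zeta),S\big)\le\frac{9\,\mathscr V^2\zeta^2L^2\,(L+\log(de))}{\gamma^2\epsilon^2}.$$ -/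

import Mathlib

noncomputable section

namespace PathNet

/-- A fully connected network with `L` layers, input dimension `d` and output dimension `k`.
Layer `ℓ` (for `0 ≤ ℓ ≤ L`) has `width ℓ` units, and the real weight matrix number `ℓ + 1`
maps layer `ℓ` to layer `ℓ + 1`.  The hidden widths are arbitrary. -/
structure Network (d k L : ℕ) where
  width : Fin (L + 1) → ℕ
  width_zero : width 0 = d
  width_last : width (Fin.last L) = k
  W : ∀ ℓ : Fin L, Matrix (Fin (width ℓ.succ)) (Fin (width ℓ.castSucc)) ℝ

/-- Positively homogeneous, `1`-Lipschitz activation functions vanishing at `0`. -/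
structure IsActivation (φ : ℝ → ℝ) : Prop where
  pos_homogeneous : ∀ a z : ℝ, 0 < a → φ (a * z) = a * φ z
  lipschitz : LipschitzWith 1 φ
  map_zero : φ 0 = 0

/-- The ramp function `R_γ`. -/
def ramp (γ z : ℝ) : ℝ :=
  if z < -γ then 0 else if z ≤ 0 then 1 + z / γ else 1

/-- The margin operator `v_y - max_{j ≠ y} v_j`. -/
def margin {k : ℕ} (v : Fin k → ℝ) (y : Fin k) : ℝ :=
  v y - ⨆ j : {j : Fin k // j ≠ y}, v j

/-- Rényi entropy of order `α`. -/
def renyiEntropy {ι : Type*} [Fintype ι] (α : ℝ) (p : ι → ℝ) : ℝ :=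
  1 / (1 - α) * Real.log (∑ i, p i ^ α)

/-- The data-dependent weight of input coordinate `j`: the empirical `ℓ_{q*}` average of the
`j`-th coordinate over the sample, which is the maximum when `q = 1`. -/
def inputWeight {d k n : ℕ} (q : ℝ) (S : Fin n → (Fin d → ℝ) × Fin k) (j : Fin d) : ℝ :=
  if q = 1 then ⨆ i, |(S i).1 j|
  else ((1 / (n : ℝ)) * ∑ i, |(S i).1 j| ^ q.conjExponent) ^ (1 / q.conjExponent)

namespace Network

variable {d k L n : ℕ}

/-- Inputs `z` to the units of each layer: layer `0` carries the network input `x`, layer `1`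
receives `W_1 x`, and layer `ℓ + 1` receives `W_{ℓ+1} φ(z_ℓ)` for `ℓ ≥ 1`. -/
def preact (N : Network d k L) (φ : ℝ → ℝ) (x : Fin d → ℝ) (ℓ : Fin (L + 1)) :
    Fin (N.width ℓ) → ℝ :=
  Fin.induction (motive := fun ℓ => Fin (N.width ℓ) → ℝ)
    (fun j => x (Fin.cast N.width_zero j))
    (fun ℓ z => Matrix.mulVec (N.W ℓ) (fun i => if (ℓ : ℕ) = 0 then z i else φ (z i)))
    ℓ

/-- The function `x ↦ W_L φ(W_{L-1} φ(⋯ φ(W_1 x)))` computed by the network (no activation is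
applied at the output). -/
def eval (N : Network d k L) (φ : ℝ → ℝ) (x : Fin d → ℝ) (j : Fin k) : ℝ :=
  N.preact φ x (Fin.last L) (Fin.cast N.width_last.symm j)

/-- A path `(j_0, …, j_L)`: one unit in every layer. -/
abbrev Path (N : Network d k L) : Type := ∀ ℓ : Fin (L + 1), Fin (N.width ℓ)

/-- The product of the absolute values of the weights along a path. -/
def pathWeight (N : Network d k L) (j : N.Path) : ℝ :=
  ∏ ℓ : Fin L, |N.W ℓ (j ℓ.succ) (j ℓ.castSucc)|

/-- The path weight multiplied by the weight of the input coordinate where the path starts. -/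
def weightedPath (N : Network d k L) (q : ℝ) (S : Fin n → (Fin d → ℝ) × Fin k)
    (j : N.Path) : ℝ :=
  inputWeight q S (Fin.cast N.width_zero (j 0)) * N.pathWeight j

/-- The `q`-path variation on the sample `S`. -/
def pathVariation (N : Network d k L) (q : ℝ) (S : Fin n → (Fin d → ℝ) × Fin k) : ℝ :=
  ∑ j : N.Path, N.weightedPath q S j

/-- The `q`-path distribution. -/
def pathDist (N : Network d k L) (q : ℝ) (S : Fin n → (Fin d → ℝ) × Fin k)
    (j : N.Path) : ℝ :=
  N.weightedPath q S j / N.pathVariation q S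

/-- The marginal of the `q`-path distribution on the units of layer `ℓ`. -/
def marginal (N : Network d k L) (q : ℝ) (S : Fin n → (Fin d → ℝ) × Fin k)
    (ℓ : Fin (L + 1)) (i : Fin (N.width ℓ)) : ℝ :=
  ∑ j : N.Path with j ℓ = i, N.pathDist q S j

/-- The `q`-path complexity; the sum runs over the hidden layers `ℓ = 1, …, L - 1`. -/
def pathComplexity (N : Network d k L) (q : ℝ) (S : Fin n → (Fin d → ℝ) × Fin k) : ℝ :=
  (1 / (L : ℝ)) * (1 + ∑ ℓ ∈ Finset.Ioo (0 : Fin (L + 1)) (Fin.last L),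
    Real.exp ((1 / 2) * renyiEntropy (1 / 2) (N.marginal q S ℓ)))

end Network

/-- The class of functions computed by `L`-layer networks with activation `φ`, of any hidden
widths, whose `q`-path variation is at most `V` and whose `q`-path complexity is at most `ζ`. -/
def networkClass {d k n : ℕ} (L : ℕ) (φ : ℝ → ℝ) (q : ℝ)
    (S : Fin n → (Fin d → ℝ) × Fin k) (V ζ : ℝ) : Set ((Fin d → ℝ) → Fin k → ℝ) :=
  {f | ∃ N : Network d k L,
    N.pathVariation q S ≤ V ∧ N.pathComplexity q S ≤ ζ ∧ f = N.eval φ}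

/-- The ramp-margin class: all `(x, y) ↦ R_γ(-margin (f x) y)` with `f` in the network class. -/
def rampMarginClass {d k n : ℕ} (L : ℕ) (φ : ℝ → ℝ) (q γ : ℝ)
    (S : Fin n → (Fin d → ℝ) × Fin k) (V ζ : ℝ) : Set ((Fin d → ℝ) × Fin k → ℝ) :=
  (fun f s => ramp γ (-margin (f s.1) s.2)) '' networkClass L φ q S V ζ

/-- The empirical `L₂` distance of two functions on a sample. -/
def empDist {X : Type*} {n : ℕ} (S : Fin n → X) (f g : X → ℝ) : ℝ :=
  Real.sqrt ((1 / (n : ℝ)) * ∑ i, |f (S i) - g (S i)| ^ 2)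

/-- `G` is an `ε`-covering of `F` in the empirical `L₂` distance. -/
def IsCovering {X : Type*} {n : ℕ} (ε : ℝ) (F G : Set (X → ℝ)) (S : Fin n → X) : Prop :=
  ∀ f ∈ F, ∃ g ∈ G, empDist S f g ≤ ε

/-- The minimal cardinality of an `ε`-covering (`⊤` if there is no finite one). -/
def coveringNumber {X : Type*} {n : ℕ} (ε : ℝ) (F : Set (X → ℝ)) (S : Fin n → X) : ℕ∞ :=
  ⨅ (G : Set (X → ℝ)) (_ : IsCovering ε F G S), G.encard

/-- The `ε`-metric entropy: the extended-real logarithm of the covering number. -/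
def metricEntropy {X : Type*} {n : ℕ} (ε : ℝ) (F : Set (X → ℝ)) (S : Fin n → X) : EReal :=
  ENNReal.log ((coveringNumber ε F S : ℕ∞) : ENNReal)

end PathNet

end

open scoped BigOperators

namespace PathNet

/-! Positive homogeneity lets the total path weight reaching a unit be pulled out of `φ`. On the
sample, each output is therefore `v j * g j` with `v j ≥ 0`, where the `v j` add up to the path
variation and `g j` lies in `unitClass`: iterated absolutely convex combinations of input
coordinates normalized to mean square at most one (`exists_rows`; the normalization uses `q* ≥ 2`).
The path complexity matters only through `1 ≤ ζ`: every exponential of an entropy in it is at least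
one, so the class is empty for `ζ < 1`, and otherwise `ζ ^ 2` only enlarges the bound. What remains
is a covering bound in terms of `B = V / (γ * ε)`; for `B ≤ 1` a single constant function suffices.

The bound must not depend on the number `k` of outputs. The key is that `ramp γ (-margin v y)`
depends only on `v y` and on the symmetric quantity `secondMax v` (`ramp_neg_margin`). A code may
thus list the output rows up to permutation, and a row needs a class name only where its own entry
`v y` is read. Each row gets a label chosen among the few classes carrying much of its mass; if its
true class is not among them, it stays unlabelled at small cost (`coveringNumber_le_of_codes`).

The rows are coded in two ways. For one layer, Maurey's sampling gives short unordered lists of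
atoms. For deeper networks the scales `v` are discretized (`exists_scale_profiles`), and for each
scale vector the rows are replaced by a net of a product of scaled unit classes. The net is small by
Sudakov's minoration, `log_card_mul_sq_le`, since its Rademacher width is small: contraction for
exponential moments costs a factor 2 per layer inside a logarithm, which gives `ℓ * log 2 + log d`
(`expect_iSup_exp_unitClass_le`).

Sudakov's bound is obtained directly for signs. Along a random walk with small steps, the expected
log-partition function of `N` separated points gains a fixed proportion of its excess over the
expected maximum. It also stays within `log N` of that maximum, so a maximum growing too slowly,
like `w * √K`, would force an impossible exponential growth. -/

/-- The real sign `±1` attached to a bit. -/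
def bitSign (b : Bool) : ℝ := if b then 1 else -1

/-- The Rademacher sum `∑ i, ± x i`. -/
def signSum {ι : Type*} [Fintype ι] (σ : ι → Bool) (x : ι → ℝ) : ℝ := ∑ i, bitSign (σ i) * x i

lemma bitSign_not (b : Bool) : bitSign (!b) = -bitSign b := by cases b <;> simp [bitSign]

lemma bitSign_sq (b : Bool) : bitSign b ^ 2 = 1 := by cases b <;> simp [bitSign]

lemma abs_bitSign (b : Bool) : |bitSign b| = 1 := by cases b <;> simp [bitSign]

/-! ### Averages over random signs -/

section SignSum

variable {ι : Type*} [Fintype ι]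

lemma signSum_not (σ : ι → Bool) (x : ι → ℝ) : signSum (fun i => !σ i) x = -signSum σ x := by
  simp [signSum, bitSign_not]

lemma signSum_const_mul (σ : ι → Bool) (c : ℝ) (x : ι → ℝ) :
    signSum σ (fun i => c * x i) = c * signSum σ x := by
  simp only [signSum, Finset.mul_sum]
  exact Finset.sum_congr rfl fun i _ => by ring

lemma signSum_finsetSum {κ : Type*} (s : Finset κ) (σ : ι → Bool) (x : κ → ι → ℝ) :
    signSum σ (fun i => ∑ j ∈ s, x j i) = ∑ j ∈ s, signSum σ (x j) := by
  simp only [signSum, Finset.mul_sum]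
  exact Finset.sum_comm

lemma abs_signSum_le (σ : ι → Bool) (x : ι → ℝ) : |signSum σ x| ≤ ∑ i, |x i| := by
  refine (Finset.abs_sum_le_sum_abs _ _).trans (le_of_eq ?_)
  simp [abs_mul, abs_bitSign]

variable [DecidableEq ι]

lemma expect_flip (i : ι) (f : (ι → Bool) → ℝ) :
    𝔼 σ, f (Function.update σ i (!σ i)) = 𝔼 σ, f σ := by
  refine Fintype.expect_equiv
    (Function.Involutive.toPerm (fun σ : ι → Bool => Function.update σ i (!σ i)) ?_) _ _ ?_
  · intro σ
    simp
  · intro σ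
    rfl

lemma expect_not (f : (ι → Bool) → ℝ) : 𝔼 σ : ι → Bool, f (fun i => !σ i) = 𝔼 σ, f σ := by
  refine Fintype.expect_equiv
    (Function.Involutive.toPerm (fun (σ : ι → Bool) i => !σ i) ?_) _ _ ?_
  · intro σ
    simp
  · intro σ
    rfl

lemma expect_prod (f : ι → Bool → ℝ) :
    𝔼 σ : ι → Bool, ∏ i, f i (σ i) = ∏ i, ((f i true + f i false) / 2) := by
  rw [Fintype.expect_eq_sum_div_card, ← Fintype.prod_sum, Finset.prod_div_distrib]
  simp

lemma expect_exp_signSum_le (x : ι → ℝ) :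
    𝔼 σ, Real.exp (signSum σ x) ≤ Real.exp ((∑ i, x i ^ 2) / 2) := by
  have h : ∀ σ : ι → Bool, Real.exp (signSum σ x) = ∏ i, Real.exp (bitSign (σ i) * x i) :=
    fun σ => Real.exp_sum _ _
  simp only [h]
  rw [expect_prod (fun i b => Real.exp (bitSign b * x i)), Finset.sum_div, Real.exp_sum]
  refine Finset.prod_le_prod (fun i _ => by positivity) fun i _ => ?_
  have := Real.cosh_le_exp_half_sq (x i)
  rw [Real.cosh_eq] at this
  simpa [bitSign] using this

lemma expect_bitSign_mul (i j : ι) :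
    𝔼 σ : ι → Bool, bitSign (σ i) * bitSign (σ j) = if i = j then 1 else 0 := by
  split_ifs with h
  · subst h
    simp [← sq, bitSign_sq]
  · have h1 := expect_flip i (fun σ : ι → Bool => bitSign (σ i) * bitSign (σ j))
    simp only [Function.update_self, Function.update_of_ne (Ne.symm h), bitSign_not, neg_mul,
      Finset.expect_neg_distrib] at h1
    linarith

lemma expect_signSum (x : ι → ℝ) : 𝔼 σ, signSum σ x = 0 := by
  have h := expect_not (fun σ : ι → Bool => signSum σ x)
  simp only [signSum_not, Finset.expect_neg_distrib] at h
  linarith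

lemma expect_signSum_sq (x : ι → ℝ) : 𝔼 σ, signSum σ x ^ 2 = ∑ i, x i ^ 2 := by
  have h : ∀ σ : ι → Bool, signSum σ x ^ 2 =
      ∑ i, ∑ j, (x i * x j) * (bitSign (σ i) * bitSign (σ j)) := fun σ => by
    rw [sq, signSum, Finset.sum_mul_sum]
    exact Finset.sum_congr rfl fun i _ => Finset.sum_congr rfl fun j _ => by ring
  simp only [h, Finset.expect_sum_comm, ← Finset.mul_expect, expect_bitSign_mul]
  simp [sq]

end SignSum

/-! ### Contraction for exponential moments -/

section Contraction

/-- With `e = exp (v - y) ≤ 1`, the first term is at most `P * e`. The second splits into a fraction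
`e`, which is at most `Q`, and a fraction `1 - e`, which is at most `P * (1 - e)`. -/
lemma exp_contraction_pair_aux {P Q A B x y u v : ℝ} (hy0 : 0 ≤ y) (hxy : y ≤ x)
    (hAP : Real.exp (A + x) ≤ P) (hBQ : Real.exp (B - y) ≤ Q) (hBP : Real.exp (B + y) ≤ P)
    (hv : |v| ≤ |y|) (huv : |u - v| ≤ |x - y|) :
    Real.exp (A + u) + Real.exp (B - v) ≤ P + Q := by
  rw [abs_of_nonneg hy0] at hv
  rw [abs_of_nonneg (sub_nonneg.2 hxy)] at huv
  obtain ⟨hv1, hv2⟩ := abs_le.1 hv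
  obtain ⟨_, huv2⟩ := abs_le.1 huv
  set e := Real.exp (-(y - v)) with he
  have he0 : 0 < e := Real.exp_pos _
  have he1 : e ≤ 1 := by rw [he, Real.exp_le_one_iff]; linarith
  have h1 : Real.exp (A + u) ≤ P * e := by
    calc Real.exp (A + u) ≤ Real.exp (A + x) * e := by
          rw [he, ← Real.exp_add]; apply Real.exp_le_exp.2; linarith
      _ ≤ P * e := by gcongr
  have h2 : Real.exp (B - v) * e ≤ Q := by
    refine le_trans (le_of_eq ?_) hBQ
    rw [he, ← Real.exp_add]; congr 1; ring
  have h3 : Real.exp (B - v) ≤ P := (Real.exp_le_exp.2 (by linarith)).trans hBP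
  nlinarith [mul_nonneg (sub_nonneg.2 h3) (sub_nonneg.2 he1)]

/-- `P` and `Q` play the suprema for the two values of one sign, and `A + x`, `B + y` the exponents
of the two maximizers. If `x` and `y` have opposite signs, each term is bounded separately;
otherwise symmetry reduces to the auxiliary case. -/
lemma exp_contraction_pair {P Q A B x y u v : ℝ}
    (hAP : Real.exp (A + x) ≤ P) (hAQ : Real.exp (A - x) ≤ Q)
    (hBP : Real.exp (B + y) ≤ P) (hBQ : Real.exp (B - y) ≤ Q)
    (hu : |u| ≤ |x|) (hv : |v| ≤ |y|) (huv : |u - v| ≤ |x - y|) :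
    Real.exp (A + u) + Real.exp (B - v) ≤ P + Q := by
  have huv' : |(-v) - (-u)| ≤ |y - x| := by
    rw [abs_sub_comm y x]; convert huv using 2; ring
  rcases le_total 0 x with hx | hx <;> rcases le_total 0 y with hy | hy
  · rcases le_total y x with h | h
    · exact exp_contraction_pair_aux hy h hAP hBQ hBP hv huv
    · have := exp_contraction_pair_aux (A := B) (B := A) (u := -v) (v := -u) hx h hBP hAQ hAP
        (by rwa [abs_neg]) huv'
      rw [sub_neg_eq_add, ← sub_eq_add_neg] at this
      linarith
  · rw [abs_of_nonneg hx] at hu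
    rw [abs_of_nonpos hy] at hv
    have := Real.exp_le_exp.2 (show A + u ≤ A + x by linarith [(abs_le.1 hu).2])
    have := Real.exp_le_exp.2 (show B - v ≤ B - y by linarith [(abs_le.1 hv).1])
    linarith
  · rw [abs_of_nonpos hx] at hu
    rw [abs_of_nonneg hy] at hv
    have := Real.exp_le_exp.2 (show A + u ≤ A - x by linarith [(abs_le.1 hu).2])
    have := Real.exp_le_exp.2 (show B - v ≤ B + y by linarith [(abs_le.1 hv).1])
    linarith
  · rcases le_total x y with h | h
    · have := exp_contraction_pair_aux (P := Q) (Q := P) (A := A) (B := B) (x := -x) (y := -y)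
        (u := u) (v := v) (by linarith) (by linarith) (by rwa [← sub_eq_add_neg])
        (by rwa [sub_neg_eq_add]) (by rwa [← sub_eq_add_neg]) (by rwa [abs_neg])
        (by rw [neg_sub_neg]; rwa [abs_sub_comm y x])
      linarith
    · have := exp_contraction_pair_aux (P := Q) (Q := P) (A := B) (B := A) (x := -y) (y := -x)
        (u := -v) (v := -u) (by linarith) (by linarith) (by rwa [← sub_eq_add_neg])
        (by rwa [sub_neg_eq_add]) (by rwa [← sub_eq_add_neg]) (by rwa [abs_neg, abs_neg])
        (by rw [neg_sub_neg y x]; rwa [abs_sub_comm y x] at huv')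
      rw [sub_neg_eq_add, ← sub_eq_add_neg] at this
      linarith

variable {ι T : Type*} [Fintype ι] [DecidableEq ι] [Finite T] [Nonempty T]

/-- The Ledoux–Talagrand contraction principle for exponential moments. -/
lemma expect_iSup_exp_signSum_le (x u : T → ι → ℝ) (hu : ∀ t i, |u t i| ≤ |x t i|)
    (hux : ∀ t s i, |u t i - u s i| ≤ |x t i - x s i|) :
    𝔼 σ, ⨆ t, Real.exp (signSum σ (u t)) ≤ 𝔼 σ, ⨆ t, Real.exp (signSum σ (x t)) := by
  -- The coordinates of `x` are replaced by those of `u` one at a time.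
  suffices H : ∀ s : Finset ι,
      𝔼 σ, ⨆ t, Real.exp (signSum σ (fun i => if i ∈ s then u t i else x t i)) ≤
        𝔼 σ, ⨆ t, Real.exp (signSum σ (x t)) by
    simpa using H Finset.univ
  intro s
  induction s using Finset.induction_on with
  | empty => simp
  | insert a s ha ih =>
    refine le_trans ?_ ih
    set z : T → ι → ℝ := fun t i => if i ∈ s then u t i else x t i with hz
    set w : T → ι → ℝ := fun t i => if i ∈ insert a s then u t i else x t i with hw
    set R : (ι → Bool) → T → ℝ := fun σ t =>
      ∑ i ∈ Finset.univ.erase a, bitSign (σ i) * z t i with hR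
    have hzs : ∀ σ t, signSum σ (z t) = R σ t + bitSign (σ a) * x t a := fun σ t => by
      rw [signSum, ← Finset.sum_erase_add _ _ (Finset.mem_univ a)]
      simp [hR, hz, ha]
    have hws : ∀ σ t, signSum σ (w t) = R σ t + bitSign (σ a) * u t a := fun σ t => by
      rw [signSum, ← Finset.sum_erase_add _ _ (Finset.mem_univ a)]
      congr 1
      · refine Finset.sum_congr rfl fun i hi => ?_
        simp [hw, hz, (Finset.mem_erase.1 hi).1]
      · simp [hw]
    have hRf : ∀ (σ : ι → Bool) t, R (Function.update σ a (!σ a)) t = R σ t := fun σ t => by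
      refine Finset.sum_congr rfl fun i hi => ?_
      rw [Function.update_of_ne (Finset.mem_erase.1 hi).1]
    -- Pairing `σ` with its flip at `a` isolates one sign. The maximizers for the two signs may
    -- differ, hence the two-point inequality.
    have key : ∀ σ : ι → Bool,
        (⨆ t, Real.exp (signSum σ (w t))) +
          (⨆ t, Real.exp (signSum (Function.update σ a (!σ a)) (w t))) ≤
        (⨆ t, Real.exp (signSum σ (z t))) +
          (⨆ t, Real.exp (signSum (Function.update σ a (!σ a)) (z t))) := by
      intro σ
      simp only [hzs, hws, hRf, Function.update_self, bitSign_not]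
      obtain ⟨t, ht⟩ := exists_eq_ciSup_of_finite
        (f := fun t => Real.exp (R σ t + bitSign (σ a) * u t a))
      obtain ⟨s', hs'⟩ := exists_eq_ciSup_of_finite
        (f := fun t => Real.exp (R σ t + -bitSign (σ a) * u t a))
      rw [← ht, ← hs', neg_mul, ← sub_eq_add_neg]
      have b1 := fun t => le_ciSup (Finite.bddAbove_range
        (fun t => Real.exp (R σ t + bitSign (σ a) * x t a))) t
      have b2 := fun t => le_ciSup (Finite.bddAbove_range
        (fun t => Real.exp (R σ t + -bitSign (σ a) * x t a))) t
      refine exp_contraction_pair (b1 t) ?_ (b1 s') ?_ ?_ ?_ ?_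
      · simpa [neg_mul, ← sub_eq_add_neg] using b2 t
      · simpa [neg_mul, ← sub_eq_add_neg] using b2 s'
      · rw [abs_mul, abs_mul, abs_bitSign]; simpa using hu t a
      · rw [abs_mul, abs_mul, abs_bitSign]; simpa using hu s' a
      · rw [← mul_sub, ← mul_sub, abs_mul, abs_mul, abs_bitSign]; simpa using hux t s' a
    have h1 := expect_flip a (fun σ => ⨆ t, Real.exp (signSum σ (w t)))
    have h2 := expect_flip a (fun σ => ⨆ t, Real.exp (signSum σ (z t)))
    have h3 := Finset.expect_le_expect (s := Finset.univ) (fun σ _ => key σ)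
    rw [Finset.expect_add_distrib, Finset.expect_add_distrib, h1, h2] at h3
    linarith

/-- The factor 2 comes from `exp |s| ≤ exp s + exp (-s)` and the symmetry of the signs; contraction
itself is for signed sums. -/
lemma expect_iSup_exp_abs_signSum_le (x u : T → ι → ℝ) (hu : ∀ t i, |u t i| ≤ |x t i|)
    (hux : ∀ t s i, |u t i - u s i| ≤ |x t i - x s i|) :
    𝔼 σ, ⨆ t, Real.exp |signSum σ (u t)| ≤ 2 * 𝔼 σ, ⨆ t, Real.exp |signSum σ (x t)| := by
  have h1 : ∀ σ : ι → Bool, (⨆ t, Real.exp |signSum σ (u t)|) ≤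
      (⨆ t, Real.exp (signSum σ (u t))) + ⨆ t, Real.exp (signSum (fun i => !σ i) (u t)) := by
    intro σ
    refine ciSup_le fun t => ?_
    have b1 := le_ciSup (Finite.bddAbove_range (fun t => Real.exp (signSum σ (u t)))) t
    have b2 := le_ciSup (Finite.bddAbove_range
      (fun t => Real.exp (signSum (fun i => !σ i) (u t)))) t
    simp only [signSum_not] at b1 b2 ⊢
    have p1 := Real.exp_pos (signSum σ (u t))
    have p2 := Real.exp_pos (-signSum σ (u t))
    rcases abs_cases (signSum σ (u t)) with ⟨h, _⟩ | ⟨h, _⟩ <;> rw [h] <;> linarith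
  have h2 := Finset.expect_le_expect (s := Finset.univ) (fun σ _ => h1 σ)
  rw [Finset.expect_add_distrib,
    expect_not (fun σ => ⨆ t, Real.exp (signSum σ (u t))), ← two_mul] at h2
  refine h2.trans ?_
  have h3 := expect_iSup_exp_signSum_le x u hu hux
  have h4 : 𝔼 σ, (⨆ t, Real.exp (signSum σ (x t))) ≤ 𝔼 σ, ⨆ t, Real.exp |signSum σ (x t)| :=
    Finset.expect_le_expect fun σ _ => ciSup_mono (Finite.bddAbove_range _)
      fun t => Real.exp_le_exp.2 (le_abs_self _)
  linarith

end Contraction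

/-! ### Averaging operator of a random walk -/

section AvgStep

variable {ι T : Type*} [Fintype ι] [DecidableEq ι]

/-- One step of the random walk `x t ↦ x t ± a t 1 ± a t 2 ± ⋯`, acting on functions. -/
noncomputable def avgStep (a : T → ι → ℝ) (f : (T → ℝ) → ℝ) (x : T → ℝ) : ℝ :=
  𝔼 σ : ι → Bool, f (fun t => x t + signSum σ (a t))

lemma avgStep_mono (a : T → ι → ℝ) {f g : (T → ℝ) → ℝ} (h : ∀ x, f x ≤ g x) (x : T → ℝ) :
    avgStep a f x ≤ avgStep a g x :=
  Finset.expect_le_expect fun _ _ => h _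

lemma avgStep_iterate_mono (a : T → ι → ℝ) (K : ℕ) {f g : (T → ℝ) → ℝ} (h : ∀ x, f x ≤ g x) :
    ∀ x, (avgStep a)^[K] f x ≤ (avgStep a)^[K] g x := by
  induction K with
  | zero => exact h
  | succ K ih =>
    intro x
    rw [Function.iterate_succ_apply', Function.iterate_succ_apply']
    exact avgStep_mono a ih x

/-- Averaging is linear and fixes constants, so pointwise affine inequalities between functions
survive `K` further steps. -/
lemma avgStep_iterate_affine (a : T → ι → ℝ) (K : ℕ) (f g : (T → ℝ) → ℝ) (b c e : ℝ) :
    ∀ x, (avgStep a)^[K] (fun y => b * f y + c * g y + e) x =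
      b * (avgStep a)^[K] f x + c * (avgStep a)^[K] g x + e := by
  induction K with
  | zero => exact fun _ => rfl
  | succ K ih =>
    intro x
    simp only [Function.iterate_succ_apply']
    rw [show (avgStep a)^[K] (fun y => b * f y + c * g y + e) =
      fun x => b * (avgStep a)^[K] f x + c * (avgStep a)^[K] g x + e from funext ih]
    simp only [avgStep, Finset.expect_add_distrib, Finset.mul_expect, Fintype.expect_const]

/-- Identifies `K` steps of the walk with independent signs on `K` copies of the coordinates, the
form in which the width is estimated. -/
lemma avgStep_iterate (a : T → ι → ℝ) (K : ℕ) (f : (T → ℝ) → ℝ) : ∀ x,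
    (avgStep a)^[K] f x =
      𝔼 σ : Fin K × ι → Bool, f (fun t => x t + signSum σ (fun p => a t p.2)) := by
  induction K with
  | zero => intro x; simp [signSum]
  | succ K ih =>
    intro x
    rw [Function.iterate_succ_apply']
    rw [← Fintype.expect_equiv
      (((Equiv.refl _).prodCongr (Equiv.curry _ _ _)).trans
        ((Fin.consEquiv (fun _ : Fin (K + 1) => ι → Bool)).trans (Equiv.curry _ _ _).symm))
      (fun s : (ι → Bool) × (Fin K × ι → Bool) =>
        f (fun t => x t + signSum s.1 (a t) + signSum s.2 (fun p => a t p.2))) _ ?_]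
    · rw [← Finset.univ_product_univ, Finset.expect_product]
      refine Finset.expect_congr rfl fun σ _ => ?_
      exact ih _
    · rintro ⟨σ, τ⟩
      congr 1
      funext t
      rw [add_assoc]
      congr 1
      simp only [signSum, Fintype.sum_prod_type, Fin.sum_univ_succ]
      rfl

end AvgStep

/-! ### Sudakov's minoration for Rademacher averages -/

section Sudakov

lemma one_add_add_sq_le_exp {u θ : ℝ} (hu : |u| ≤ θ) (hθ1 : θ ≤ 1) :
    1 + u + (1 - θ) * u ^ 2 / 2 ≤ Real.exp u := by
  have hθ : 0 ≤ θ := (abs_nonneg u).trans hu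
  have h3 := Real.exp_bound (x := u) (hu.trans hθ1) (n := 3) (by norm_num)
  have hs : ∑ m ∈ Finset.range 3, u ^ m / (m.factorial : ℝ) = 1 + u + u ^ 2 / 2 := by
    simp [Finset.sum_range_succ, Nat.factorial]
  rw [hs] at h3
  have h4 : |u| ^ 3 ≤ θ * u ^ 2 := by
    rw [← sq_abs u]; nlinarith [sq_nonneg |u|]
  have h5 := (abs_le.1 h3).1
  have h6 : |u| ^ 3 * (((Nat.succ 3 : ℕ) : ℝ) / (((Nat.factorial 3 : ℕ) : ℝ) * ((3 : ℕ) : ℝ))) ≤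
      θ * u ^ 2 / 2 := by
    have : (((Nat.succ 3 : ℕ) : ℝ) / (((Nat.factorial 3 : ℕ) : ℝ) * ((3 : ℕ) : ℝ))) = 2 / 9 := by
      norm_num [Nat.factorial]
    rw [this]
    have : 0 ≤ θ * u ^ 2 := by positivity
    linarith
  linarith

/-- The chord of the convex function `exp` over `[-log N, 0]` lies above its graph. This makes the
gain of the log-partition function linear in its excess over the maximum. -/
lemma one_sub_exp_neg_ge {N u : ℝ} (hN : 1 < N) (hu0 : 0 ≤ u) (hu : u ≤ Real.log N) :
    (1 - 1 / N) * (u / Real.log N) ≤ 1 - Real.exp (-u) := by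
  have hl : 0 < Real.log N := Real.log_pos hN
  have hc := convexOn_exp.2 (Set.mem_univ (-Real.log N)) (Set.mem_univ (0 : ℝ))
    (show 0 ≤ u / Real.log N by positivity)
    (show 0 ≤ 1 - u / Real.log N by rw [sub_nonneg, div_le_one hl]; exact hu) (by ring)
  have e1 : (u / Real.log N) • (-Real.log N) + (1 - u / Real.log N) • (0 : ℝ) = -u := by
    simp only [smul_eq_mul]; field_simp; ring
  rw [e1, Real.exp_neg (Real.log N), Real.exp_log (by linarith), Real.exp_zero] at hc
  simp only [smul_eq_mul] at hc
  rw [one_div]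
  linarith

lemma sum_weight_sq_sub {T : Type*} [Fintype T] (p s : T → ℝ) (hp : ∑ t, p t = 1) :
    ∑ t, p t * (s t - ∑ u, p u * s u) ^ 2 =
      1 / 2 * ∑ t, ∑ u, p t * p u * (s t - s u) ^ 2 := by
  set m := ∑ u, p u * s u with hm
  have h1 : ∑ t, p t * (s t - m) ^ 2 = ∑ t, p t * s t ^ 2 - m ^ 2 := by
    have : ∀ t, p t * (s t - m) ^ 2 = p t * s t ^ 2 - 2 * m * (p t * s t) + m ^ 2 * p t :=
      fun t => by ring
    simp only [this, Finset.sum_add_distrib, Finset.sum_sub_distrib, ← Finset.mul_sum, ← hm, hp]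
    ring
  have h2 : ∀ t, ∑ u, p t * p u * (s t - s u) ^ 2 =
      p t * s t ^ 2 - 2 * m * (p t * s t) + p t * ∑ u, p u * s u ^ 2 := fun t => by
    have : ∀ u, p t * p u * (s t - s u) ^ 2 =
        p t * s t ^ 2 * p u - 2 * (p t * s t) * (p u * s u) + p t * (p u * s u ^ 2) :=
      fun u => by ring
    simp only [this, Finset.sum_add_distrib, Finset.sum_sub_distrib, ← Finset.mul_sum, ← hm, hp]
    ring
  simp only [h1, h2, Finset.sum_add_distrib, Finset.sum_sub_distrib, ← Finset.mul_sum, ← hm,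
    ← Finset.sum_mul, hp]
  ring

/-- Second-order expansion of a cumulant generating function: mean plus half the variance, the
variance being written as a sum over pairs. The factor `(1 - θ) ^ 2` absorbs the Taylor errors of
`exp` and `log`. -/
lemma log_sum_exp_ge {T : Type*} [Fintype T] (p s : T → ℝ) (hp0 : ∀ t, 0 ≤ p t)
    (hp : ∑ t, p t = 1) {R θ : ℝ} (hs : ∀ t, |s t| ≤ R) (hR1 : 2 * R ≤ θ) (hθ : θ ≤ 1) :
    (∑ t, p t * s t) + (1 - θ) ^ 2 * (1 / 4 * ∑ t, ∑ u, p t * p u * (s t - s u) ^ 2) ≤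
      Real.log (∑ t, p t * Real.exp (s t)) := by
  set m := ∑ u, p u * s u with hm
  set v := ∑ t, p t * (s t - m) ^ 2 with hv
  have hvv := sum_weight_sq_sub p s hp
  rw [← hm, ← hv] at hvv
  have hne : ∃ t, p t ≠ 0 := by
    by_contra! h
    simp [h] at hp
  obtain ⟨t0, _⟩ := hne
  have hR0 : 0 ≤ R := (abs_nonneg _).trans (hs t0)
  have hmR : |m| ≤ R := by
    calc |m| ≤ ∑ u, |p u * s u| := Finset.abs_sum_le_sum_abs _ _
      _ ≤ ∑ u, p u * R := Finset.sum_le_sum fun u _ => by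
          rw [abs_mul, abs_of_nonneg (hp0 u)]; exact mul_le_mul_of_nonneg_left (hs u) (hp0 u)
      _ = R := by rw [← Finset.sum_mul, hp, one_mul]
  have hy : ∀ t, |s t - m| ≤ θ := fun t => by
    have := abs_sub (s t) m
    linarith [hs t]
  have hθ0 : 0 ≤ θ := by linarith
  have hv0 : 0 ≤ v := Finset.sum_nonneg fun t _ => mul_nonneg (hp0 t) (sq_nonneg _)
  have hv1 : v ≤ θ := by
    calc v ≤ ∑ t, p t * θ := Finset.sum_le_sum fun t _ => by
          refine mul_le_mul_of_nonneg_left ?_ (hp0 t)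
          rw [← sq_abs]
          nlinarith [hy t, abs_nonneg (s t - m)]
      _ = θ := by rw [← Finset.sum_mul, hp, one_mul]
  have h1 : 1 + (1 - θ) * v / 2 ≤ ∑ t, p t * Real.exp (s t - m) := by
    calc 1 + (1 - θ) * v / 2
        = ∑ t, p t * (1 + (s t - m) + (1 - θ) * (s t - m) ^ 2 / 2) := by
          have : ∀ t, p t * (1 + (s t - m) + (1 - θ) * (s t - m) ^ 2 / 2) =
              p t + p t * s t - m * p t + (1 - θ) / 2 * (p t * (s t - m) ^ 2) := fun t => by ring
          simp only [this, Finset.sum_add_distrib, Finset.sum_sub_distrib, ← Finset.mul_sum,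
            ← hm, hp, ← hv]
          ring
      _ ≤ _ := Finset.sum_le_sum fun t _ =>
          mul_le_mul_of_nonneg_left (one_add_add_sq_le_exp (hy t) hθ) (hp0 t)
  have h2 : ∑ t, p t * Real.exp (s t) = Real.exp m * ∑ t, p t * Real.exp (s t - m) := by
    rw [Finset.mul_sum]
    refine Finset.sum_congr rfl fun t _ => ?_
    rw [Real.exp_sub]; field_simp
  set w := (1 - θ) * v / 2 with hw
  have hw0 : 0 ≤ w := by have : 0 ≤ 1 - θ := by linarith
                         positivity
  have hw1 : w ≤ θ := by nlinarith
  have h3 : w * (1 - θ) ≤ Real.log (1 + w) := by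
    refine le_trans ?_ (Real.one_sub_inv_le_log_of_pos (by linarith))
    have : 1 - (1 + w)⁻¹ = w / (1 + w) := by field_simp; ring
    rw [this, le_div_iff₀ (by linarith)]
    nlinarith [mul_nonneg hw0 hw0, mul_nonneg hw0 hθ0, mul_nonneg hw0 (sub_nonneg.2 hw1)]
  have hpos : 0 < ∑ t, p t * Real.exp (s t - m) := by linarith
  rw [h2, Real.log_mul (Real.exp_pos _).ne' hpos.ne', Real.log_exp]
  have h4 := Real.log_le_log (by linarith) h1
  have h5 : (1 - θ) ^ 2 * (1 / 4 * ∑ t, ∑ u, p t * p u * (s t - s u) ^ 2) = w * (1 - θ) := by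
    rw [hw, hvv]; ring
  linarith

/-- The log-partition function. -/
noncomputable def logSumExp {T : Type*} [Fintype T] (x : T → ℝ) : ℝ := Real.log (∑ t, Real.exp (x t))

variable {ι T : Type*} [Fintype ι] [DecidableEq ι] [Fintype T] [Nonempty T]

lemma sum_exp_pos (x : T → ℝ) : 0 < ∑ t, Real.exp (x t) :=
  Finset.sum_pos (fun _ _ => Real.exp_pos _) Finset.univ_nonempty

lemma le_logSumExp (x : T → ℝ) (t : T) : x t ≤ logSumExp x := by
  rw [logSumExp, Real.le_log_iff_exp_le (sum_exp_pos x)]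
  exact Finset.single_le_sum (f := fun t => Real.exp (x t)) (fun _ _ => (Real.exp_pos _).le)
    (Finset.mem_univ t)

lemma iSup_le_logSumExp (x : T → ℝ) : ⨆ t, x t ≤ logSumExp x := ciSup_le (le_logSumExp x)

lemma logSumExp_le (x : T → ℝ) : logSumExp x ≤ Real.log (Fintype.card T) + ⨆ t, x t := by
  have h : ∑ t, Real.exp (x t) ≤ Fintype.card T * Real.exp (⨆ t, x t) := by
    rw [← nsmul_eq_mul, ← Finset.card_univ, ← Finset.sum_const]
    exact Finset.sum_le_sum fun t _ =>
      Real.exp_le_exp.2 (le_ciSup (Finite.bddAbove_range x) t)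
  have hc : (0 : ℝ) < Fintype.card T := by exact_mod_cast Fintype.card_pos
  calc logSumExp x ≤ Real.log (Fintype.card T * Real.exp (⨆ t, x t)) :=
        Real.log_le_log (sum_exp_pos x) h
    _ = _ := by rw [Real.log_mul hc.ne' (Real.exp_pos _).ne', Real.log_exp]

/-- For the Gibbs weights `p` of `x`, the first-order terms average to zero and the variance term
averages to `∑ p t * p u * ‖a t - a u‖ ^ 2`. Separation bounds this below by `ε ^ 2 * (1 - ∑ p t ^
2)`, and `∑ p t ^ 2` is at most the largest weight, which is the exponential in the statement. -/
lemma avgStep_logSumExp_ge (a : T → ι → ℝ) {ε θ : ℝ} (hθ : θ ≤ 1)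
    (ha : ∀ t, 2 * ∑ i, |a t i| ≤ θ)
    (hsep : ∀ t u, t ≠ u → ε ^ 2 ≤ ∑ i, (a t i - a u i) ^ 2) (x : T → ℝ) :
    logSumExp x + (1 - θ) ^ 2 * (ε ^ 2 / 4) * (1 - Real.exp ((⨆ t, x t) - logSumExp x)) ≤
      avgStep a logSumExp x := by
  classical
  set Z := ∑ t, Real.exp (x t) with hZ
  have hZ0 : 0 < Z := sum_exp_pos x
  set p : T → ℝ := fun t => Real.exp (x t) / Z with hp
  have hp0 : ∀ t, 0 ≤ p t := fun t => by positivity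
  have hp1 : ∑ t, p t = 1 := by rw [← Finset.sum_div, ← hZ, div_self hZ0.ne']
  set P := Real.exp ((⨆ t, x t) - logSumExp x) with hP
  have hpP : ∀ t, p t ≤ P := fun t => by
    rw [hP, Real.exp_sub, logSumExp, Real.exp_log hZ0]
    exact div_le_div_of_nonneg_right
      (Real.exp_le_exp.2 (le_ciSup (Finite.bddAbove_range x) t)) hZ0.le
  have hstep : ∀ σ : ι → Bool, logSumExp x + ((∑ t, p t * signSum σ (a t)) +
      (1 - θ) ^ 2 * (1 / 4 * ∑ t, ∑ u, p t * p u * (signSum σ (a t) - signSum σ (a u)) ^ 2)) ≤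
      logSumExp (fun t => x t + signSum σ (a t)) := by
    intro σ
    have h := log_sum_exp_ge p (fun t => signSum σ (a t)) hp0 hp1 (R := θ / 2) (θ := θ)
      (fun t => (abs_signSum_le σ (a t)).trans (by linarith [ha t])) (by linarith) hθ
    have h2 : logSumExp (fun t => x t + signSum σ (a t)) =
        logSumExp x + Real.log (∑ t, p t * Real.exp (signSum σ (a t))) := by
      have hpos : 0 < ∑ t, p t * Real.exp (signSum σ (a t)) :=
        Finset.sum_pos (fun t _ => by positivity) Finset.univ_nonempty
      rw [logSumExp, logSumExp, ← hZ, ← Real.log_mul hZ0.ne' hpos.ne', Finset.mul_sum]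
      congr 1
      refine Finset.sum_congr rfl fun t _ => ?_
      rw [hp, Real.exp_add]; field_simp
    rw [h2]; linarith
  have havg := Finset.expect_le_expect (s := Finset.univ) (fun σ _ => hstep σ)
  refine le_trans ?_ havg
  have hsq : ∀ t u, 𝔼 σ : ι → Bool, (signSum σ (a t) - signSum σ (a u)) ^ 2 =
      ∑ i, (a t i - a u i) ^ 2 := fun t u => by
    rw [← expect_signSum_sq]
    refine Finset.expect_congr rfl fun σ _ => ?_
    congr 1
    simp [signSum, mul_sub]
  simp only [Finset.expect_add_distrib, Fintype.expect_const, ← Finset.mul_expect,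
    Finset.expect_sum_comm, expect_signSum, hsq, mul_zero, Finset.sum_const_zero, zero_add]
  have hpair : ε ^ 2 * (1 - P) ≤ ∑ t, ∑ u, p t * p u * ∑ i, (a t i - a u i) ^ 2 := by
    have h1 : ∀ t u, p t * p u * ε ^ 2 - (if t = u then p t * P * ε ^ 2 else 0) ≤
        p t * p u * ∑ i, (a t i - a u i) ^ 2 := by
      intro t u
      split_ifs with h
      · subst h
        simp only [sub_self, ne_eq, OfNat.ofNat_ne_zero, not_false_eq_true, zero_pow,
          Finset.sum_const_zero, mul_zero, sub_nonpos]
        exact mul_le_mul_of_nonneg_right (mul_le_mul_of_nonneg_left (hpP t) (hp0 t))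
          (sq_nonneg ε)
      · rw [sub_zero]
        exact mul_le_mul_of_nonneg_left (hsep t u h) (mul_nonneg (hp0 t) (hp0 u))
    refine le_trans (le_of_eq ?_) (Finset.sum_le_sum fun t _ => Finset.sum_le_sum fun u _ => h1 t u)
    simp only [Finset.sum_sub_distrib, Finset.sum_ite_eq, Finset.mem_univ, if_true,
      ← Finset.sum_mul, ← Finset.mul_sum, hp1]
    ring
  have := mul_le_mul_of_nonneg_left hpair (sq_nonneg (1 - θ))
  linarith

/-- If `m < r * Λ`, the recursion forces `Φ` to grow like `(1 + r ^ 2) ^ k`, against the upper bound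
`Λ + m * √k`. -/
lemma sq_le_of_linear_growth {Φ : ℕ → ℝ} {Λ m r : ℝ} (hr : 0 < r) (hm : 0 ≤ m)
    (h0 : Φ 0 = Λ)
    (hstep : ∀ k : ℕ, Φ k + r ^ 2 * (Φ k - m * √k) ≤ Φ (k + 1))
    (hup : ∀ k : ℕ, Φ k ≤ Λ + m * √k) : r * Λ ≤ m := by
  by_contra! hlt
  have hsqrt : ∀ k : ℕ, m * √k ≤ m / 2 * (r * k + 1 / r) := fun k => by
    have h1 : √(k : ℝ) ≤ (r * k + 1 / r) / 2 := by
      have h2 : √(k : ℝ) ^ 2 = k := Real.sq_sqrt (Nat.cast_nonneg k)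
      have h3 : (r * k + 1 / r) / 2 - √(k : ℝ) = (r * √(k : ℝ) - 1) ^ 2 / (2 * r) := by
        rw [← h2]; field_simp; ring_nf; simp
      have h4 : 0 ≤ (r * √(k : ℝ) - 1) ^ 2 / (2 * r) := by positivity
      linarith
    calc m * √k ≤ m * ((r * k + 1 / r) / 2) := mul_le_mul_of_nonneg_left h1 hm
      _ = _ := by ring
  -- The left side solves the recursion exactly once `√k` is replaced by `(r * k + 1 / r) / 2`. Its
  -- linear part has the same slope as the resulting upper bound, so only the geometric term has to
  -- win.
  have hlow : ∀ k : ℕ, m * r / 2 * k + m / r + (Λ - m / r) * (1 + r ^ 2) ^ k ≤ Φ k := by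
    intro k
    induction k with
    | zero => simp [h0]
    | succ k ih =>
      refine le_trans ?_ (hstep k)
      have h1 := hsqrt k
      have h2 : (1 + r ^ 2) * (m * r / 2 * k + m / r + (Λ - m / r) * (1 + r ^ 2) ^ k) ≤
          (1 + r ^ 2) * Φ k := mul_le_mul_of_nonneg_left ih (by positivity)
      have h3 : r ^ 2 * (m * √k) ≤ r ^ 2 * (m / 2 * (r * k + 1 / r)) :=
        mul_le_mul_of_nonneg_left h1 (by positivity)
      have h4 : m * r / 2 * ((k + 1 : ℕ) : ℝ) + m / r + (Λ - m / r) * (1 + r ^ 2) ^ (k + 1) =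
          (1 + r ^ 2) * (m * r / 2 * k + m / r + (Λ - m / r) * (1 + r ^ 2) ^ k) -
            r ^ 2 * (m / 2 * (r * k + 1 / r)) := by
        push_cast
        field_simp
        ring
      rw [h4]
      linarith
  have hc : 0 < Λ - m / r := by
    rw [sub_pos, div_lt_iff₀ hr]; linarith
  obtain ⟨k, hk⟩ := pow_unbounded_of_one_lt (Λ / (Λ - m / r))
    (show (1 : ℝ) < 1 + r ^ 2 by nlinarith)
  rw [div_lt_iff₀ hc] at hk
  have h1 := hlow k
  have h2 := hup k
  have h3 := hsqrt k
  have h4 : m / 2 * (r * k + 1 / r) = m * r / 2 * k + m / r / 2 := by ring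
  have h5 : 0 ≤ m / r := by positivity
  nlinarith

/-- Sudakov's minoration, for Rademacher averages of repeated coordinates. -/
theorem log_card_mul_sq_le (a : T → ι → ℝ) {ε w : ℝ} (hε : 0 < ε) (hw : 0 ≤ w)
    (hcard : 2 ≤ Fintype.card T)
    (hsep : ∀ t u, t ≠ u → ε ^ 2 ≤ ∑ i, (a t i - a u i) ^ 2)
    (hwidth : ∀ K : ℕ, 𝔼 σ : Fin K × ι → Bool, ⨆ t, signSum σ (fun p => a t p.2) ≤ w * √K) :
    (1 - 1 / (Fintype.card T : ℝ)) * Real.log (Fintype.card T) * ε ^ 2 ≤ 4 * w ^ 2 := by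
  set N : ℝ := (Fintype.card T : ℝ) with hN
  have hN1 : 1 < N := by rw [hN]; exact_mod_cast hcard
  have hΛ : 0 < Real.log N := Real.log_pos hN1
  have hκ : 0 < 1 - 1 / N := by
    rw [sub_pos, div_lt_one (by linarith)]; exact hN1
  obtain ⟨R, hR0, hR⟩ : ∃ R : ℝ, 0 < R ∧ ∀ t, 2 * ∑ i, |a t i| ≤ R := by
    obtain ⟨R, hR⟩ := Finite.bddAbove_range (fun t => 2 * ∑ i, |a t i|)
    exact ⟨max R 1, by positivity, fun t => (hR ⟨t, rfl⟩).trans (le_max_left _ _)⟩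
  have main : ∀ θ : ℝ, 0 < θ → θ < 1 →
      (1 - θ) ^ 2 * ((1 - 1 / N) * Real.log N * ε ^ 2) ≤ 4 * w ^ 2 := by
    intro θ hθ0 hθ1
    -- Steps are shrunk so that the expansion of the log-partition function applies; `h` cancels in
    -- the end.
    set h := θ / R with hh
    have hh0 : 0 < h := by positivity
    set b : T → ι → ℝ := fun t i => h * a t i with hb
    have hstep := avgStep_logSumExp_ge b (ε := h * ε) (θ := θ) hθ1.le
      (fun t => by
        simp only [hb, abs_mul, abs_of_pos hh0, ← Finset.mul_sum]
        calc 2 * (h * ∑ i, |a t i|) = h * (2 * ∑ i, |a t i|) := by ring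
          _ ≤ h * R := mul_le_mul_of_nonneg_left (hR t) hh0.le
          _ = θ := by rw [hh]; field_simp)
      (fun t u htu => by
        simp only [hb, ← mul_sub, mul_pow, ← Finset.mul_sum]
        exact mul_le_mul_of_nonneg_left (hsep t u htu) (by positivity))
    -- The rate of gain per unit of excess: the one-step gain times the slope of the chord of `exp`.
    set A := (1 - θ) ^ 2 * ((h * ε) ^ 2 / 4) * (1 - 1 / N) / Real.log N with hA
    have hθ' : 0 < 1 - θ := by linarith
    have hA0 : 0 < A := by positivity
    have hpt : ∀ x : T → ℝ, (1 + A) * logSumExp x + (-A) * (⨆ t, x t) + 0 ≤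
        avgStep b logSumExp x := by
      intro x
      refine le_trans ?_ (hstep x)
      have h1 := one_sub_exp_neg_ge hN1 (u := logSumExp x - ⨆ t, x t)
        (by linarith [iSup_le_logSumExp x]) (by linarith [logSumExp_le x])
      rw [neg_sub] at h1
      have h2 := mul_le_mul_of_nonneg_left h1
        (show 0 ≤ (1 - θ) ^ 2 * ((h * ε) ^ 2 / 4) by positivity)
      have h3 : (1 - θ) ^ 2 * ((h * ε) ^ 2 / 4) *
          ((1 - 1 / N) * ((logSumExp x - ⨆ t, x t) / Real.log N)) =
          A * (logSumExp x - ⨆ t, x t) := by rw [hA]; field_simp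
      rw [h3] at h2
      linarith
    set Φ : ℕ → ℝ := fun k => (avgStep b)^[k] logSumExp 0 with hΦ
    have hmax : ∀ k : ℕ, (avgStep b)^[k] (fun x => ⨆ t, x t) 0 ≤ h * w * √k := by
      intro k
      rw [avgStep_iterate]
      calc 𝔼 σ : Fin k × ι → Bool, ⨆ t, ((0 : T → ℝ) t + signSum σ (fun p => b t p.2))
          = 𝔼 σ : Fin k × ι → Bool, h * ⨆ t, signSum σ (fun p => a t p.2) := by
            refine Finset.expect_congr rfl fun σ _ => ?_
            rw [Real.mul_iSup_of_nonneg hh0.le]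
            simp only [hb, signSum_const_mul, Pi.zero_apply, zero_add]
        _ ≤ h * (w * √k) := by
            rw [← Finset.mul_expect]
            exact mul_le_mul_of_nonneg_left (hwidth k) hh0.le
        _ = _ := by ring
    have h0 : Φ 0 = Real.log N := by simp [hΦ, logSumExp, hN]
    have hrec : ∀ k : ℕ, Φ k + √A ^ 2 * (Φ k - h * w * √k) ≤ Φ (k + 1) := by
      intro k
      rw [Real.sq_sqrt hA0.le]
      have h1 := avgStep_iterate_mono b k hpt 0
      rw [avgStep_iterate_affine, ← Function.iterate_succ_apply] at h1
      have h2 := mul_le_mul_of_nonneg_left (hmax k) hA0.le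
      simp only [hΦ]
      linarith
    have hup : ∀ k : ℕ, Φ k ≤ Real.log N + h * w * √k := by
      intro k
      have h1 := avgStep_iterate_mono b k
        (f := logSumExp) (g := fun x => 0 * logSumExp x + 1 * (⨆ t, x t) + Real.log N)
        (fun x => by linarith [logSumExp_le x]) 0
      rw [avgStep_iterate_affine] at h1
      have h2 := hmax k
      simp only [hΦ]
      linarith
    have key := sq_le_of_linear_growth (Real.sqrt_pos.2 hA0) (by positivity) h0 hrec hup
    have key2 : A * Real.log N ^ 2 ≤ (h * w) ^ 2 := by
      have := pow_le_pow_left₀ (by positivity) key 2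
      rwa [mul_pow, Real.sq_sqrt hA0.le] at this
    have e : A * Real.log N ^ 2 =
        h ^ 2 / 4 * ((1 - θ) ^ 2 * ((1 - 1 / N) * Real.log N * ε ^ 2)) := by
      rw [hA]; field_simp
    rw [e, mul_pow] at key2
    have hh2 : 0 < h ^ 2 := by positivity
    nlinarith
  -- Letting `θ` tend to zero removes the loss from the Taylor expansion.
  have hcont : Filter.Tendsto
      (fun θ : ℝ => (1 - θ) ^ 2 * ((1 - 1 / N) * Real.log N * ε ^ 2))
      (nhdsWithin 0 (Set.Ioi 0)) (nhds ((1 - 0) ^ 2 * ((1 - 1 / N) * Real.log N * ε ^ 2))) :=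
    (Continuous.tendsto (by fun_prop) 0).mono_left nhdsWithin_le_nhds
  have hle := le_of_tendsto hcont (b := 4 * w ^ 2) (by
    filter_upwards [Ioo_mem_nhdsGT (show (0 : ℝ) < 1 by norm_num)] with θ hθ
    exact main θ hθ.1 hθ.2)
  simpa using hle

end Sudakov

/-! ### Unit classes and their Rademacher width -/

/-- The values on a sample of the normalized units in layer `ℓ + 1`: absolutely convex
combinations of the features `ψ`, respectively of activated units of the previous layer. -/
def unitClass {d n : ℕ} (φ : ℝ → ℝ) (ψ : Fin d → Fin n → ℝ) : ℕ → Set (Fin n → ℝ)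
  | 0 => {g | ∃ c : Fin d → ℝ, ∑ a, |c a| ≤ 1 ∧ g = fun i => ∑ a, c a * ψ a i}
  | ℓ + 1 => {g | ∃ (m : ℕ) (c : Fin m → ℝ) (z : Fin m → Fin n → ℝ), ∑ j, |c j| ≤ 1 ∧
      (∀ j, z j ∈ unitClass φ ψ ℓ) ∧ g = fun i => ∑ j, c j * φ (z j i)}

lemma IsActivation.abs_sub_le {φ : ℝ → ℝ} (hφ : IsActivation φ) (x y : ℝ) :
    |φ x - φ y| ≤ |x - y| := by
  simpa [Real.dist_eq] using hφ.lipschitz.dist_le_mul x y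

lemma IsActivation.abs_le {φ : ℝ → ℝ} (hφ : IsActivation φ) (x : ℝ) : |φ x| ≤ |x| := by
  simpa [hφ.map_zero] using hφ.abs_sub_le x 0

lemma abs_sum_mul_le_of_abs_le {κ : Type*} [Fintype κ] {c x : κ → ℝ} {B : ℝ} (hB : 0 ≤ B)
    (hc : ∑ j, |c j| ≤ 1) (hx : ∀ j, |x j| ≤ B) : |∑ j, c j * x j| ≤ B := by
  calc |∑ j, c j * x j| ≤ ∑ j, |c j * x j| := Finset.abs_sum_le_sum_abs _ _
    _ ≤ ∑ j, |c j| * B := Finset.sum_le_sum fun j _ => by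
        rw [abs_mul]; exact mul_le_mul_of_nonneg_left (hx j) (abs_nonneg _)
    _ = (∑ j, |c j|) * B := by rw [Finset.sum_mul]
    _ ≤ 1 * B := mul_le_mul_of_nonneg_right hc hB
    _ = B := one_mul B

lemma sq_sum_mul_le {κ : Type*} (s : Finset κ) (c x : κ → ℝ) :
    (∑ j ∈ s, c j * x j) ^ 2 ≤ (∑ j ∈ s, |c j|) * ∑ j ∈ s, |c j| * x j ^ 2 := by
  refine Finset.sum_sq_le_sum_mul_sum_of_sq_le_mul s (fun j _ => abs_nonneg _)
    (fun j _ => by positivity) (fun j _ => le_of_eq ?_)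
  rw [mul_pow, ← sq_abs (c j)]
  ring

lemma sum_sq_sum_mul_le {κ : Type*} [Fintype κ] {n : ℕ} {c : κ → ℝ} {x : κ → Fin n → ℝ} {Q : ℝ}
    (hc : ∑ j, |c j| ≤ 1) (hQ : 0 ≤ Q) (hx : ∀ j, ∑ i, x j i ^ 2 ≤ Q) :
    ∑ i, (∑ j, c j * x j i) ^ 2 ≤ Q := by
  calc ∑ i, (∑ j, c j * x j i) ^ 2 ≤ ∑ i, ∑ j, |c j| * x j i ^ 2 :=
        Finset.sum_le_sum fun i _ => (sq_sum_mul_le _ _ _).trans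
          (mul_le_of_le_one_left (Finset.sum_nonneg fun j _ => by positivity) hc)
    _ = ∑ j, |c j| * ∑ i, x j i ^ 2 := by
        rw [Finset.sum_comm]; simp only [Finset.mul_sum]
    _ ≤ ∑ j, |c j| * Q :=
        Finset.sum_le_sum fun j _ => mul_le_mul_of_nonneg_left (hx j) (abs_nonneg _)
    _ ≤ Q := by rw [← Finset.sum_mul]; exact mul_le_of_le_one_left hQ hc

section UnitClass

variable {d n : ℕ} {φ : ℝ → ℝ} {ψ : Fin d → Fin n → ℝ}

lemma unitClass_const_mul {ℓ : ℕ} {g : Fin n → ℝ} (hg : g ∈ unitClass φ ψ ℓ) {α : ℝ}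
    (hα : |α| ≤ 1) : (fun i => α * g i) ∈ unitClass φ ψ ℓ := by
  cases ℓ with
  | zero =>
    obtain ⟨c, hc, rfl⟩ := hg
    refine ⟨fun a => α * c a, ?_, ?_⟩
    · simp only [abs_mul, ← Finset.mul_sum]
      exact mul_le_one₀ hα (by positivity) hc
    · funext i; simp only [Finset.mul_sum, mul_assoc]
  | succ ℓ =>
    obtain ⟨m, c, z, hc, hz, rfl⟩ := hg
    refine ⟨m, fun a => α * c a, z, ?_, hz, ?_⟩
    · simp only [abs_mul, ← Finset.mul_sum]
      exact mul_le_one₀ hα (by positivity) hc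
    · funext i; simp only [Finset.mul_sum, mul_assoc]

lemma zero_mem_unitClass (ℓ : ℕ) : (0 : Fin n → ℝ) ∈ unitClass φ ψ ℓ := by
  cases ℓ with
  | zero => exact ⟨0, by simp, by funext i; simp⟩
  | succ ℓ => exact ⟨0, 0, 0, by simp, fun j => j.elim0, by funext i; simp⟩

lemma unitClass_sum_sq_le (hφ : IsActivation φ) {Q : ℝ} (hQ : 0 ≤ Q)
    (hψ : ∀ a, ∑ i, ψ a i ^ 2 ≤ Q) : ∀ {ℓ : ℕ} {g : Fin n → ℝ}, g ∈ unitClass φ ψ ℓ →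
    ∑ i, g i ^ 2 ≤ Q
  | 0, g, hg => by
    obtain ⟨c, hc, rfl⟩ := hg
    exact sum_sq_sum_mul_le hc hQ hψ
  | ℓ + 1, g, hg => by
    obtain ⟨m, c, z, hc, hz, rfl⟩ := hg
    refine sum_sq_sum_mul_le (x := fun j i => φ (z j i)) hc hQ fun j => ?_
    refine le_trans (Finset.sum_le_sum fun i _ => ?_) (unitClass_sum_sq_le hφ hQ hψ (hz j))
    exact sq_le_sq.2 (hφ.abs_le _)

lemma unitClass_eq_of_eq {i i' : Fin n} (hψ : ∀ a, ψ a i = ψ a i') :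
    ∀ {ℓ : ℕ} {g : Fin n → ℝ}, g ∈ unitClass φ ψ ℓ → g i = g i'
  | 0, g, hg => by
    obtain ⟨c, hc, rfl⟩ := hg
    simp only [hψ]
  | ℓ + 1, g, hg => by
    obtain ⟨m, c, z, hc, hz, rfl⟩ := hg
    simp only [fun j => unitClass_eq_of_eq hψ (hz j)]

/-- A linear functional on an absolutely convex hull is largest at an atom. At the bottom the
supremum is at most a sum over `d` features and two signs; each layer then removes `φ` by
contraction at a factor 2. General `π` and `μ` allow repeated sample points, selection of one row,
and a Laplace parameter. The index type varies because the induction passes to the atoms. -/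
lemma expect_iSup_exp_unitClass_le (hφ : IsActivation φ) (hd : 1 ≤ d)
    {J : Type*} [Fintype J] [DecidableEq J] (π : J → Fin n) (μ : J → ℝ) {Q : ℝ}
    (hQ : ∀ a, ∑ j, (μ j * ψ a (π j)) ^ 2 ≤ Q) (ℓ : ℕ) :
    ∀ {T : Type} [Finite T] [Nonempty T] (g : T → Fin n → ℝ), (∀ t, g t ∈ unitClass φ ψ ℓ) →
    𝔼 σ : J → Bool, ⨆ t, Real.exp |signSum σ (fun j => μ j * g t (π j))| ≤
      2 ^ (ℓ + 1) * d * Real.exp (Q / 2) := by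
  have : NeZero d := ⟨by omega⟩
  induction ℓ with
  | zero =>
    intro T _ _ g hg
    have h1 : ∀ σ : J → Bool, (⨆ t, Real.exp |signSum σ (fun j => μ j * g t (π j))|) ≤
        ∑ a, (Real.exp (signSum σ (fun j => μ j * ψ a (π j))) +
          Real.exp (signSum (fun j => !σ j) (fun j => μ j * ψ a (π j)))) := by
      intro σ
      refine ciSup_le fun t => ?_
      obtain ⟨c, hc, hgt⟩ := hg t
      obtain ⟨a₀, ha₀⟩ := exists_eq_ciSup_of_finite
        (f := fun a => |signSum σ (fun j => μ j * ψ a (π j))|)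
      have h2 : |signSum σ (fun j => μ j * g t (π j))| ≤
          |signSum σ (fun j => μ j * ψ a₀ (π j))| := by
        have h3 : signSum σ (fun j => μ j * g t (π j)) =
            ∑ a, c a * signSum σ (fun j => μ j * ψ a (π j)) := by
          simp only [← signSum_const_mul]
          rw [← signSum_finsetSum]
          congr 1
          funext j
          rw [hgt, Finset.mul_sum]
          exact Finset.sum_congr rfl fun a _ => by ring
        rw [h3]
        refine abs_sum_mul_le_of_abs_le (abs_nonneg _) hc fun a => ?_
        rw [ha₀]
        exact le_ciSup (Finite.bddAbove_range
          (fun a => |signSum σ (fun j => μ j * ψ a (π j))|)) a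
      refine (Real.exp_le_exp.2 h2).trans (le_trans ?_
        (Finset.single_le_sum (fun a _ => by positivity) (Finset.mem_univ a₀)))
      rw [signSum_not]
      have p1 := Real.exp_pos (signSum σ (fun j => μ j * ψ a₀ (π j)))
      have p2 := Real.exp_pos (-signSum σ (fun j => μ j * ψ a₀ (π j)))
      rcases abs_cases (signSum σ (fun j => μ j * ψ a₀ (π j))) with ⟨h, _⟩ | ⟨h, _⟩ <;>
        rw [h] <;> linarith
    refine (Finset.expect_le_expect fun σ _ => h1 σ).trans ?_
    rw [Finset.expect_sum_comm]
    have h2 : ∀ a, 𝔼 σ : J → Bool, (Real.exp (signSum σ (fun j => μ j * ψ a (π j))) +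
          Real.exp (signSum (fun j => !σ j) (fun j => μ j * ψ a (π j)))) ≤
          2 * Real.exp (Q / 2) := by
      intro a
      rw [Finset.expect_add_distrib,
        expect_not (fun σ => Real.exp (signSum σ (fun j => μ j * ψ a (π j)))), ← two_mul]
      have := expect_exp_signSum_le (fun j => μ j * ψ a (π j))
      have h3 := Real.exp_le_exp.2 (div_le_div_of_nonneg_right (hQ a) (show (0 : ℝ) ≤ 2 by norm_num))
      linarith
    refine (Finset.sum_le_sum fun a _ => h2 a).trans (le_of_eq ?_)
    simp
    ring
  | succ ℓ ih =>
    intro T _ _ g hg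
    choose m c z hc hz hgt using hg
    -- The extra index `none`, carrying the zero function, keeps the family nonempty when all
    -- combinations are empty.
    let y : Option (Σ t, Fin (m t)) → Fin n → ℝ := fun o => o.elim 0 fun p => z p.1 p.2
    have hy : ∀ o, y o ∈ unitClass φ ψ ℓ := by
      rintro (_ | p)
      · exact zero_mem_unitClass ℓ
      · exact hz p.1 p.2
    have h1 : ∀ σ : J → Bool, (⨆ t, Real.exp |signSum σ (fun j => μ j * g t (π j))|) ≤
        ⨆ o, Real.exp |signSum σ (fun j => μ j * φ (y o (π j)))| := by
      intro σ
      refine ciSup_le fun t => ?_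
      obtain ⟨o₀, ho₀⟩ := exists_eq_ciSup_of_finite
        (f := fun o => |signSum σ (fun j => μ j * φ (y o (π j)))|)
      have hb := fun o => le_ciSup (Finite.bddAbove_range
        (fun o => |signSum σ (fun j => μ j * φ (y o (π j)))|)) o
      refine le_trans (Real.exp_le_exp.2 ?_) (le_ciSup (Finite.bddAbove_range
        (fun o => Real.exp |signSum σ (fun j => μ j * φ (y o (π j)))|)) o₀)
      have h3 : signSum σ (fun j => μ j * g t (π j)) =
          ∑ a, c t a * signSum σ (fun j => μ j * φ (z t a (π j))) := by
        simp only [← signSum_const_mul]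
        rw [← signSum_finsetSum]
        congr 1
        funext j
        rw [hgt, Finset.mul_sum]
        exact Finset.sum_congr rfl fun a _ => by ring
      rw [h3]
      refine abs_sum_mul_le_of_abs_le (abs_nonneg _) (hc t) fun a => ?_
      rw [ho₀]
      exact hb (some ⟨t, a⟩)
    refine (Finset.expect_le_expect fun σ _ => h1 σ).trans ?_
    have h2 := expect_iSup_exp_abs_signSum_le (fun o j => μ j * y o (π j))
      (fun o j => μ j * φ (y o (π j)))
      (fun o j => by
        rw [abs_mul, abs_mul]; exact mul_le_mul_of_nonneg_left (hφ.abs_le _) (abs_nonneg _))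
      (fun o o' j => by
        rw [← mul_sub, ← mul_sub, abs_mul, abs_mul]
        exact mul_le_mul_of_nonneg_left (hφ.abs_sub_le _ _) (abs_nonneg _))
    refine h2.trans ?_
    refine (mul_le_mul_of_nonneg_left (ih y hy) (by norm_num)).trans (le_of_eq ?_)
    ring

lemma le_sqrt_of_forall_mul_le {X A Q : ℝ} (hQ : 0 ≤ Q)
    (h : ∀ s : ℝ, 0 < s → s * X ≤ A + s ^ 2 * Q / 2) : X ≤ √(2 * A * Q) := by
  rcases le_or_gt X 0 with hX | hX
  · exact hX.trans (Real.sqrt_nonneg _)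
  refine Real.le_sqrt_of_sq_le ?_
  rcases hQ.eq_or_lt with rfl | hQ
  · have hA : 0 ≤ A := by
      have := h 1 one_pos
      simp at this
      linarith
    have := h ((A + 1) / X) (by positivity)
    rw [div_mul_cancel₀ _ hX.ne'] at this
    simp at this
    linarith
  · have := h (X / Q) (by positivity)
    have e1 : X / Q * X = X ^ 2 / Q := by ring
    have e2 : (X / Q) ^ 2 * Q / 2 = X ^ 2 / Q / 2 := by field_simp
    rw [e1, e2] at this
    have h3 : X ^ 2 / Q ≤ 2 * A := by linarith
    rwa [div_le_iff₀ hQ] at h3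

/-- Jensen's inequality in the form of the tangent of `exp` at `C`, followed by optimization over
the Laplace parameter `s`. The layer factors enter only through a logarithm. -/
lemma expect_iSup_abs_unitClass_le (hφ : IsActivation φ) (hd : 1 ≤ d)
    {J : Type*} [Fintype J] [DecidableEq J] (π : J → Fin n) (μ : J → ℝ) {Q : ℝ} (hQ0 : 0 ≤ Q)
    (hQ : ∀ a, ∑ j, (μ j * ψ a (π j)) ^ 2 ≤ Q) (ℓ : ℕ)
    {T : Type} [Finite T] [Nonempty T] (g : T → Fin n → ℝ) (hg : ∀ t, g t ∈ unitClass φ ψ ℓ) :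
    𝔼 σ : J → Bool, ⨆ t, |signSum σ (fun j => μ j * g t (π j))| ≤
      √(2 * Real.log (2 ^ (ℓ + 1) * d) * Q) := by
  have hd0 : (0 : ℝ) < d := by exact_mod_cast hd
  refine le_sqrt_of_forall_mul_le hQ0 fun s hs => ?_
  set C := Real.log (2 ^ (ℓ + 1) * d) + s ^ 2 * Q / 2 with hC
  have h1 := expect_iSup_exp_unitClass_le hφ hd π (fun j => s * μ j) (ψ := ψ) (Q := s ^ 2 * Q)
    (fun a => by
      simp only [mul_assoc, mul_pow, ← Finset.mul_sum]
      refine mul_le_mul_of_nonneg_left ?_ (sq_nonneg s)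
      simpa only [mul_pow] using hQ a) ℓ g hg
  have hE : 2 ^ (ℓ + 1) * (d : ℝ) * Real.exp (s ^ 2 * Q / 2) = Real.exp C := by
    rw [hC, Real.exp_add, Real.exp_log (by positivity)]
  rw [hE] at h1
  have h2 : ∀ σ : J → Bool, s * (⨆ t, |signSum σ (fun j => μ j * g t (π j))|) - C + 1 ≤
      Real.exp (-C) * ⨆ t, Real.exp |signSum σ (fun j => s * μ j * g t (π j))| := by
    intro σ
    obtain ⟨t₀, ht₀⟩ := exists_eq_ciSup_of_finite
      (f := fun t => |signSum σ (fun j => μ j * g t (π j))|)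
    rw [← ht₀]
    have h3 := le_ciSup (Finite.bddAbove_range
      (fun t => Real.exp |signSum σ (fun j => s * μ j * g t (π j))|)) t₀
    refine le_trans ?_ (mul_le_mul_of_nonneg_left h3 (Real.exp_pos _).le)
    simp only [mul_assoc, signSum_const_mul, abs_mul, abs_of_pos hs]
    rw [← Real.exp_add]
    have := Real.add_one_le_exp (-C + s * |signSum σ (fun j => μ j * g t₀ (π j))|)
    linarith
  have h3 := Finset.expect_le_expect (s := Finset.univ) fun σ _ => h2 σ
  rw [Finset.expect_add_distrib, Finset.expect_sub_distrib, ← Finset.mul_expect,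
    ← Finset.mul_expect, Fintype.expect_const, Fintype.expect_const] at h3
  have h4 : Real.exp (-C) * (𝔼 σ : J → Bool,
      ⨆ t, Real.exp |signSum σ (fun j => s * μ j * g t (π j))|) ≤ 1 := by
    calc _ ≤ Real.exp (-C) * Real.exp C := mul_le_mul_of_nonneg_left h1 (Real.exp_pos _).le
      _ = 1 := by rw [← Real.exp_add]; simp
  linarith

/-- The Rademacher width of a product of scaled unit classes. -/
lemma expect_iSup_signSum_prod_le (hφ : IsActivation φ) (hd : 1 ≤ d)
    (hψ : ∀ a, ∑ i, ψ a i ^ 2 ≤ n) {k : ℕ} (v : Fin k → ℝ) (hv : ∀ r, 0 ≤ v r) (ℓ : ℕ)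
    {T : Type} [Finite T] [Nonempty T] (g : T → Fin k → Fin n → ℝ)
    (hg : ∀ t r, g t r ∈ unitClass φ ψ ℓ) (K : ℕ) :
    𝔼 σ : Fin K × (Fin k × Fin n) → Bool, ⨆ t, signSum σ (fun p => v p.2.1 * g t p.2.1 p.2.2) ≤
      (∑ r, v r) * √(2 * Real.log (2 ^ (ℓ + 1) * d) * n) * √K := by
  have h1 : ∀ σ : Fin K × (Fin k × Fin n) → Bool,
      (⨆ t, signSum σ (fun p => v p.2.1 * g t p.2.1 p.2.2)) ≤
      ∑ r, v r * ⨆ t, |signSum σ (fun p => (if p.2.1 = r then 1 else 0) * g t r p.2.2)| := by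
    intro σ
    refine ciSup_le fun t => ?_
    have h2 : signSum σ (fun p => v p.2.1 * g t p.2.1 p.2.2) =
        ∑ r, v r * signSum σ (fun p => (if p.2.1 = r then 1 else 0) * g t r p.2.2) := by
      simp only [← signSum_const_mul]
      rw [← signSum_finsetSum]
      congr 1
      funext p
      simp
    rw [h2]
    refine Finset.sum_le_sum fun r _ => mul_le_mul_of_nonneg_left ?_ (hv r)
    exact (le_abs_self _).trans (le_ciSup (Finite.bddAbove_range
      (fun t => |signSum σ (fun p => (if p.2.1 = r then 1 else 0) * g t r p.2.2)|)) t)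
  refine (Finset.expect_le_expect fun σ _ => h1 σ).trans ?_
  rw [Finset.expect_sum_comm]
  simp only [← Finset.mul_expect]
  rw [mul_assoc, Finset.sum_mul]
  refine Finset.sum_le_sum fun r _ => mul_le_mul_of_nonneg_left ?_ (hv r)
  have h3 := expect_iSup_abs_unitClass_le hφ hd (ψ := ψ)
    (J := Fin K × (Fin k × Fin n)) (fun p => p.2.2) (fun p => if p.2.1 = r then 1 else 0)
    (Q := n * K) (by positivity) (fun a => by
      rw [Fintype.sum_prod_type]
      simp only [Fintype.sum_prod_type, ite_mul, one_mul, zero_mul, ite_pow, ne_eq,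
        OfNat.ofNat_ne_zero, not_false_eq_true, zero_pow]
      rw [Finset.sum_const, Finset.sum_comm]
      simp only [Finset.sum_ite_eq', Finset.mem_univ, if_true, Finset.card_univ, Fintype.card_fin,
        nsmul_eq_mul]
      rw [mul_comm]
      exact mul_le_mul_of_nonneg_right (hψ a) (Nat.cast_nonneg K)) ℓ (fun t => g t r)
    (fun t => hg t r)
  refine h3.trans (le_of_eq ?_)
  rw [← mul_assoc, Real.sqrt_mul' _ (Nat.cast_nonneg K)]

end UnitClass

/-- A maximal separated subset is a net; its size is controlled by Sudakov's minoration. -/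
theorem exists_finset_net_prod_unitClass {d n k : ℕ} {φ : ℝ → ℝ} {ψ : Fin d → Fin n → ℝ}
    (hφ : IsActivation φ) (hd : 1 ≤ d) (hn : 1 ≤ n) (hψ : ∀ a, ∑ i, ψ a i ^ 2 ≤ n)
    (v : Fin k → ℝ) (hv : ∀ r, 0 ≤ v r) (ℓ : ℕ) {δ Y : ℝ} (hδ : 0 < δ)
    (hY1 : Real.log 100 ≤ Y)
    (hY2 : 8 * (∑ r, v r) ^ 2 * Real.log (2 ^ (ℓ + 1) * d) ≤ 0.99 * Y * δ ^ 2) :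
    ∃ s : Finset (Fin k → Fin n → ℝ),
      (∀ a ∈ s, ∀ r, ∃ g ∈ unitClass φ ψ ℓ, a r = fun i => v r * g i) ∧
      (s.card : ℝ) ≤ Real.exp Y ∧
      ∀ a : Fin k → Fin n → ℝ, (∀ r, ∃ g ∈ unitClass φ ψ ℓ, a r = fun i => v r * g i) →
        ∃ b ∈ s, ∑ r, ∑ i, (a r i - b r i) ^ 2 ≤ n * δ ^ 2 := by
  classical
  have hn0 : (0 : ℝ) < n := by exact_mod_cast hn
  have hd1 : (1 : ℝ) ≤ d := by exact_mod_cast hd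
  set sep : Finset (Fin k → Fin n → ℝ) → Prop := fun s =>
    (∀ a ∈ s, ∀ r, ∃ g ∈ unitClass φ ψ ℓ, a r = fun i => v r * g i) ∧
    ∀ a ∈ s, ∀ b ∈ s, a ≠ b → n * δ ^ 2 < ∑ r, ∑ i, (a r i - b r i) ^ 2 with hsep
  have hcard : ∀ s, sep s → (s.card : ℝ) ≤ Real.exp Y := by
    rintro s ⟨hs1, hs2⟩
    -- Small sets are covered by `log 100 ≤ Y`; from 100 points on, the factor `1 - 1 / N` in
    -- Sudakov's bound is at least 0.99.
    by_cases h100 : s.card < 100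
    · refine le_trans ?_ ((Real.log_le_iff_le_exp (by norm_num)).1 hY1)
      exact_mod_cast h100.le
    push Not at h100
    have hsc : Fintype.card s = s.card := Fintype.card_coe s
    have hne : Nonempty s := Fintype.card_pos_iff.1 (by omega)
    choose g hg hga using fun (t : s) => hs1 t.1 t.2
    have hD : 0 ≤ Real.log (2 ^ (ℓ + 1) * (d : ℝ)) :=
      Real.log_nonneg (one_le_mul_of_one_le_of_one_le (one_le_pow₀ (by norm_num)) hd1)
    have hSud := log_card_mul_sq_le (T := s) (ι := Fin k × Fin n)
      (fun t p => v p.1 * g t p.1 p.2) (ε := √n * δ)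
      (w := (∑ r, v r) * √(2 * Real.log (2 ^ (ℓ + 1) * d) * n)) (by positivity)
      (mul_nonneg (Finset.sum_nonneg fun r _ => hv r) (Real.sqrt_nonneg _)) (by omega)
      (fun t u htu => by
        have := hs2 t.1 t.2 u.1 u.2 (fun h => htu (Subtype.ext h))
        rw [mul_pow, Real.sq_sqrt hn0.le, Fintype.sum_prod_type]
        simpa only [hga] using this.le)
      (expect_iSup_signSum_prod_le hφ hd hψ v hv ℓ g hg)
    rw [hsc, mul_pow, mul_pow, Real.sq_sqrt hn0.le, Real.sq_sqrt (by positivity)] at hSud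
    have hN : (100 : ℝ) ≤ s.card := by exact_mod_cast h100
    have hlog : 0 < Real.log s.card := Real.log_pos (by linarith)
    have h1 : (0.99 : ℝ) ≤ 1 - 1 / (s.card : ℝ) := by
      have : 1 / (s.card : ℝ) ≤ 1 / 100 := one_div_le_one_div_of_le (by norm_num) hN
      linarith
    have h2 : 0.99 * Real.log s.card * δ ^ 2 ≤ 0.99 * Y * δ ^ 2 := by
      have h3 : 0.99 * Real.log s.card * (n * δ ^ 2) ≤
          (1 - 1 / (s.card : ℝ)) * Real.log s.card * (n * δ ^ 2) :=
        mul_le_mul_of_nonneg_right (mul_le_mul_of_nonneg_right h1 hlog.le) (by positivity)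
      have h4 : n * (0.99 * Real.log s.card * δ ^ 2) ≤ n * (0.99 * Y * δ ^ 2) := by
        have := mul_le_mul_of_nonneg_left hY2 hn0.le
        linarith
      exact le_of_mul_le_mul_left h4 hn0
    have h3 : Real.log s.card ≤ Y := by
      have hδ2 : 0 < δ ^ 2 := by positivity
      have := le_of_mul_le_mul_right h2 hδ2
      linarith
    exact (Real.log_le_iff_le_exp (by linarith)).1 h3
  -- The uniform size bound makes a separated set of largest cardinality exist; a point far from it
  -- could be added.
  set cards : Set ℕ := {N | ∃ s, sep s ∧ s.card = N} with hcards
  have hne : cards.Nonempty := ⟨0, ∅, by simp [hsep], rfl⟩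
  have hbdd : BddAbove cards := by
    refine ⟨⌊Real.exp Y⌋₊, ?_⟩
    rintro _ ⟨s, hs, rfl⟩
    exact Nat.le_floor (hcard s hs)
  obtain ⟨s, hs, hmax⟩ := Nat.sSup_mem hne hbdd
  refine ⟨s, hs.1, hcard s hs, fun a ha => ?_⟩
  by_contra! hfar
  have has : a ∉ s := fun h => by
    have := hfar a h
    simp only [sub_self, ne_eq, OfNat.ofNat_ne_zero, not_false_eq_true, zero_pow,
      Finset.sum_const_zero] at this
    have h2 : 0 ≤ n * δ ^ 2 := by positivity
    linarith
  have hins : sep (insert a s) := by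
    refine ⟨?_, ?_⟩
    · intro b hb
      rcases Finset.mem_insert.1 hb with rfl | hb
      · exact ha
      · exact hs.1 b hb
    · intro b hb c hc hbc
      rcases Finset.mem_insert.1 hb with rfl | hb' <;> rcases Finset.mem_insert.1 hc with rfl | hc'
      · exact absurd rfl hbc
      · exact hfar c hc'
      · have := hfar b hb'
        simpa only [sub_sq_comm] using this
      · exact hs.2 b hb' c hc' hbc
  have := le_csSup hbdd (show (insert a s).card ∈ cards from ⟨_, hins, rfl⟩)
  rw [Finset.card_insert_of_notMem has] at this
  omega

/-! ### Ramp and margin -/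

section Margin

lemma ramp_sub_le {γ : ℝ} (hγ : 0 < γ) {z w : ℝ} (h : z ≤ w) :
    0 ≤ ramp γ w - ramp γ z ∧ ramp γ w - ramp γ z ≤ (w - z) / γ := by
  have h1 : z < -γ → z / γ < -1 := fun h => by rw [div_lt_iff₀ hγ]; linarith
  have h2 : -γ ≤ z → -1 ≤ z / γ := fun h => by rw [le_div_iff₀ hγ]; linarith
  have h3 : -γ ≤ w → -1 ≤ w / γ := fun h => by rw [le_div_iff₀ hγ]; linarith
  have h4 : w ≤ 0 → w / γ ≤ 0 := fun h => div_nonpos_of_nonpos_of_nonneg h hγ.le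
  have h5 : z ≤ 0 → z / γ ≤ 0 := fun h => div_nonpos_of_nonpos_of_nonneg h hγ.le
  have h6 : 0 ≤ w → 0 ≤ w / γ := fun h => div_nonneg h hγ.le
  have h7 : z / γ ≤ w / γ := div_le_div_of_nonneg_right h hγ.le
  rw [sub_div]
  unfold ramp
  split_ifs <;> constructor <;> grind

lemma abs_ramp_sub_le {γ : ℝ} (hγ : 0 < γ) (z w : ℝ) :
    |ramp γ z - ramp γ w| ≤ |z - w| / γ := by
  rcases le_total z w with h | h
  · have := ramp_sub_le hγ h
    rw [abs_sub_comm, abs_of_nonneg this.1, abs_sub_comm, abs_of_nonneg (sub_nonneg.2 h)]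
    exact this.2
  · have := ramp_sub_le hγ h
    rw [abs_of_nonneg this.1, abs_of_nonneg (sub_nonneg.2 h)]
    exact this.2

lemma ramp_of_nonneg {γ : ℝ} (hγ : 0 < γ) {z : ℝ} (hz : 0 ≤ z) : ramp γ z = 1 := by
  unfold ramp
  rw [if_neg (by linarith)]
  split_ifs with h
  · rw [le_antisymm h hz]; simp
  · rfl

lemma exists_abs_iSup_sub_le {ι : Type*} [Finite ι] [Nonempty ι] (u v : ι → ℝ) :
    ∃ j, |(⨆ j, u j) - ⨆ j, v j| ≤ |u j - v j| := by
  obtain ⟨a, ha⟩ := exists_eq_ciSup_of_finite (f := u)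
  obtain ⟨b, hb⟩ := exists_eq_ciSup_of_finite (f := v)
  rcases le_total (⨆ j, u j) (⨆ j, v j) with h | h
  · refine ⟨b, ?_⟩
    have := le_ciSup (Finite.bddAbove_range u) b
    rw [abs_sub_comm, abs_of_nonneg (sub_nonneg.2 h), abs_sub_comm, ← hb]
    exact (sub_le_sub_left this _).trans (le_abs_self _)
  · refine ⟨a, ?_⟩
    have := le_ciSup (Finite.bddAbove_range v) a
    rw [abs_of_nonneg (sub_nonneg.2 h), ← ha]
    exact (sub_le_sub_left this _).trans (le_abs_self _)

variable {k : ℕ}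

/-- The second largest entry of a vector, counted with multiplicity. -/
noncomputable def secondMax (v : Fin k → ℝ) : ℝ := ⨅ y, ⨆ j : {j : Fin k // j ≠ y}, v j

lemma secondMax_comp_perm (v : Fin k → ℝ) (e : Equiv.Perm (Fin k)) :
    secondMax (fun r => v (e r)) = secondMax v := by
  refine Equiv.iInf_congr e fun y => ?_
  refine (Equiv.iSup_congr (e.subtypeEquiv fun j => ?_) fun j => rfl).symm
  simp

lemma nonempty_ne (hk : 2 ≤ k) (y : Fin k) : Nonempty {j : Fin k // j ≠ y} := by
  have : Nontrivial (Fin k) := Fin.nontrivial_iff_two_le.2 hk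
  obtain ⟨j, hj⟩ := exists_ne y
  exact ⟨⟨j, hj⟩⟩

/-- If `y` attains the infimum in `secondMax`, the arguments agree. Otherwise `v y ≤ secondMax v ≤ ⨆
j ≠ y, v j`, so both arguments are nonnegative and both ramps equal one. -/
lemma ramp_neg_margin {γ : ℝ} (hγ : 0 < γ) (v : Fin k → ℝ) (y : Fin k) :
    ramp γ (-margin v y) = ramp γ (secondMax v - v y) := by
  have : Nonempty (Fin k) := ⟨y⟩
  obtain ⟨y₀, h₀⟩ := exists_eq_ciInf_of_finite
    (f := fun y => ⨆ j : {j : Fin k // j ≠ y}, v j)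
  have hle : secondMax v ≤ ⨆ j : {j : Fin k // j ≠ y}, v j :=
    ciInf_le (Finite.bddBelow_range (fun y => ⨆ j : {j : Fin k // j ≠ y}, v j)) y
  rw [margin, neg_sub]
  by_cases hy : y = y₀
  · subst hy
    rw [h₀]
    rfl
  · have h1 : v y ≤ secondMax v := by
      rw [secondMax, ← h₀]
      exact le_ciSup (Finite.bddAbove_range (fun j : {j : Fin k // j ≠ y₀} => v j)) ⟨y, hy⟩
    rw [ramp_of_nonneg hγ (by linarith), ramp_of_nonneg hγ (by linarith)]

lemma exists_abs_margin_sub_le (hk : 2 ≤ k) (u v : Fin k → ℝ) (y : Fin k) :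
    ∃ j, j ≠ y ∧ |margin u y - margin v y| ≤ |u y - v y| + |u j - v j| := by
  have := nonempty_ne hk y
  obtain ⟨j, hj⟩ := exists_abs_iSup_sub_le (fun j : {j : Fin k // j ≠ y} => u j)
    (fun j : {j : Fin k // j ≠ y} => v j)
  refine ⟨j, j.2, ?_⟩
  rw [margin, margin]
  have e : u y - (⨆ j : {j : Fin k // j ≠ y}, u j) - (v y - ⨆ j : {j : Fin k // j ≠ y}, v j) =
    (u y - v y) - ((⨆ j : {j : Fin k // j ≠ y}, u j) - ⨆ j : {j : Fin k // j ≠ y}, v j) := by ring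
  rw [e]
  exact (abs_sub _ _).trans (by linarith)

/-- Only two coordinates are involved, which gives the constant 2 whatever `k` is. -/
lemma margin_sub_sq_le (hk : 2 ≤ k) (u v : Fin k → ℝ) (y : Fin k) :
    (margin u y - margin v y) ^ 2 ≤ 2 * ∑ j, (u j - v j) ^ 2 := by
  obtain ⟨j, hj, h⟩ := exists_abs_margin_sub_le hk u v y
  have h1 : (u y - v y) ^ 2 + (u j - v j) ^ 2 ≤ ∑ j, (u j - v j) ^ 2 := by
    rw [← Finset.sum_pair (f := fun j => (u j - v j) ^ 2) hj.symm]
    exact Finset.sum_le_sum_of_subset_of_nonneg (Finset.subset_univ _)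
      fun _ _ _ => sq_nonneg _
  rw [← sq_abs]
  have h2 : |margin u y - margin v y| ^ 2 ≤ (|u y - v y| + |u j - v j|) ^ 2 := by gcongr
  have h3 := sq_nonneg (|u y - v y| - |u j - v j|)
  have h4 := sq_abs (u y - v y)
  have h5 := sq_abs (u j - v j)
  nlinarith

lemma abs_margin_le (hk : 2 ≤ k) (v : Fin k → ℝ) (y : Fin k) : |margin v y| ≤ ∑ j, |v j| := by
  obtain ⟨j, hj, h⟩ := exists_abs_margin_sub_le hk v 0 y
  have := nonempty_ne hk y
  have h0 : margin (0 : Fin k → ℝ) y = 0 := by simp [margin]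
  rw [h0, sub_zero] at h
  simp only [Pi.zero_apply, sub_zero] at h
  refine h.trans ?_
  rw [← Finset.sum_pair (f := fun j => |v j|) hj.symm]
  exact Finset.sum_le_sum_of_subset_of_nonneg (Finset.subset_univ _) fun _ _ _ => abs_nonneg _

end Margin

lemma sum_add_sq_le {ι : Type*} (s : Finset ι) (α β : ι → ℝ) {A B : ℝ} (hA : 0 ≤ A) (hB : 0 ≤ B)
    (hα : ∑ i ∈ s, α i ^ 2 ≤ A ^ 2) (hβ : ∑ i ∈ s, β i ^ 2 ≤ B ^ 2) :
    ∑ i ∈ s, (α i + β i) ^ 2 ≤ (A + B) ^ 2 := by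
  have h1 : ∑ i ∈ s, α i * β i ≤ A * B := by
    refine abs_le_of_sq_le_sq' ?_ (by positivity) |>.2
    calc (∑ i ∈ s, α i * β i) ^ 2 ≤ (∑ i ∈ s, α i ^ 2) * ∑ i ∈ s, β i ^ 2 :=
          Finset.sum_mul_sq_le_sq_mul_sq _ _ _
      _ ≤ A ^ 2 * B ^ 2 := mul_le_mul hα hβ (Finset.sum_nonneg fun _ _ => sq_nonneg _)
          (sq_nonneg _)
      _ = _ := by ring
  have h2 : ∑ i ∈ s, (α i + β i) ^ 2 =
      ∑ i ∈ s, α i ^ 2 + 2 * ∑ i ∈ s, α i * β i + ∑ i ∈ s, β i ^ 2 := by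
    simp only [add_sq, Finset.sum_add_distrib, Finset.mul_sum, mul_assoc]
  rw [h2]
  nlinarith

lemma empDist_le_of_sum_sq_le {X : Type*} {n : ℕ} (hn : 1 ≤ n) {S : Fin n → X} {f g : X → ℝ}
    {ε : ℝ} (hε : 0 ≤ ε) (h : ∑ i, (f (S i) - g (S i)) ^ 2 ≤ n * ε ^ 2) : empDist S f g ≤ ε := by
  have hn0 : (0 : ℝ) < n := by exact_mod_cast hn
  refine Real.sqrt_le_iff.2 ⟨hε, ?_⟩
  simp only [sq_abs]
  rw [one_div, inv_mul_le_iff₀ hn0]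
  exact h

lemma coveringNumber_le_encard {X : Type*} {n : ℕ} {ε : ℝ} {F G : Set (X → ℝ)} {S : Fin n → X}
    (h : IsCovering ε F G S) : coveringNumber ε F S ≤ G.encard :=
  iInf₂_le G h

/-! ### Coverings by codes without class labels -/

section Labels

variable {X Ω : Type*} {k n : ℕ}

/-- The candidate labels of a row `a`: those classes carrying a large share of its mass. -/
noncomputable def heavyLabels (y : Fin n → Fin k) (a : Fin n → ℝ) (t : ℝ) : Finset (Fin k) :=
  Finset.univ.filter fun j => t < ∑ i with y i = j, a i ^ 2

/-- Markov's inequality over the disjoint label classes. Strictness leaves room for the additional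
option of no label. -/
lemma card_heavyLabels_lt (y : Fin n → Fin k) (a : Fin n → ℝ) {t : ℝ} {c : ℕ} (hc : 1 ≤ c)
    (h : ∑ i, a i ^ 2 ≤ c * t) : (heavyLabels y a t).card < c := by
  have ht : 0 ≤ t := by
    have h1 : (0 : ℝ) ≤ c * t := (Finset.sum_nonneg fun i _ => sq_nonneg (a i)).trans h
    have h2 : (0 : ℝ) < c := by exact_mod_cast hc
    exact nonneg_of_mul_nonneg_right h1 h2
  rcases (heavyLabels y a t).eq_empty_or_nonempty with he | hne
  · rw [he]; simpa using Nat.lt_of_lt_of_le Nat.zero_lt_one hc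
  have h1 : (heavyLabels y a t).card * t < ∑ i, a i ^ 2 := by
    calc ((heavyLabels y a t).card : ℝ) * t = ∑ _j ∈ heavyLabels y a t, t := by simp
      _ < ∑ j ∈ heavyLabels y a t, ∑ i with y i = j, a i ^ 2 :=
          Finset.sum_lt_sum_of_nonempty hne fun j hj => (Finset.mem_filter.1 hj).2
      _ ≤ ∑ j, ∑ i with y i = j, a i ^ 2 :=
          Finset.sum_le_sum_of_subset_of_nonneg (Finset.subset_univ _)
            fun j _ _ => Finset.sum_nonneg fun i _ => sq_nonneg _
      _ = ∑ i, a i ^ 2 := Finset.sum_fiberwise _ _ _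
  have h2 := h1.trans_le h
  have h3 : ((heavyLabels y a t).card : ℝ) < c := lt_of_mul_lt_mul_right h2 ht
  exact_mod_cast h3

/-- Covering the ramp-margin class by unlabelled codes: the rows of a code only need to match the
outputs up to a permutation, and labels are restored where they carry weight. -/
theorem coveringNumber_le_of_codes [Fintype Ω] (hk : 2 ≤ k) (hn : 1 ≤ n) (S : Fin n → X × Fin k)
    (F : Set (X → Fin k → ℝ)) {γ ε D U : ℝ} (hγ : 0 < γ) (hε : 0 < ε) (hD : 0 ≤ D) (hU : 0 ≤ U)
    (a : Ω → Fin k → Fin n → ℝ) (m : Ω → Fin k → ℕ) (ρ : Ω → Fin k → ℝ) {b M : ℕ} (hb : 1 ≤ b)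
    (ha : ∀ ω r i i', (S i).1 = (S i').1 → a ω r i = a ω r i')
    (hρ : ∀ ω r, ∑ i, a ω r i ^ 2 ≤ n * ρ ω r ^ 2)
    (hm : ∀ ω, ∑ r, m ω r ≤ M)
    (hρU : ∀ ω, ∑ r, ρ ω r ^ 2 / b ^ m ω r ≤ U ^ 2)
    (happrox : ∀ f ∈ F, ∃ ω, ∃ e : Equiv.Perm (Fin k),
      ∑ r, ∑ i, (f (S i).1 (e r) - a ω r i) ^ 2 ≤ n * D ^ 2)
    (hDU : √2 * D + U ≤ γ * ε) :
    coveringNumber ε ((fun f (s : X × Fin k) => ramp γ (-margin (f s.1) s.2)) '' F) S ≤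
      ((Fintype.card Ω * b ^ M : ℕ) : ℕ∞) := by
  classical
  have hn0 : (0 : ℝ) < n := by exact_mod_cast hn
  have hb0 : (0 : ℝ) < b := by exact_mod_cast hb
  -- A row with budget `m` is given fewer than `b ^ m` candidate labels; omitting a label outside
  -- this list costs squared error at most `n * ρ ^ 2 / b ^ m`.
  set lab : Ω → Fin k → Finset (Fin k) := fun ω r =>
    heavyLabels (fun i => (S i).2) (a ω r) (n * ρ ω r ^ 2 / b ^ m ω r) with hlab
  have hlabc : ∀ ω r, (lab ω r).card < b ^ m ω r := fun ω r => by
    refine card_heavyLabels_lt _ _ (Nat.one_le_pow _ _ hb) ?_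
    push_cast
    rw [mul_div_cancel₀ _ (by positivity)]
    exact hρ ω r
  set codes : Finset (Σ _ : Ω, Fin k → Option (Fin k)) :=
    Finset.univ.sigma fun ω => Fintype.piFinset fun r => Finset.insertNone (lab ω r) with hcodes
  have hcodesc : codes.card ≤ Fintype.card Ω * b ^ M := by
    rw [hcodes, Finset.card_sigma, ← Finset.card_univ, ← smul_eq_mul]
    refine Finset.sum_le_card_nsmul _ _ _ fun ω _ => ?_
    rw [Fintype.card_piFinset]
    calc ∏ r, (Finset.insertNone (lab ω r)).card ≤ ∏ r, b ^ m ω r :=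
          Finset.prod_le_prod' fun r _ => by
            rw [Finset.card_insertNone]; exact hlabc ω r
      _ = b ^ ∑ r, m ω r := Finset.prod_pow_eq_pow_sum _ _ _
      _ ≤ b ^ M := Nat.pow_le_pow_right hb (hm ω)
  -- The symmetric part uses all rows; the entry at the true class is the sum of the rows bearing
  -- that label, zero if there is none.
  set val : (Σ _ : Ω, Fin k → Option (Fin k)) → Fin n → ℝ := fun c i =>
    ramp γ (secondMax (fun r => a c.1 r i) -
      ∑ r, if c.2 r = some (S i).2 then a c.1 r i else 0) with hval
  have hfac : ∀ c, (val c).FactorsThrough S := by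
    intro c i i' hii
    have h1 : ∀ r, a c.1 r i = a c.1 r i' := fun r => ha c.1 r i i' (by rw [hii])
    simp only [hval, h1, hii]
  -- A code determines values at sample indices only. They respect coincidences in `S`, so they
  -- extend to functions of `(x, y)`.
  set G : Set (X × Fin k → ℝ) :=
    (fun c => Function.extend S (val c) 0) '' (codes : Set (Σ _ : Ω, Fin k → Option (Fin k)))
    with hG
  have hcov : IsCovering ε ((fun f (s : X × Fin k) => ramp γ (-margin (f s.1) s.2)) '' F) G S := by
    rintro _ ⟨f, hf, rfl⟩
    obtain ⟨ω, e, hω⟩ := happrox f hf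
    -- The true label is restored exactly when it is heavy.
    set l : Fin k → Option (Fin k) := fun r => if e r ∈ lab ω r then some (e r) else none with hl
    refine ⟨_, ⟨⟨ω, l⟩, ?_, rfl⟩, ?_⟩
    · simp only [hcodes, Finset.coe_sigma, Set.mem_sigma_iff, Finset.mem_coe, Finset.mem_univ,
        true_and, Fintype.mem_piFinset]
      intro r
      simp only [hl]
      split_ifs with h
      · exact Finset.some_mem_insertNone.2 h
      · exact Finset.none_mem_insertNone
    refine empDist_le_of_sum_sq_le hn hε.le ?_
    set u : Fin n → Fin k → ℝ := fun i j => a ω (e.symm j) i with hu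
    set β : Fin n → ℝ := fun i =>
      |u i (S i).2 - ∑ r, if l r = some (S i).2 then a ω r i else 0| with hβ
    set α : Fin n → ℝ := fun i => |margin (f (S i).1) (S i).2 - margin (u i) (S i).2| with hα
    have hpt : ∀ i, |ramp γ (-margin (f (S i).1) (S i).2) -
        Function.extend S (val ⟨ω, l⟩) 0 (S i)| ≤ (α i + β i) / γ := by
      intro i
      rw [(hfac ⟨ω, l⟩).extend_apply]
      have h1 := abs_ramp_sub_le hγ (-margin (f (S i).1) (S i).2) (-margin (u i) (S i).2)
      have h2 := abs_ramp_sub_le hγ (secondMax (u i) - u i (S i).2)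
        (secondMax (u i) - ∑ r, if l r = some (S i).2 then a ω r i else 0)
      rw [← ramp_neg_margin hγ] at h2
      have h3 : val ⟨ω, l⟩ i = ramp γ (secondMax (u i) -
          ∑ r, if l r = some (S i).2 then a ω r i else 0) := by
        simp only [hval]
        congr 2
        rw [← secondMax_comp_perm (u i) e]
        simp [hu]
      rw [h3]
      rw [← neg_sub', abs_neg] at h1
      rw [sub_sub_sub_cancel_left, abs_sub_comm _ (u i (S i).2)] at h2
      refine (abs_sub_le _ (ramp γ (-margin (u i) (S i).2)) _).trans ?_
      rw [add_div]
      exact add_le_add h1 h2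
    have hαs : ∑ i, α i ^ 2 ≤ (√n * (√2 * D)) ^ 2 := by
      calc ∑ i, α i ^ 2 ≤ ∑ i, 2 * ∑ j, (f (S i).1 j - u i j) ^ 2 :=
            Finset.sum_le_sum fun i _ => by
              simp only [hα, sq_abs]; exact margin_sub_sq_le hk _ _ _
        _ = 2 * ∑ r, ∑ i, (f (S i).1 (e r) - a ω r i) ^ 2 := by
            rw [← Finset.mul_sum, Finset.sum_comm]
            congr 1
            rw [← Equiv.sum_comp e]
            simp [hu]
        _ ≤ 2 * (n * D ^ 2) := by gcongr
        _ = _ := by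
            rw [mul_pow, mul_pow, Real.sq_sqrt hn0.le, Real.sq_sqrt (by norm_num)]; ring
    have hβs : ∑ i, β i ^ 2 ≤ (√n * U) ^ 2 := by
      have hβi : ∀ i, β i ^ 2 = ∑ r, if (S i).2 = e r then
          (if e r ∈ lab ω r then 0 else a ω r i ^ 2) else 0 := by
        intro i
        have h1 : ∀ r, (l r = some (S i).2) ↔ ((S i).2 = e r ∧ e r ∈ lab ω r) := fun r => by
          simp only [hl]
          split_ifs with h
          · simp [h, eq_comm]
          · simp [h]
        obtain ⟨r₀, hr₀⟩ := e.surjective (S i).2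
        have h2 : ∀ r, (S i).2 = e r ↔ r₀ = r := fun r => by
          rw [← hr₀, e.injective.eq_iff]
        have h3 : u i (S i).2 = a ω r₀ i := by simp [hu, ← hr₀]
        simp only [hβ, sq_abs, h1, h2, ite_and, Finset.sum_ite_eq, Finset.mem_univ, if_true, h3]
        split_ifs <;> simp
      calc ∑ i, β i ^ 2
          = ∑ r, ∑ i, if (S i).2 = e r then
              (if e r ∈ lab ω r then 0 else a ω r i ^ 2) else 0 := by
            simp only [hβi]; exact Finset.sum_comm
        _ ≤ ∑ r, n * (ρ ω r ^ 2 / b ^ m ω r) := by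
            refine Finset.sum_le_sum fun r _ => ?_
            rw [← Finset.sum_filter]
            by_cases h : e r ∈ lab ω r
            · simp only [h, if_true, Finset.sum_const_zero]
              positivity
            · simp only [h, if_false]
              have h' : ¬ (n * ρ ω r ^ 2 / b ^ m ω r < ∑ i with (S i).2 = e r, a ω r i ^ 2) :=
                fun hh => h (Finset.mem_filter.2 ⟨Finset.mem_univ _, hh⟩)
              rw [← mul_div_assoc]
              exact not_lt.1 h'
        _ ≤ n * U ^ 2 := by
            rw [← Finset.mul_sum]; exact mul_le_mul_of_nonneg_left (hρU ω) hn0.le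
        _ = _ := by rw [mul_pow, Real.sq_sqrt hn0.le]
    have hsum := sum_add_sq_le Finset.univ α β (by positivity) (by positivity) hαs hβs
    calc ∑ i, (ramp γ (-margin (f (S i).1) (S i).2) -
          Function.extend S (val ⟨ω, l⟩) 0 (S i)) ^ 2
        ≤ ∑ i, ((α i + β i) / γ) ^ 2 := Finset.sum_le_sum fun i _ => by
          rw [← sq_abs]; gcongr; exact hpt i
      _ = (∑ i, (α i + β i) ^ 2) / γ ^ 2 := by simp only [div_pow, Finset.sum_div]
      _ ≤ (√n * (√2 * D) + √n * U) ^ 2 / γ ^ 2 := by gcongr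
      _ = n * (√2 * D + U) ^ 2 / γ ^ 2 := by
          rw [← mul_add, mul_pow, Real.sq_sqrt hn0.le]
      _ ≤ n * (γ * ε) ^ 2 / γ ^ 2 := by gcongr
      _ = n * ε ^ 2 := by field_simp
  refine (coveringNumber_le_encard hcov).trans ?_
  calc G.encard ≤ (codes : Set (Σ _ : Ω, Fin k → Option (Fin k))).encard := Set.encard_image_le _ _
    _ = (codes.card : ℕ∞) := Set.encard_coe_eq_coe_finsetCard _
    _ ≤ _ := by exact_mod_cast hcodesc

end Labels

/-! ### Normalized input coordinates -/

section InputWeight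

variable {d k n : ℕ}

lemma inputWeight_nonneg (q : ℝ) (S : Fin n → (Fin d → ℝ) × Fin k) (a : Fin d) :
    0 ≤ inputWeight q S a := by
  unfold inputWeight
  split_ifs
  · exact Real.iSup_nonneg fun i => abs_nonneg _
  · positivity

lemma eq_zero_of_inputWeight_eq_zero (hn : 1 ≤ n) {q : ℝ} (hq1 : 1 ≤ q)
    {S : Fin n → (Fin d → ℝ) × Fin k} {a : Fin d} (h : inputWeight q S a = 0) (i : Fin n) :
    (S i).1 a = 0 := by
  unfold inputWeight at h
  split_ifs at h with hq
  · have := le_ciSup (Finite.bddAbove_range fun i => |(S i).1 a|) i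
    rw [h] at this
    exact abs_nonpos_iff.1 this
  · have hq' : 1 < q := lt_of_le_of_ne hq1 (Ne.symm hq)
    have hp : 0 < q.conjExponent := by
      unfold Real.conjExponent
      exact div_pos (by linarith) (by linarith)
    have hn0 : (0 : ℝ) < n := by exact_mod_cast hn
    have hs : 0 ≤ ∑ i, |(S i).1 a| ^ q.conjExponent :=
      Finset.sum_nonneg fun i _ => by positivity
    rw [Real.rpow_eq_zero (by positivity) (by positivity)] at h
    have h2 : ∑ i, |(S i).1 a| ^ q.conjExponent = 0 := by
      rcases mul_eq_zero.1 h with h | h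
      · exact absurd h (by positivity)
      · exact h
    have h3 := (Finset.sum_eq_zero_iff_of_nonneg fun i _ => by positivity).1 h2 i
      (Finset.mem_univ i)
    rw [Real.rpow_eq_zero (abs_nonneg _) hp.ne'] at h3
    exact abs_eq_zero.1 h3

/-- The input coordinates on the sample, normalized by their weights. -/
noncomputable def feature (q : ℝ) (S : Fin n → (Fin d → ℝ) × Fin k) (a : Fin d) (i : Fin n) : ℝ :=
  (S i).1 a / inputWeight q S a

lemma inputWeight_mul_feature (hn : 1 ≤ n) {q : ℝ} (hq1 : 1 ≤ q)
    (S : Fin n → (Fin d → ℝ) × Fin k) (a : Fin d) (i : Fin n) :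
    inputWeight q S a * feature q S a i = (S i).1 a := by
  unfold feature
  by_cases h : inputWeight q S a = 0
  · rw [h, zero_mul, eq_zero_of_inputWeight_eq_zero hn hq1 h]
  · rw [mul_div_cancel₀ _ h]

/-- Power means: the normalized coordinate has mean `p`-th power one with `p = q* ≥ 2`. Bernoulli's
inequality for the exponent `2 / p ≤ 1`, summed over the sample, gives the second moment. A zero
weight gives the zero feature by division by zero. -/
lemma sum_feature_sq_le (hn : 1 ≤ n) {q : ℝ} (hq1 : 1 ≤ q) (hq2 : q ≤ 2)
    (S : Fin n → (Fin d → ℝ) × Fin k) (a : Fin d) : ∑ i, feature q S a i ^ 2 ≤ n := by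
  have hn0 : (0 : ℝ) < n := by exact_mod_cast hn
  rcases (inputWeight_nonneg q S a).eq_or_lt with hw | hw
  · simp [feature, ← hw]
  by_cases hq : q = 1
  · have h1 : ∀ i, feature q S a i ^ 2 ≤ 1 := by
      intro i
      rw [sq_le_one_iff_abs_le_one, feature, abs_div, abs_of_pos hw, div_le_one hw, inputWeight,
        if_pos hq]
      exact le_ciSup (Finite.bddAbove_range fun i => |(S i).1 a|) i
    refine (Finset.sum_le_sum fun i _ => h1 i).trans ?_
    simp
  · have hq' : 1 < q := lt_of_le_of_ne hq1 (Ne.symm hq)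
    set p := q.conjExponent with hp
    have hp2 : 2 ≤ p := by
      rw [hp, Real.conjExponent, le_div_iff₀ (by linarith)]
      linarith
    have hs : 0 ≤ 1 / (n : ℝ) * ∑ i, |(S i).1 a| ^ p :=
      mul_nonneg (by positivity) (Finset.sum_nonneg fun i _ => by positivity)
    have hwp : inputWeight q S a ^ p = 1 / (n : ℝ) * ∑ i, |(S i).1 a| ^ p := by
      rw [inputWeight, if_neg hq, ← hp, ← Real.rpow_mul hs, one_div_mul_cancel (by linarith),
        Real.rpow_one]
    have hsum : ∑ i, |feature q S a i| ^ p = n := by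
      have h1 : ∀ i, |feature q S a i| ^ p = |(S i).1 a| ^ p / inputWeight q S a ^ p := fun i => by
        rw [feature, abs_div, abs_of_pos hw, Real.div_rpow (abs_nonneg _) hw.le]
      have h2 : 0 < inputWeight q S a ^ p := by positivity
      simp only [h1]
      rw [← Finset.sum_div, div_eq_iff h2.ne', hwp]
      field_simp
    have h1 : ∀ i, feature q S a i ^ 2 ≤ 1 + 2 / p * (|feature q S a i| ^ p - 1) := by
      intro i
      have h3 : (0 : ℝ) ≤ |feature q S a i| ^ p := by positivity
      have h2 := rpow_one_add_le_one_add_mul_self (s := |feature q S a i| ^ p - 1)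
        (p := 2 / p) (by linarith) (by positivity)
        (by rw [div_le_one (by linarith)]; exact hp2)
      rw [add_sub_cancel, ← Real.rpow_mul (abs_nonneg _), mul_div_cancel₀ _ (by linarith)] at h2
      rw [← sq_abs]
      exact_mod_cast h2
    refine (Finset.sum_le_sum fun i _ => h1 i).trans (le_of_eq ?_)
    rw [Finset.sum_add_distrib, ← Finset.mul_sum, Finset.sum_sub_distrib, hsum]
    simp

end InputWeight

/-! ### Path sums and forward propagation -/

section Forward

/-- Distributivity, summing out one layer at a time. The test function `h` on the last layer lets
the induction absorb the last matrix. -/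
lemma sum_paths_eq {L : ℕ} (width : Fin (L + 1) → ℕ)
    (A : ∀ ℓ : Fin L, Fin (width ℓ.succ) → Fin (width ℓ.castSucc) → ℝ)
    (u : ∀ ℓ, Fin (width ℓ) → ℝ)
    (hu : ∀ (ℓ : Fin L) j, u ℓ.succ j = ∑ i, A ℓ j i * u ℓ.castSucc i) :
    ∀ h : Fin (width (Fin.last L)) → ℝ,
      ∑ j : (∀ ℓ, Fin (width ℓ)), u 0 (j 0) * (∏ ℓ : Fin L, A ℓ (j ℓ.succ) (j ℓ.castSucc)) *
        h (j (Fin.last L)) = ∑ i, u (Fin.last L) i * h i := by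
  induction L with
  | zero =>
    intro h
    simp only [Finset.univ_eq_empty, Finset.prod_empty, mul_one]
    exact Fintype.sum_equiv (Equiv.piUnique (fun ℓ : Fin 1 => Fin (width ℓ)))
      _ _ (fun j => rfl)
  | succ L ih =>
    intro h
    rw [← Equiv.sum_comp (Fin.snocEquiv (fun ℓ : Fin (L + 2) => Fin (width ℓ))),
      Fintype.sum_prod_type]
    refine Finset.sum_congr rfl fun i _ => ?_
    have hrec := ih (fun ℓ => width ℓ.castSucc) (fun ℓ => A ℓ.castSucc) (fun ℓ => u ℓ.castSucc)
      (fun ℓ j => hu ℓ.castSucc j) (fun i' => A (Fin.last L) i i')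
    have hlast := hu (Fin.last L) i
    rw [show u (Fin.last (L + 1)) i = u (Fin.last L).succ i from rfl, hlast, Finset.sum_mul]
    simp only [mul_comm (A (Fin.last L) i _)]
    rw [← Finset.sum_mul, ← hrec, Finset.sum_mul]
    refine Finset.sum_congr rfl fun j _ => ?_
    rw [Fin.prod_univ_castSucc]
    have e1 : ∀ ℓ : Fin (L + 1),
        (Fin.snocEquiv (fun ℓ : Fin (L + 2) => Fin (width ℓ))) (i, j) ℓ.castSucc = j ℓ :=
      fun ℓ => Fin.snoc_castSucc (α := fun ℓ : Fin (L + 2) => Fin (width ℓ)) _ _ _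
    have e2 : (Fin.snocEquiv (fun ℓ : Fin (L + 2) => Fin (width ℓ))) (i, j) (Fin.last (L + 1)) = i :=
      Fin.snoc_last (α := fun ℓ : Fin (L + 2) => Fin (width ℓ)) _ _
    have e0 : (Fin.snocEquiv (fun ℓ : Fin (L + 2) => Fin (width ℓ))) (i, j) 0 = j 0 := e1 0
    have e3 : ∀ ℓ : Fin L,
        (Fin.snocEquiv (fun ℓ : Fin (L + 2) => Fin (width ℓ))) (i, j) ℓ.castSucc.succ = j ℓ.succ :=
      fun ℓ => e1 ℓ.succ
    have e4 : (Fin.snocEquiv (fun ℓ : Fin (L + 2) => Fin (width ℓ))) (i, j) (Fin.last L).succ = i :=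
      e2
    simp only [e0, e1, e2, e3, e4]
    rw [← mul_assoc (u 0 (j 0))]
    rfl

lemma exists_normalized_coeff {κ : Type*} [Fintype κ] (e : κ → ℝ) :
    ∃ c : κ → ℝ, ∑ j, |c j| ≤ 1 ∧ ∀ j, e j = (∑ j, |e j|) * c j := by
  have h0 : 0 ≤ ∑ j, |e j| := Finset.sum_nonneg fun j _ => abs_nonneg _
  refine ⟨fun j => e j / ∑ j, |e j|, ?_, fun j => ?_⟩
  · simp only [abs_div, abs_of_nonneg h0, ← Finset.sum_div]
    exact div_self_le_one _
  · by_cases h : ∑ j, |e j| = 0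
    · have := (Finset.sum_eq_zero_iff_of_nonneg fun j _ => abs_nonneg _).1 h j (Finset.mem_univ j)
      rw [h, zero_mul, abs_eq_zero.1 this]
    · rw [mul_div_cancel₀ _ h]

end Forward

namespace Network

variable {d k L n : ℕ}

/-- The total weight of the paths from the input to a unit. -/
noncomputable def forwardMass (N : Network d k L) (q : ℝ) (S : Fin n → (Fin d → ℝ) × Fin k)
    (ℓ : Fin (L + 1)) : Fin (N.width ℓ) → ℝ :=
  Fin.induction (motive := fun ℓ => Fin (N.width ℓ) → ℝ)
    (fun j => inputWeight q S (Fin.cast N.width_zero j))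
    (fun ℓ u j => ∑ i, |N.W ℓ j i| * u i) ℓ

lemma forwardMass_succ (N : Network d k L) (q : ℝ) (S : Fin n → (Fin d → ℝ) × Fin k) (ℓ : Fin L)
    (j : Fin (N.width ℓ.succ)) :
    N.forwardMass q S ℓ.succ j = ∑ i, |N.W ℓ j i| * N.forwardMass q S ℓ.castSucc i := rfl

lemma preact_succ (N : Network d k L) (φ : ℝ → ℝ) (x : Fin d → ℝ) (ℓ : Fin L)
    (j : Fin (N.width ℓ.succ)) :
    N.preact φ x ℓ.succ j = ∑ i, N.W ℓ j i *
      (if (ℓ : ℕ) = 0 then N.preact φ x ℓ.castSucc i else φ (N.preact φ x ℓ.castSucc i)) := rfl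

lemma forwardMass_nonneg (N : Network d k L) (q : ℝ) (S : Fin n → (Fin d → ℝ) × Fin k)
    (ℓ : Fin (L + 1)) : ∀ j, 0 ≤ N.forwardMass q S ℓ j := by
  induction ℓ using Fin.induction with
  | zero => exact fun j => inputWeight_nonneg _ _ _
  | succ ℓ ih =>
    intro j
    rw [forwardMass_succ]
    exact Finset.sum_nonneg fun i _ => mul_nonneg (abs_nonneg _) (ih i)

lemma pathVariation_eq (N : Network d k L) (q : ℝ) (S : Fin n → (Fin d → ℝ) × Fin k) :
    N.pathVariation q S = ∑ j, N.forwardMass q S (Fin.last L) j := by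
  have h := sum_paths_eq N.width (fun ℓ j i => |N.W ℓ j i|) (N.forwardMass q S)
    (fun ℓ j => rfl) (fun _ => 1)
  simp only [mul_one] at h
  exact h

/-- The forward masses of the previous layer are pulled out of `φ` by homogeneity, or are zero and
harmless since `φ 0 = 0`. Together with the weights they form coefficients of total absolute value
equal to the new mass, so dividing by it leaves an absolutely convex combination. -/
lemma exists_unit_preact (N : Network d k L) {φ : ℝ → ℝ} (hφ : IsActivation φ) (hn : 1 ≤ n)
    {q : ℝ} (hq1 : 1 ≤ q) (S : Fin n → (Fin d → ℝ) × Fin k) (m : ℕ) : ∀ (hm : m < L)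
    (j : Fin (N.width (Fin.succ ⟨m, hm⟩))), ∃ g ∈ unitClass φ (feature q S) m,
      ∀ i, N.preact φ (S i).1 (Fin.succ ⟨m, hm⟩) j = N.forwardMass q S (Fin.succ ⟨m, hm⟩) j * g i := by
  induction m with
  | zero =>
    intro hm j
    let e : Fin d ≃ Fin (N.width (Fin.castSucc ⟨0, hm⟩)) := finCongr N.width_zero.symm
    obtain ⟨c, hc, hce⟩ := exists_normalized_coeff (fun a : Fin d =>
      N.W ⟨0, hm⟩ j (e a) * inputWeight q S a)
    refine ⟨_, ⟨c, hc, rfl⟩, fun i => ?_⟩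
    have hmass : N.forwardMass q S (Fin.succ ⟨0, hm⟩) j =
        ∑ a, |N.W ⟨0, hm⟩ j (e a) * inputWeight q S a| := by
      rw [forwardMass_succ, ← Equiv.sum_comp e]
      refine Finset.sum_congr rfl fun a _ => ?_
      rw [abs_mul, abs_of_nonneg (inputWeight_nonneg q S a)]
      rfl
    rw [hmass, preact_succ, Finset.mul_sum, ← Equiv.sum_comp e]
    refine Finset.sum_congr rfl fun a _ => ?_
    rw [← mul_assoc, ← hce a, mul_assoc, inputWeight_mul_feature hn hq1]
    rfl
  | succ m ih =>
    intro hm j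
    have hm' : m < L := by omega
    choose z hz hzp using ih hm'
    obtain ⟨c, hc, hce⟩ := exists_normalized_coeff (fun a =>
      N.W ⟨m + 1, hm⟩ j a * N.forwardMass q S (Fin.succ ⟨m, hm'⟩) a)
    refine ⟨_, ⟨_, c, z, hc, hz, rfl⟩, fun i => ?_⟩
    have hmass : N.forwardMass q S (Fin.succ ⟨m + 1, hm⟩) j =
        ∑ a, |N.W ⟨m + 1, hm⟩ j a * N.forwardMass q S (Fin.succ ⟨m, hm'⟩) a| := by
      rw [forwardMass_succ]
      refine Finset.sum_congr rfl fun a _ => ?_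
      rw [abs_mul, abs_of_nonneg (N.forwardMass_nonneg q S (Fin.succ ⟨m, hm'⟩) a)]
      rfl
    rw [hmass, preact_succ, Finset.mul_sum]
    refine Finset.sum_congr rfl fun a _ => ?_
    rw [← mul_assoc, ← hce a, mul_assoc, if_neg (Nat.succ_ne_zero m)]
    congr 1
    have h1 : N.preact φ (S i).1 (Fin.castSucc ⟨m + 1, hm⟩) a =
        N.forwardMass q S (Fin.succ ⟨m, hm'⟩) a * z a i := hzp a i
    rw [h1]
    rcases (N.forwardMass_nonneg q S (Fin.succ ⟨m, hm'⟩) a).eq_or_lt with h | h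
    · rw [← h, zero_mul, zero_mul, hφ.map_zero]
    · exact hφ.pos_homogeneous _ _ h

/-- On the sample, the outputs are multiples of normalized units, with total weight the path
variation. -/
lemma exists_rows (N : Network d k (L + 1)) {φ : ℝ → ℝ} (hφ : IsActivation φ) (hn : 1 ≤ n)
    {q : ℝ} (hq1 : 1 ≤ q) (S : Fin n → (Fin d → ℝ) × Fin k) :
    ∃ (v : Fin k → ℝ) (g : Fin k → Fin n → ℝ), (∀ j, 0 ≤ v j) ∧
      ∑ j, v j = N.pathVariation q S ∧ (∀ j, g j ∈ unitClass φ (feature q S) L) ∧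
      ∀ i j, N.eval φ (S i).1 j = v j * g j i := by
  choose g hg hgp using N.exists_unit_preact hφ hn hq1 S L (Nat.lt_succ_self L)
  refine ⟨fun j => N.forwardMass q S (Fin.last (L + 1)) (Fin.cast N.width_last.symm j),
    fun j => g (Fin.cast N.width_last.symm j), fun j => N.forwardMass_nonneg q S _ _, ?_,
    fun j => hg _, fun i j => hgp _ i⟩
  rw [pathVariation_eq, ← Equiv.sum_comp (finCongr N.width_last.symm)]
  rfl

lemma weightedPath_nonneg (N : Network d k L) (q : ℝ) (S : Fin n → (Fin d → ℝ) × Fin k)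
    (j : N.Path) : 0 ≤ N.weightedPath q S j :=
  mul_nonneg (inputWeight_nonneg _ _ _) (Finset.prod_nonneg fun _ _ => abs_nonneg _)

lemma pathVariation_nonneg (N : Network d k L) (q : ℝ) (S : Fin n → (Fin d → ℝ) × Fin k) :
    0 ≤ N.pathVariation q S :=
  Finset.sum_nonneg fun j _ => N.weightedPath_nonneg q S j

lemma pathDist_nonneg (N : Network d k L) (q : ℝ) (S : Fin n → (Fin d → ℝ) × Fin k)
    (j : N.Path) : 0 ≤ N.pathDist q S j :=
  div_nonneg (N.weightedPath_nonneg q S j) (N.pathVariation_nonneg q S)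

lemma sum_marginal (N : Network d k L) (q : ℝ) (S : Fin n → (Fin d → ℝ) × Fin k)
    (ℓ : Fin (L + 1)) : ∑ i, N.marginal q S ℓ i = N.pathVariation q S / N.pathVariation q S := by
  unfold marginal
  rw [Finset.sum_fiberwise]
  simp only [pathDist, ← Finset.sum_div]
  rfl

/-- For probabilities, `√p ≥ p`. Total mass zero occurs when the path variation vanishes; then the
entropy is zero because `Real.log 0 = 0`, in agreement with the convention for the complexity. -/
lemma renyiEntropy_half_nonneg {ι : Type*} [Fintype ι] (p : ι → ℝ) (hp : ∀ i, 0 ≤ p i)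
    (h : ∑ i, p i = 0 ∨ ∑ i, p i = 1) : 0 ≤ renyiEntropy (1 / 2) p := by
  refine mul_nonneg (by norm_num) ?_
  rcases h with h | h
  · have h0 : ∀ i, p i = 0 := fun i =>
      (Finset.sum_eq_zero_iff_of_nonneg fun i _ => hp i).1 h i (Finset.mem_univ i)
    simp [h0]
  · refine Real.log_nonneg ?_
    refine h.ge.trans (Finset.sum_le_sum fun i _ => ?_)
    have hi1 : p i ≤ 1 :=
      (Finset.single_le_sum (fun i _ => hp i) (Finset.mem_univ i)).trans_eq h
    rcases (hp i).eq_or_lt with h0 | h0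
    · rw [← h0]; simp
    · calc p i = p i ^ (1 : ℝ) := (Real.rpow_one _).symm
        _ ≤ _ := Real.rpow_le_rpow_of_exponent_ge h0 hi1 (by norm_num)

lemma one_le_pathComplexity (N : Network d k (L + 1)) (q : ℝ)
    (S : Fin n → (Fin d → ℝ) × Fin k) : 1 ≤ N.pathComplexity q S := by
  have h1 : ∀ ℓ, 1 ≤ Real.exp ((1 / 2) * renyiEntropy (1 / 2) (N.marginal q S ℓ)) := by
    intro ℓ
    refine Real.one_le_exp (mul_nonneg (by norm_num) (renyiEntropy_half_nonneg _
      (fun i => Finset.sum_nonneg fun j _ => N.pathDist_nonneg q S j) ?_))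
    rw [sum_marginal]
    by_cases h : N.pathVariation q S = 0
    · left; rw [h]; simp
    · right; exact div_self h
  have h2 : (L : ℝ) ≤ ∑ ℓ ∈ Finset.Ioo (0 : Fin (L + 1 + 1)) (Fin.last (L + 1)),
      Real.exp ((1 / 2) * renyiEntropy (1 / 2) (N.marginal q S ℓ)) := by
    refine le_trans (le_of_eq ?_) (Finset.sum_le_sum fun ℓ _ => h1 ℓ)
    simp
  unfold pathComplexity
  rw [one_div, ← div_eq_inv_mul, one_le_div (by positivity)]
  push_cast
  linarith

end Network

/-! ### Sampling and counting tools -/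

/-- Maurey's empirical method, derandomized by choosing the atoms one at a time. -/
lemma exists_sum_atoms_sq_le {κ α : Type*} [Fintype κ] [Fintype α] (p : α → ℝ)
    (hp0 : ∀ a, 0 ≤ p a) (hp1 : ∑ a, p a = 1) (u : α → κ → ℝ) {R : ℝ}
    (hu : ∀ a, ∑ x, u a x ^ 2 ≤ R) (v : κ → ℝ) (hv : ∀ x, ∑ a, p a * u a x = v x) (M : ℕ) :
    ∃ t : Fin M → α, ∑ x, (∑ s, u (t s) x - M * v x) ^ 2 ≤ M * R := by
  induction M with
  | zero => exact ⟨Fin.elim0, by simp⟩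
  | succ M ih =>
    obtain ⟨t, ht⟩ := ih
    set D : κ → ℝ := fun x => ∑ s, u (t s) x - M * v x with hD
    have havg : ∑ a, p a * ∑ x, (D x + (u a x - v x)) ^ 2 ≤ ∑ x, D x ^ 2 + R := by
      have h1 : ∀ x, ∑ a, p a * (D x + (u a x - v x)) ^ 2 =
          D x ^ 2 + ∑ a, p a * u a x ^ 2 - v x ^ 2 := by
        intro x
        have : ∀ a, p a * (D x + (u a x - v x)) ^ 2 =
            (D x - v x) ^ 2 * p a + 2 * (D x - v x) * (p a * u a x) + p a * u a x ^ 2 :=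
          fun a => by ring
        simp only [this, Finset.sum_add_distrib, ← Finset.mul_sum, hp1, hv]
        ring
      calc ∑ a, p a * ∑ x, (D x + (u a x - v x)) ^ 2
          = ∑ x, (D x ^ 2 + ∑ a, p a * u a x ^ 2 - v x ^ 2) := by
            simp only [Finset.mul_sum]
            rw [Finset.sum_comm]
            simp only [h1]
        _ ≤ ∑ x, (D x ^ 2 + ∑ a, p a * u a x ^ 2) :=
            Finset.sum_le_sum fun x _ => by linarith [sq_nonneg (v x)]
        _ = ∑ x, D x ^ 2 + ∑ a, p a * ∑ x, u a x ^ 2 := by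
            rw [Finset.sum_add_distrib, Finset.sum_comm]
            simp only [Finset.mul_sum]
        _ ≤ ∑ x, D x ^ 2 + ∑ a, p a * R := by
            gcongr with a
            · exact hp0 a
            · exact hu a
        _ = _ := by rw [← Finset.sum_mul, hp1, one_mul]
    obtain ⟨a, ha⟩ : ∃ a, ∑ x, (D x + (u a x - v x)) ^ 2 ≤ ∑ x, D x ^ 2 + R := by
      by_contra! hlt
      refine absurd havg (not_le.2 ?_)
      calc ∑ x, D x ^ 2 + R = ∑ a, p a * (∑ x, D x ^ 2 + R) := by
            rw [← Finset.sum_mul, hp1, one_mul]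
        _ < _ := by
            obtain ⟨a, ha⟩ : ∃ a, 0 < p a := by
              by_contra! h0
              have : ∑ a, p a ≤ 0 := Finset.sum_nonpos fun a _ => h0 a
              linarith
            exact Finset.sum_lt_sum (fun a _ => mul_le_mul_of_nonneg_left (hlt a).le (hp0 a))
              ⟨a, Finset.mem_univ a, mul_lt_mul_of_pos_left (hlt a) ha⟩
    refine ⟨Fin.snoc t a, ?_⟩
    have e : ∀ x, ∑ s, u ((Fin.snoc t a : Fin (M + 1) → α) s) x - ((M + 1 : ℕ) : ℝ) * v x =
        D x + (u a x - v x) := by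
      intro x
      rw [Fin.sum_univ_castSucc]
      simp only [Fin.snoc_castSucc, Fin.snoc_last, hD]
      push_cast
      ring
    simp only [e]
    push_cast
    linarith

/-- Moves the outputs in use into the first `J` slots, so that counting codes no longer involves
`k`. -/
lemma exists_perm_of_card_le {k J : ℕ} (hJ : J ≤ k) (s : Finset (Fin k)) (hs : s.card ≤ J) :
    ∃ e : Equiv.Perm (Fin k), ∀ j ∈ s, (e.symm j : ℕ) < J := by
  classical
  have hcard : ((Finset.univ : Finset (Fin J)).map (Fin.castLEEmb hJ)).card = J := by simp
  obtain ⟨t, ht, htc⟩ := Finset.exists_subset_card_eq (hs.trans hcard.ge)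
  have hst : s.card = t.card := htc.symm
  let e₀ : {x // x ∈ s} ≃ {x // x ∈ t} := Finset.equivOfCardEq hst
  refine ⟨(e₀.extendSubtype).symm, fun j hj => ?_⟩
  have h1 := e₀.extendSubtype_mem j hj
  obtain ⟨r, _, hr⟩ := Finset.mem_map.1 (ht h1)
  rw [Equiv.symm_symm, ← hr]
  exact r.2

/-- Representatives of words of length `M` up to reordering. -/
lemma exists_unordered_words (α : Type*) [Fintype α] [DecidableEq α] (M : ℕ) :
    ∃ w : Sym α M → Fin M → α, ∀ t : Fin M → α, ∃ ω, ∀ F : α → ℝ,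
      ∑ s, F (w ω s) = ∑ s, F (t s) := by
  have hsurj : ∀ ω : Sym α M, ∃ t : Fin M → α, (ω : Multiset α) = Multiset.ofList (List.ofFn t) := by
    rintro ⟨m, hm⟩
    induction m using Quotient.inductionOn with
    | h l =>
      subst hm
      exact ⟨l.get, by simp⟩
  choose w hw using hsurj
  refine ⟨w, fun t => ⟨⟨Multiset.ofList (List.ofFn t), by simp⟩, fun F => ?_⟩⟩
  have h := hw ⟨Multiset.ofList (List.ofFn t), by simp⟩
  have h2 := congrArg (fun m : Multiset α => (m.map F).sum) h
  simp only [Sym.coe_mk, Multiset.map_coe, Multiset.sum_coe, List.map_ofFn, List.sum_ofFn] at h2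
  exact h2.symm

/-- Forgetting the order divides by `M!`, which cancels `M ^ M` up to `e ^ M`: the cost per draw
does not grow with `M` even though the alphabet does. -/
lemma multichoose_le_exp {P M : ℕ} {c : ℝ} (hP : (P : ℝ) ≤ c * M) :
    (P.multichoose M : ℝ) ≤ (Real.exp 1 * (c + 1)) ^ M := by
  rcases Nat.eq_zero_or_pos M with rfl | hM
  · simp
  have hM0 : (0 : ℝ) < M := by exact_mod_cast hM
  have h1 : (P.multichoose M : ℝ) ≤ ((P + M - 1 : ℕ) : ℝ) ^ M / (M.factorial : ℝ) := by
    rw [Nat.multichoose_eq]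
    exact Nat.choose_le_pow_div M _
  have h2 : ((P + M - 1 : ℕ) : ℝ) ≤ (c + 1) * M := by
    have : ((P + M - 1 : ℕ) : ℝ) ≤ ((P + M : ℕ) : ℝ) := by exact_mod_cast Nat.sub_le _ _
    push_cast at this
    linarith
  have h3 : (M : ℝ) ^ M / (M.factorial : ℝ) ≤ Real.exp 1 ^ M := by
    rw [← Real.exp_nat_mul, mul_one]
    exact Real.pow_div_factorial_le_exp _ hM0.le _
  have hc : 0 ≤ c + 1 := by
    have : (0 : ℝ) ≤ (c + 1) * M := (Nat.cast_nonneg _).trans h2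
    exact nonneg_of_mul_nonneg_left this hM0
  calc (P.multichoose M : ℝ) ≤ ((c + 1) * M) ^ M / (M.factorial : ℝ) := h1.trans (by gcongr)
    _ = (c + 1) ^ M * ((M : ℝ) ^ M / (M.factorial : ℝ)) := by rw [mul_pow]; ring
    _ ≤ (c + 1) ^ M * Real.exp 1 ^ M := by gcongr
    _ = _ := by rw [mul_pow]; ring

lemma metricEntropy_le {X : Type*} {n : ℕ} {ε : ℝ} {F : Set (X → ℝ)} {S : Fin n → X} {N : ℕ}
    {Y : ℝ} (h : coveringNumber ε F S ≤ (N : ℕ∞)) (hN : (N : ℝ) ≤ Real.exp Y) :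
    metricEntropy ε F S ≤ (Y : EReal) := by
  unfold metricEntropy
  have h1 : ((coveringNumber ε F S : ℕ∞) : ENNReal) ≤ ENNReal.ofReal (Real.exp Y) := by
    refine (ENat.toENNReal_mono h).trans ?_
    rw [ENat.toENNReal_coe]
    refine le_trans (le_of_eq ?_) (ENNReal.ofReal_le_ofReal hN)
    exact (ENNReal.ofReal_natCast N).symm
  refine (ENNReal.log_monotone h1).trans (le_of_eq ?_)
  rw [ENNReal.log_ofReal_of_pos (Real.exp_pos _), Real.log_exp]

/-- With `m` draws in a row and label base 3, it turns the error `m ^ 2 / 3 ^ m` into `m / 3`, which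
sums over the rows. -/
lemma three_mul_le_three_pow (m : ℕ) : 3 * m ≤ 3 ^ m := by
  induction m with
  | zero => simp
  | succ m ih =>
    rcases Nat.eq_zero_or_pos m with rfl | hm
    · simp
    · rw [pow_succ]; omega

lemma sqrt_two_add_inv_sqrt_three_le : √2 + √(1 / 3) ≤ 2 := by
  have h1 : √2 ≤ 1.415 := Real.sqrt_le_iff.2 ⟨by norm_num, by norm_num⟩
  have h2 : √(1 / 3) ≤ 0.58 := Real.sqrt_le_iff.2 ⟨by norm_num, by norm_num⟩
  linarith

/-- A function on the sample, with values in a class of scaled units for each output. -/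
def IsRowClass {d k n : ℕ} (φ : ℝ → ℝ) (ψ : Fin d → Fin n → ℝ) (ℓ : ℕ)
    (S : Fin n → (Fin d → ℝ) × Fin k) (V : ℝ) (F : Set ((Fin d → ℝ) → Fin k → ℝ)) : Prop :=
  ∀ f ∈ F, ∃ (v : Fin k → ℝ) (g : Fin k → Fin n → ℝ), (∀ j, 0 ≤ v j) ∧ ∑ j, v j ≤ V ∧
    (∀ j, g j ∈ unitClass φ ψ ℓ) ∧ ∀ i j, f (S i).1 j = v j * g j i

/-! ### One layer: Maurey codes -/

section OneLayer

variable {d k n : ℕ} {φ : ℝ → ℝ} {ψ : Fin d → Fin n → ℝ}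

/-- Atoms of the one-layer class: a signed feature placed in one output. -/
def signedAtom (ψ : Fin d → Fin n → ℝ) (α : Fin k × Fin d × Bool) (x : Fin k × Fin n) : ℝ :=
  if α.1 = x.1 then bitSign α.2.2 * ψ α.2.1 x.2 else 0

lemma sum_signedAtom_sq (α : Fin k × Fin d × Bool) :
    ∑ x, signedAtom ψ α x ^ 2 = ∑ i, ψ α.2.1 i ^ 2 := by
  rw [Fintype.sum_prod_type, Finset.sum_comm]
  refine Finset.sum_congr rfl fun i _ => ?_
  simp [signedAtom, ite_pow, mul_pow, bitSign_sq]

/-- The missing mass `1 - ∑ |e j a|` is spread evenly over all atoms; opposite signs cancel, so the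
barycenter is unchanged. -/
lemma exists_weights_signedAtom (hd : 1 ≤ d) (hk : 1 ≤ k) (e : Fin k → Fin d → ℝ)
    (he : ∑ j, ∑ a, |e j a| ≤ 1) :
    ∃ p : Fin k × Fin d × Bool → ℝ, (∀ α, 0 ≤ p α) ∧ ∑ α, p α = 1 ∧
      ∀ x, ∑ α, p α * signedAtom ψ α x = ∑ a, e x.1 a * ψ a x.2 := by
  have hd0 : (0 : ℝ) < d := by exact_mod_cast hd
  have hk0 : (0 : ℝ) < k := by exact_mod_cast hk
  set η : ℝ := (1 - ∑ j, ∑ a, |e j a|) / (2 * k * d) with hη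
  have hη0 : 0 ≤ η := div_nonneg (by linarith) (by positivity)
  refine ⟨fun α => (|e α.1 α.2.1| + bitSign α.2.2 * e α.1 α.2.1) / 2 + η, fun α => ?_, ?_, ?_⟩
  · have h1 : |bitSign α.2.2 * e α.1 α.2.1| = |e α.1 α.2.1| := by
      rw [abs_mul, abs_bitSign, one_mul]
    have h2 := neg_abs_le (bitSign α.2.2 * e α.1 α.2.1)
    rw [h1] at h2
    have : 0 ≤ (|e α.1 α.2.1| + bitSign α.2.2 * e α.1 α.2.1) / 2 := by linarith
    positivity
  · simp only [Fintype.sum_prod_type, Fintype.sum_bool]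
    have h1 : ∀ j a, (|e j a| + bitSign true * e j a) / 2 + η +
        ((|e j a| + bitSign false * e j a) / 2 + η) = |e j a| + 2 * η := fun j a => by
      simp only [bitSign]; norm_num; ring
    simp only [h1, Finset.sum_add_distrib, Finset.sum_const, Finset.card_univ, Fintype.card_fin,
      nsmul_eq_mul]
    rw [hη]
    field_simp
    ring
  · rintro ⟨j, i⟩
    simp only [Fintype.sum_prod_type, Fintype.sum_bool, signedAtom, mul_ite, mul_zero]
    have h1 : ∀ j' : Fin k, (∑ a, ((if j' = j then
        ((|e j' a| + bitSign true * e j' a) / 2 + η) * (bitSign true * ψ a i) else 0) +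
        if j' = j then ((|e j' a| + bitSign false * e j' a) / 2 + η) *
          (bitSign false * ψ a i) else 0)) =
        if j' = j then ∑ a, e j' a * ψ a i else 0 := by
      intro j'
      split_ifs
      · refine Finset.sum_congr rfl fun a _ => ?_
        simp only [bitSign]; norm_num; ring
      · simp
    simp only [h1, Finset.sum_ite_eq', Finset.mem_univ, if_true]

lemma exists_draws (hd : 1 ≤ d) (hk : 1 ≤ k) (hψ : ∀ a, ∑ i, ψ a i ^ 2 ≤ n) {V : ℝ} (hV : 0 < V)
    (v : Fin k → ℝ) (g : Fin k → Fin n → ℝ) (hv : ∀ j, 0 ≤ v j) (hvV : ∑ j, v j ≤ V)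
    (hg : ∀ j, g j ∈ unitClass φ ψ 0) (M : ℕ) :
    ∃ t : Fin M → Fin k × Fin d × Bool,
      ∑ j, ∑ i, (∑ s, signedAtom ψ (t s) (j, i) - M * (v j * g j i / V)) ^ 2 ≤ M * n := by
  choose c hc hgc using hg
  obtain ⟨p, hp0, hp1, hpm⟩ := exists_weights_signedAtom (ψ := ψ) hd hk
    (fun j a => v j * c j a / V) (by
      have h1 : ∀ j a, |v j * c j a / V| = v j * |c j a| / V := fun j a => by
        rw [abs_div, abs_mul, abs_of_nonneg (hv j), abs_of_pos hV]
      simp only [h1, ← Finset.sum_div, ← Finset.mul_sum]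
      rw [div_le_one hV]
      exact (Finset.sum_le_sum fun j _ => mul_le_of_le_one_right (hv j) (hc j)).trans hvV)
  obtain ⟨t, ht⟩ := exists_sum_atoms_sq_le p hp0 hp1 (signedAtom ψ) (R := n)
    (fun α => (sum_signedAtom_sq α).trans_le (hψ _)) (fun x => v x.1 * g x.1 x.2 / V)
    (fun x => by
      rw [hpm, hgc, Finset.mul_sum, Finset.sum_div]
      exact Finset.sum_congr rfl fun a _ => by ring) M
  refine ⟨t, ?_⟩
  rwa [Fintype.sum_prod_type] at ht

/-- A code is an unordered list of `M` atoms placed in the first `min k M` slots; the label budget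
of a row is its number of draws. Maurey gives `D = V / √M`, unlabelled rows give `U = D / √3`, and
`√2 + √(1 / 3) ≤ 2`. -/
theorem coveringNumber_le_of_rowClass_zero (hd : 1 ≤ d) (hk : 2 ≤ k) (hn : 1 ≤ n)
    (S : Fin n → (Fin d → ℝ) × Fin k) (hψ : ∀ a, ∑ i, ψ a i ^ 2 ≤ n)
    (hψS : ∀ a i i', (S i).1 = (S i').1 → ψ a i = ψ a i')
    {F : Set ((Fin d → ℝ) → Fin k → ℝ)} {V γ ε : ℝ} (hV : 0 < V) (hγ : 0 < γ) (hε : 0 < ε)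
    (hF : IsRowClass φ ψ 0 S V F) {M : ℕ} (hM : 1 ≤ M) (hMV : 2 * V ≤ γ * ε * √M) :
    coveringNumber ε ((fun f s => ramp γ (-margin (f s.1) s.2)) '' F) S ≤
      (((min k M * (d * 2)).multichoose M * 3 ^ M : ℕ) : ℕ∞) := by
  classical
  have hn0 : (0 : ℝ) < n := by exact_mod_cast hn
  have hM0 : (0 : ℝ) < M := by exact_mod_cast hM
  obtain ⟨w, hw⟩ := exists_unordered_words (Fin (min k M) × Fin d × Bool) M
  have hcard : Fintype.card (Sym (Fin (min k M) × Fin d × Bool) M) =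
      (min k M * (d * 2)).multichoose M := by
    rw [Sym.card_sym_eq_multichoose]
    simp
  rw [← hcard]
  have hJ : min k M ≤ k := min_le_left _ _
  set lift : Fin (min k M) × Fin d × Bool → Fin k × Fin d × Bool :=
    fun α => (Fin.castLE hJ α.1, α.2) with hlift
  set a : Sym (Fin (min k M) × Fin d × Bool) M → Fin k → Fin n → ℝ := fun ω r i =>
    V / M * ∑ s, signedAtom ψ (lift (w ω s)) (r, i) with ha
  set m : Sym (Fin (min k M) × Fin d × Bool) M → Fin k → ℕ := fun ω r =>
    (Finset.univ.filter fun s => (lift (w ω s)).1 = r).card with hm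
  have hUD : √2 * (V / √M) + V / √M * √(1 / 3) ≤ γ * ε := by
    have h1 : √2 * (V / √M) + V / √M * √(1 / 3) = (√2 + √(1 / 3)) * (V / √M) := by ring
    rw [h1]
    calc (√2 + √(1 / 3)) * (V / √M) ≤ 2 * (V / √M) := by
          gcongr; exact sqrt_two_add_inv_sqrt_three_le
      _ = 2 * V / √M := by ring
      _ ≤ γ * ε := by rw [div_le_iff₀ (by positivity)]; exact hMV
  refine coveringNumber_le_of_codes hk hn S F hγ hε (D := V / √M) (U := V / √M * √(1 / 3))
    (by positivity) (by positivity) a m (fun ω r => V / M * m ω r) (by norm_num) ?_ ?_ ?_ ?_ ?_ hUD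
  · intro ω r i i' hii
    simp only [ha, signedAtom, hψS _ i i' hii]
  · intro ω r
    have h1 : ∀ i, a ω r i = V / M * ∑ s, (if (lift (w ω s)).1 = r then
        bitSign (lift (w ω s)).2.2 else 0) * ψ (lift (w ω s)).2.1 i := fun i => by
      simp only [ha, signedAtom, ite_mul, zero_mul]
    have h2 : ∀ s, |if (lift (w ω s)).1 = r then bitSign (lift (w ω s)).2.2 else 0| =
        if (lift (w ω s)).1 = r then (1 : ℝ) else 0 := fun s => by
      split_ifs
      · exact abs_bitSign _
      · simp
    have h3 : ∑ s, (if (lift (w ω s)).1 = r then (1 : ℝ) else 0) = m ω r := by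
      simp [hm]
    simp only [h1, mul_pow, ← Finset.mul_sum]
    calc (V / M) ^ 2 * ∑ i, (∑ s, (if (lift (w ω s)).1 = r then
          bitSign (lift (w ω s)).2.2 else 0) * ψ (lift (w ω s)).2.1 i) ^ 2
        ≤ (V / M) ^ 2 * ∑ i, (m ω r * ∑ s, (if (lift (w ω s)).1 = r then (1 : ℝ) else 0) *
            ψ (lift (w ω s)).2.1 i ^ 2) := by
          gcongr with i
          have := sq_sum_mul_le Finset.univ (fun s => if (lift (w ω s)).1 = r then
            bitSign (lift (w ω s)).2.2 else 0) (fun s => ψ (lift (w ω s)).2.1 i)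
          simpa only [h2, h3] using this
      _ = (V / M) ^ 2 * (m ω r * ∑ s, (if (lift (w ω s)).1 = r then (1 : ℝ) else 0) *
            ∑ i, ψ (lift (w ω s)).2.1 i ^ 2) := by
          rw [← Finset.mul_sum, Finset.sum_comm]
          simp only [Finset.mul_sum]
      _ ≤ (V / M) ^ 2 * (m ω r * ∑ s, (if (lift (w ω s)).1 = r then (1 : ℝ) else 0) * n) := by
          gcongr with s
          exact hψ _
      _ = n * ((V / M) ^ 2 * (m ω r : ℝ) ^ 2) := by
          rw [← Finset.sum_mul, h3]; ring
  · intro ω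
    refine le_of_eq ?_
    simp only [hm]
    rw [← Finset.card_eq_sum_card_fiberwise (fun s _ => Finset.mem_univ (lift (w ω s)).1)]
    simp
  · intro ω
    have hsum : ∑ r, (m ω r : ℝ) = M := by
      have : ∑ r, m ω r = M := by
        simp only [hm]
        rw [← Finset.card_eq_sum_card_fiberwise (fun s _ => Finset.mem_univ (lift (w ω s)).1)]
        simp
      exact_mod_cast this
    calc ∑ r, (V / M * (m ω r : ℝ)) ^ 2 / ((3 : ℕ) : ℝ) ^ m ω r
        ≤ ∑ r, (V / M) ^ 2 * (1 / 3) * (m ω r : ℝ) := by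
          refine Finset.sum_le_sum fun r _ => ?_
          have h3 : 3 * (m ω r : ℝ) ≤ ((3 : ℕ) : ℝ) ^ m ω r := by
            exact_mod_cast three_mul_le_three_pow (m ω r)
          rw [div_le_iff₀ (by positivity), mul_pow]
          have h4 : 0 ≤ (V / M) ^ 2 * (1 / 3) * (m ω r : ℝ) := by positivity
          have := mul_le_mul_of_nonneg_left h3 h4
          linarith
      _ = (V / √M * √(1 / 3)) ^ 2 := by
          rw [← Finset.mul_sum, hsum, mul_pow, div_pow, div_pow, Real.sq_sqrt hM0.le,
            Real.sq_sqrt (by norm_num)]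
          field_simp
  · intro f hf
    obtain ⟨v, g, hv, hvV, hg, hfg⟩ := hF f hf
    obtain ⟨t, ht⟩ := exists_draws hd (by omega) hψ hV v g hv hvV hg M
    have hused : (Finset.univ.image fun s => (t s).1).card ≤ min k M := by
      refine le_min ((Finset.card_le_univ _).trans (by simp)) (Finset.card_image_le.trans (by simp))
    obtain ⟨e, he⟩ := exists_perm_of_card_le hJ _ hused
    have he' : ∀ s, (e.symm (t s).1 : ℕ) < min k M := fun s =>
      he _ (Finset.mem_image.2 ⟨s, Finset.mem_univ s, rfl⟩)
    obtain ⟨ω, hω⟩ := hw fun s => (⟨e.symm (t s).1, he' s⟩, (t s).2)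
    refine ⟨ω, e, ?_⟩
    have ha' : ∀ r i, a ω r i = V / M * ∑ s, signedAtom ψ (t s) (e r, i) := by
      intro r i
      simp only [ha]
      rw [hω fun α => signedAtom ψ (lift α) (r, i)]
      congr 1
      refine Finset.sum_congr rfl fun s _ => ?_
      have h1 : (Fin.castLE hJ ⟨(e.symm (t s).1 : ℕ), he' s⟩ = r) ↔ (t s).1 = e r := by
        rw [← Equiv.symm_apply_eq]
        rfl
      simp only [signedAtom, hlift, h1]
    calc ∑ r, ∑ i, (f (S i).1 (e r) - a ω r i) ^ 2
        = (V / M) ^ 2 * ∑ r, ∑ i, (∑ s, signedAtom ψ (t s) (e r, i) -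
            M * (v (e r) * g (e r) i / V)) ^ 2 := by
          simp only [Finset.mul_sum]
          refine Finset.sum_congr rfl fun r _ => Finset.sum_congr rfl fun i _ => ?_
          rw [ha', hfg]
          have h2 : v (e r) * g (e r) i = V / M * (M * (v (e r) * g (e r) i / V)) := by
            field_simp
          rw [← mul_pow, mul_sub, ← h2]
          ring
      _ = (V / M) ^ 2 * ∑ j, ∑ i, (∑ s, signedAtom ψ (t s) (j, i) -
            M * (v j * g j i / V)) ^ 2 := by
          rw [Equiv.sum_comp e (fun j => ∑ i, (∑ s, signedAtom ψ (t s) (j, i) -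
            M * (v j * g j i / V)) ^ 2)]
      _ ≤ (V / M) ^ 2 * (M * n) := by gcongr
      _ = n * (V / √M) ^ 2 := by
          rw [div_pow, div_pow, Real.sq_sqrt hM0.le]
          field_simp

/-- The entropy bound for one layer. -/
theorem metricEntropy_le_of_rowClass_zero (hd : 1 ≤ d) (hk : 2 ≤ k) (hn : 1 ≤ n)
    (S : Fin n → (Fin d → ℝ) × Fin k) (hψ : ∀ a, ∑ i, ψ a i ^ 2 ≤ n)
    (hψS : ∀ a i i', (S i).1 = (S i').1 → ψ a i = ψ a i')
    {F : Set ((Fin d → ℝ) → Fin k → ℝ)} {V γ ε : ℝ} (hγ : 0 < γ) (hε : 0 < ε)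
    (hVε : γ * ε < V) (hF : IsRowClass φ ψ 0 S V F) :
    metricEntropy ε ((fun f s => ramp γ (-margin (f s.1) s.2)) '' F) S ≤
      ((9 * (V / (γ * ε)) ^ 2 * (2 + Real.log d) : ℝ) : EReal) := by
  have hV : 0 < V := lt_trans (by positivity) hVε
  have hd1 : (1 : ℝ) ≤ d := by exact_mod_cast hd
  set B := V / (γ * ε) with hB
  have hB1 : 1 < B := by rw [hB, one_lt_div (by positivity)]; exact hVε
  have hB2 : 1 < B ^ 2 := by nlinarith
  -- The least number of draws with `2 * V ≤ γ * ε * √M`. As `B > 1`, it is at most `5 * B ^ 2`, and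
  -- each draw costs at most `3.2 + log d`.
  set M := ⌈4 * B ^ 2⌉₊ with hM
  have hM1 : 4 * B ^ 2 ≤ M := Nat.le_ceil _
  have hM2 : (M : ℝ) ≤ 5 * B ^ 2 := by
    have := (Nat.ceil_lt_add_one (show 0 ≤ 4 * B ^ 2 by positivity)).le
    linarith
  have hMpos : 1 ≤ M := by
    have : (1 : ℝ) ≤ M := by linarith
    exact_mod_cast this
  refine metricEntropy_le (coveringNumber_le_of_rowClass_zero (φ := φ) hd hk hn S hψ hψS hV hγ hε
    hF hMpos ?_) ?_
  · have h1 : 2 * B ≤ √M := by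
      refine Real.le_sqrt_of_sq_le ?_
      linarith
    have h2 : V = B * (γ * ε) := by rw [hB]; field_simp
    calc 2 * V = 2 * B * (γ * ε) := by rw [h2]; ring
      _ ≤ √M * (γ * ε) := by gcongr
      _ = _ := by ring
  · push_cast
    have h1 : (((min k M * (d * 2) : ℕ)).multichoose M : ℝ) ≤
        (Real.exp 1 * (2 * d + 1)) ^ M := by
      refine multichoose_le_exp ?_
      have : ((min k M * (d * 2) : ℕ) : ℝ) ≤ ((M * (d * 2) : ℕ) : ℝ) := by
        exact_mod_cast Nat.mul_le_mul_right _ (min_le_right _ _)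
      refine this.trans (le_of_eq ?_)
      push_cast
      ring
    have h9 : (9 : ℝ) ≤ Real.exp 2.2 := by
      have he : (2.7182818283 : ℝ) ≤ Real.exp 1 := Real.exp_one_gt_d9.le
      have h2 : Real.exp 2.2 ^ 5 = Real.exp 1 ^ 11 := by
        rw [← Real.exp_nat_mul, ← Real.exp_nat_mul]; norm_num
      have h3 : (9 : ℝ) ^ 5 ≤ Real.exp 2.2 ^ 5 := by
        rw [h2]
        calc (9 : ℝ) ^ 5 ≤ 2.7182818283 ^ 11 := by norm_num
          _ ≤ _ := by gcongr
      exact le_of_pow_le_pow_left₀ (by norm_num) (Real.exp_pos _).le h3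
    have hbase : Real.exp 1 * (2 * d + 1) * 3 ≤ Real.exp (3.2 + Real.log d) := by
      rw [show (3.2 : ℝ) + Real.log d = 1 + (2.2 + Real.log d) by ring, Real.exp_add,
        Real.exp_add, Real.exp_log (by linarith), mul_assoc]
      refine mul_le_mul_of_nonneg_left ?_ (Real.exp_pos 1).le
      nlinarith
    calc (((min k M * (d * 2) : ℕ)).multichoose M : ℝ) * 3 ^ M
        ≤ (Real.exp 1 * (2 * d + 1)) ^ M * 3 ^ M := by gcongr
      _ = (Real.exp 1 * (2 * d + 1) * 3) ^ M := (mul_pow _ _ _).symm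
      _ ≤ Real.exp (3.2 + Real.log d) ^ M := by gcongr
      _ = Real.exp (M * (3.2 + Real.log d)) := by rw [Real.exp_nat_mul]
      _ ≤ _ := by
        refine Real.exp_le_exp.2 ?_
        have hlog : 0 ≤ Real.log d := Real.log_nonneg hd1
        calc (M : ℝ) * (3.2 + Real.log d) ≤ 5 * B ^ 2 * (3.2 + Real.log d) := by gcongr
          _ ≤ _ := by nlinarith

end OneLayer

/-! ### Discretization of the output scales -/

/-- Vectors of natural numbers with sum at most `M`. -/
def boundedCounts (J M : ℕ) : Finset (Fin J → ℕ) :=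
  (Fintype.piFinset fun _ => Finset.range (M + 1)).filter fun m => ∑ r, m r ≤ M

lemma mem_boundedCounts {J M : ℕ} {m : Fin J → ℕ} : m ∈ boundedCounts J M ↔ ∑ r, m r ≤ M := by
  simp only [boundedCounts, Finset.mem_filter, Fintype.mem_piFinset, Finset.mem_range,
    Nat.lt_succ_iff, and_iff_right_iff_imp]
  exact fun h r => (Finset.single_le_sum (fun _ _ => Nat.zero_le _) (Finset.mem_univ r)).trans h

/-- Weighting each vector by `2 ^ M * ∏ 2 ^ (-m r) ≥ 1` turns the count into a product of geometric
series. -/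
lemma card_boundedCounts_le (J M : ℕ) : (boundedCounts J M).card ≤ 2 ^ M * 2 ^ J := by
  have hgeom : ∑ j ∈ Finset.range (M + 1), (1 / 2 : ℝ) ^ j ≤ 2 := by
    rw [geom_sum_eq (by norm_num)]
    have : (0 : ℝ) < (1 / 2) ^ (M + 1) := by positivity
    rw [div_le_iff_of_neg (by norm_num)]
    linarith
  have h : ((boundedCounts J M).card : ℝ) ≤ 2 ^ M * 2 ^ J := by
    calc ((boundedCounts J M).card : ℝ) = ∑ _m ∈ boundedCounts J M, (1 : ℝ) := by simp
      _ ≤ ∑ m ∈ boundedCounts J M, 2 ^ M * ∏ r, (1 / 2 : ℝ) ^ m r := by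
          refine Finset.sum_le_sum fun m hm => ?_
          rw [Finset.prod_pow_eq_pow_sum, one_div, inv_pow, ← div_eq_mul_inv,
            one_le_div (by positivity)]
          exact pow_le_pow_right₀ (by norm_num) (mem_boundedCounts.1 hm)
      _ ≤ ∑ m ∈ Fintype.piFinset fun _ : Fin J => Finset.range (M + 1),
            2 ^ M * ∏ r, (1 / 2 : ℝ) ^ m r :=
          Finset.sum_le_sum_of_subset_of_nonneg (Finset.filter_subset _ _)
            fun _ _ _ => by positivity
      _ = 2 ^ M * ∏ _r : Fin J, ∑ j ∈ Finset.range (M + 1), (1 / 2 : ℝ) ^ j := by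
          rw [← Finset.mul_sum, Finset.prod_univ_sum]
      _ ≤ 2 ^ M * ∏ _r : Fin J, (2 : ℝ) := by
          gcongr
      _ = _ := by simp
  exact_mod_cast h

/-- Discretized output scales: up to a permutation of the outputs, the scales above `τ V` are
rounded up to a tenth of `τ V`, and the smaller ones are dropped. -/
lemma exists_scale_profiles (k : ℕ) {V τ : ℝ} (hV : 0 < V) (hτ : 0 < τ) :
    ∃ P : Finset ((Fin k → ℕ) × (Fin k → ℝ)), P.card ≤ 40 ^ ⌊1 / τ⌋₊ ∧
      (∀ p ∈ P, ∑ r, p.1 r ≤ ⌊1 / τ⌋₊ ∧ ∑ r, p.2 r ≤ 1.1 * V ∧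
        ∀ r, 0 ≤ p.2 r ∧ p.2 r ≤ (p.1 r + 1) * (τ * V) ∧ (p.1 r = 0 → p.2 r = 0)) ∧
      ∀ v : Fin k → ℝ, (∀ j, 0 ≤ v j) → ∑ j, v j ≤ V → ∃ p ∈ P, ∃ e : Equiv.Perm (Fin k),
        ∀ r, (τ * V ≤ v (e r) ∧ v (e r) ≤ p.2 r) ∨ (v (e r) < τ * V ∧ p.2 r = 0) := by
  classical
  have hτV : 0 < τ * V := by positivity
  set M := ⌊1 / τ⌋₊ with hM
  set J := min k M with hJ
  -- A profile records, in units of `τ * V`, the integer part of each kept scale and a digit for its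
  -- tenths, rounded up. At most `min k ⌊1 / τ⌋₊` scales are kept, since each is at least one unit.
  set F : (Fin J → ℕ) × (Fin J → Fin 10) → (Fin k → ℕ) × (Fin k → ℝ) := fun x =>
    (fun r => if h : (r : ℕ) < J then x.1 ⟨r, h⟩ else 0,
     fun r => if h : (r : ℕ) < J then (if x.1 ⟨r, h⟩ = 0 then 0 else
      (x.1 ⟨r, h⟩ + ((x.2 ⟨r, h⟩ : ℕ) + 1) / 10) * (τ * V)) else 0) with hF
  have hFsum : ∀ x, ∑ r, (F x).1 r = ∑ r, x.1 r := by
    intro x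
    have hJk : J ≤ k := min_le_left _ _
    symm
    calc ∑ r, x.1 r = ∑ r : Fin J, (F x).1 (Fin.castLE hJk r) := by
          refine Finset.sum_congr rfl fun r _ => ?_
          simp [hF]
      _ = ∑ r ∈ Finset.univ.map (Fin.castLEEmb hJk), (F x).1 r := by simp
      _ = ∑ r, (F x).1 r := by
          refine Finset.sum_subset (Finset.subset_univ _) fun r _ hr => ?_
          simp only [hF]
          rw [dif_neg]
          intro h
          exact hr (Finset.mem_map.2 ⟨⟨r, h⟩, Finset.mem_univ _, by ext; simp⟩)
  refine ⟨((boundedCounts J M ×ˢ Finset.univ).image F).filter fun p => ∑ r, p.2 r ≤ 1.1 * V,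
    ?_, ?_, ?_⟩
  · refine (Finset.card_filter_le _ _).trans (Finset.card_image_le.trans ?_)
    rw [Finset.card_product, Finset.card_univ, Fintype.card_fun, Fintype.card_fin,
      Fintype.card_fin]
    have hJM : J ≤ M := min_le_right _ _
    calc (boundedCounts J M).card * 10 ^ J ≤ 2 ^ M * 2 ^ J * 10 ^ J := by
          gcongr; exact card_boundedCounts_le J M
      _ ≤ 2 ^ M * 2 ^ M * 10 ^ M := by gcongr <;> norm_num
      _ = 40 ^ M := by rw [← mul_pow, ← mul_pow]; norm_num
  · intro p hp
    obtain ⟨hp, hpV⟩ := Finset.mem_filter.1 hp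
    obtain ⟨x, hx, rfl⟩ := Finset.mem_image.1 hp
    refine ⟨(hFsum x).trans_le (mem_boundedCounts.1 (Finset.mem_product.1 hx).1), hpV,
      fun r => ?_⟩
    simp only [hF]
    split_ifs with h h0
    · simp [h0, hτV.le]
    · have h1 : (((x.2 ⟨r, h⟩ : Fin 10) : ℕ) : ℝ) + 1 ≤ 10 := by
        exact_mod_cast (x.2 ⟨r, h⟩).2
      refine ⟨by positivity, ?_, fun h' => absurd h' h0⟩
      gcongr
      linarith
    · simp [hτV.le]
  · intro v hv hvV
    set x : Fin k → ℝ := fun j => v j / (τ * V) with hx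
    have hx0 : ∀ j, 0 ≤ x j := fun j => div_nonneg (hv j) hτV.le
    have hvx : ∀ j, v j = x j * (τ * V) := fun j => by
      simp only [hx]; field_simp
    have hxs : ∑ j, x j ≤ 1 / τ := by
      rw [← Finset.sum_div, div_le_iff₀ hτV]
      refine hvV.trans (le_of_eq ?_)
      field_simp
    have hkept : (Finset.univ.filter fun j => 1 ≤ x j).card ≤ J := by
      refine le_min ((Finset.card_le_univ _).trans (by simp)) (Nat.le_floor ?_)
      calc ((Finset.univ.filter fun j => 1 ≤ x j).card : ℝ)
          = ∑ j with 1 ≤ x j, (1 : ℝ) := by simp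
        _ ≤ ∑ j with 1 ≤ x j, x j :=
            Finset.sum_le_sum fun j hj => (Finset.mem_filter.1 hj).2
        _ ≤ ∑ j, x j := Finset.sum_le_sum_of_subset_of_nonneg (Finset.subset_univ _)
            fun j _ _ => hx0 j
        _ ≤ _ := hxs
    obtain ⟨e, he⟩ := exists_perm_of_card_le (min_le_left k M) _ hkept
    have heJ : ∀ r, 1 ≤ x (e r) → (r : ℕ) < J := fun r hr => by
      have := he (e r) (Finset.mem_filter.2 ⟨Finset.mem_univ _, hr⟩)
      rwa [Equiv.symm_apply_apply] at this
    have hfr : ∀ y : ℝ, 0 ≤ y → ⌊10 * (y - ⌊y⌋₊)⌋₊ < 10 := fun y hy => by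
      rw [Nat.floor_lt (by have := Nat.floor_le hy; linarith)]
      have := Nat.lt_floor_add_one y
      push_cast
      linarith
    set ι : Fin J → Fin k := Fin.castLE (min_le_left k M) with hι
    set z : (Fin J → ℕ) × (Fin J → Fin 10) :=
      (fun r => ⌊x (e (ι r))⌋₊, fun r => ⟨_, hfr (x (e (ι r))) (hx0 _)⟩) with hz
    have hcase : ∀ r, (1 ≤ x (e r) ∧ v (e r) ≤ (F z).2 r ∧ (F z).2 r ≤ 1.1 * v (e r)) ∨
        (x (e r) < 1 ∧ (F z).2 r = 0) := by
      intro r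
      rcases lt_or_ge (x (e r)) 1 with h | h
      · right
        refine ⟨h, ?_⟩
        simp only [hF]
        split_ifs with h1 h2
        · rfl
        · exact absurd (Nat.floor_eq_zero.2 h) h2
        · rfl
      · left
        have hrJ := heJ r h
        have hne : ¬ ⌊x (e r)⌋₊ = 0 := fun h' => not_lt.2 h (Nat.floor_eq_zero.1 h')
        have hval : (F z).2 r =
            (⌊x (e r)⌋₊ + (⌊10 * (x (e r) - ⌊x (e r)⌋₊)⌋₊ + 1) / 10) * (τ * V) := by
          simp only [hF]
          rw [dif_pos hrJ, if_neg]
          · rfl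
          · exact hne
        have h1 := Nat.lt_floor_add_one (10 * (x (e r) - ⌊x (e r)⌋₊))
        have h2 := Nat.floor_le (show 0 ≤ 10 * (x (e r) - ⌊x (e r)⌋₊) by
          have := Nat.floor_le (hx0 (e r)); linarith)
        refine ⟨h, ?_, ?_⟩
        · rw [hval, hvx]
          gcongr
          linarith
        -- Rounding adds at most a tenth of a unit, and a kept scale is at least one unit.
        · rw [hval, hvx, ← mul_assoc 1.1]
          refine mul_le_mul_of_nonneg_right ?_ hτV.le
          linarith
    refine ⟨F z, Finset.mem_filter.2 ⟨Finset.mem_image.2 ⟨z, Finset.mem_product.2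
      ⟨mem_boundedCounts.2 ?_, Finset.mem_univ _⟩, rfl⟩, ?_⟩, e, fun r => ?_⟩
    · refine Nat.le_floor ?_
      push_cast
      calc ∑ r, (⌊x (e (ι r))⌋₊ : ℝ) ≤ ∑ r, x (e (ι r)) :=
            Finset.sum_le_sum fun r _ => Nat.floor_le (hx0 _)
        _ = ∑ r ∈ Finset.univ.map (Fin.castLEEmb (min_le_left k M)), x (e r) := by
            rw [Finset.sum_map]; rfl
        _ ≤ ∑ r, x (e r) := Finset.sum_le_sum_of_subset_of_nonneg (Finset.subset_univ _)
            fun j _ _ => hx0 _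
        _ = ∑ j, x j := Equiv.sum_comp e x
        _ ≤ _ := hxs
    · calc ∑ r, (F z).2 r ≤ ∑ r, 1.1 * v (e r) := by
            refine Finset.sum_le_sum fun r _ => ?_
            rcases hcase r with h | h
            · exact h.2.2
            · rw [h.2]; have := hv (e r); positivity
        _ = 1.1 * ∑ j, v j := by rw [← Finset.mul_sum, Equiv.sum_comp e v]
        _ ≤ _ := by gcongr
    · rcases hcase r with h | h
      · refine Or.inl ⟨?_, h.2.1⟩
        rw [hvx]
        exact le_mul_of_one_le_left hτV.le h.1
      · refine Or.inr ⟨?_, h.2⟩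
        rw [hvx]
        exact mul_lt_of_lt_one_left hτV h.1

/-- Bounds the label error for base 100: a scale of at most `m + 1` units with budget `m` leaves at
most `m / 25` squared units. The case `m = 0` is a dropped row. -/
lemma mul_add_one_sq_le (m : ℕ) : 25 * (m + 1) ^ 2 ≤ m * 100 ^ m ∨ m = 0 := by
  rcases Nat.eq_zero_or_pos m with h | h
  · exact Or.inr h
  · left
    induction m, h using Nat.le_induction with
    | base => norm_num
    | succ m hm ih =>
      have h1 : (m + 1) * 100 ^ (m + 1) = 100 * (m * 100 ^ m) + 100 * 100 ^ m := by ring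
      rw [h1]
      nlinarith

/-! ### At least two layers: nets of unit classes -/

section Deep

variable {d k n : ℕ} {φ : ℝ → ℝ} {ψ : Fin d → Fin n → ℝ}

/-- A code is a scale profile together with a point of the net for its scales. There are at most `40
^ M` profiles and `100 ^ M` labellings, `M = ⌊1 / τ⌋₊`, hence the 4000. The approximation error is
`δ ^ 2` from the net plus `τ * V ^ 2` from the dropped rows. -/
theorem coveringNumber_le_of_rowClass (hφ : IsActivation φ) (hd : 1 ≤ d) (hk : 2 ≤ k) (hn : 1 ≤ n)
    (S : Fin n → (Fin d → ℝ) × Fin k) (hψ : ∀ a, ∑ i, ψ a i ^ 2 ≤ n)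
    (hψS : ∀ a i i', (S i).1 = (S i').1 → ψ a i = ψ a i') (ℓ : ℕ)
    {F : Set ((Fin d → ℝ) → Fin k → ℝ)} {V γ ε τ δ D U Y : ℝ} (hV : 0 < V) (hγ : 0 < γ)
    (hε : 0 < ε) (hτ : 0 < τ) (hδ : 0 < δ) (hD : 0 ≤ D) (hU : 0 ≤ U)
    (hF : IsRowClass φ ψ ℓ S V F) (hY1 : Real.log 100 ≤ Y)
    (hY2 : 8 * (1.1 * V) ^ 2 * Real.log (2 ^ (ℓ + 1) * d) ≤ 0.99 * Y * δ ^ 2)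
    (hδD : δ ^ 2 + τ * V ^ 2 ≤ D ^ 2) (hτU : 0.04 * (τ * V ^ 2) ≤ U ^ 2)
    (hDU : √2 * D + U ≤ γ * ε) :
    ∃ N : ℕ, coveringNumber ε ((fun f s => ramp γ (-margin (f s.1) s.2)) '' F) S ≤ (N : ℕ∞) ∧
      (N : ℝ) ≤ Real.exp Y * 4000 ^ ⌊1 / τ⌋₊ := by
  classical
  have hn0 : (0 : ℝ) < n := by exact_mod_cast hn
  obtain ⟨P, hPc, hP, hPv⟩ := exists_scale_profiles k hV hτ
  have hlog : 0 ≤ Real.log (2 ^ (ℓ + 1) * d) := Real.log_nonneg <|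
    one_le_mul_of_one_le_of_one_le (one_le_pow₀ (by norm_num)) (by exact_mod_cast hd)
  have hnet : ∀ p : {p // p ∈ P}, ∃ s : Finset (Fin k → Fin n → ℝ),
      (∀ a ∈ s, ∀ r, ∃ g ∈ unitClass φ ψ ℓ, a r = fun i => p.1.2 r * g i) ∧
      (s.card : ℝ) ≤ Real.exp Y ∧
      ∀ a : Fin k → Fin n → ℝ, (∀ r, ∃ g ∈ unitClass φ ψ ℓ, a r = fun i => p.1.2 r * g i) →
        ∃ b ∈ s, ∑ r, ∑ i, (a r i - b r i) ^ 2 ≤ n * δ ^ 2 := by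
    rintro ⟨p, hp⟩
    refine exists_finset_net_prod_unitClass hφ hd hn hψ p.2 (fun r => ((hP p hp).2.2 r).1) ℓ hδ
      hY1 (le_trans ?_ hY2)
    have h0 : 0 ≤ ∑ r, p.2 r := Finset.sum_nonneg fun r _ => ((hP p hp).2.2 r).1
    have h1 := (hP p hp).2.1
    gcongr
  choose s hs hsc hsn using hnet
  have hcov := coveringNumber_le_of_codes (Ω := Σ p : {p // p ∈ P}, {a // a ∈ s p}) hk hn S F
    hγ hε hD hU (fun ω => ω.2.1) (fun ω => ω.1.1.1) (fun ω => ω.1.1.2) (b := 100)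
    (M := ⌊1 / τ⌋₊) (by norm_num) ?_ ?_ (fun ω => (hP _ ω.1.2).1) ?_ ?_ hDU
  · refine ⟨_, hcov, ?_⟩
    have h1 : (Fintype.card (Σ p : {p // p ∈ P}, {a // a ∈ s p}) : ℝ) ≤
        40 ^ ⌊1 / τ⌋₊ * Real.exp Y := by
      rw [Fintype.card_sigma]
      push_cast
      simp only [Fintype.card_coe]
      calc ∑ p, ((s p).card : ℝ) ≤ ∑ _p : {p // p ∈ P}, Real.exp Y :=
            Finset.sum_le_sum fun p _ => hsc p
        _ = P.card * Real.exp Y := by simp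
        _ ≤ _ := by gcongr; exact_mod_cast hPc
    push_cast
    calc (Fintype.card (Σ p : {p // p ∈ P}, {a // a ∈ s p}) : ℝ) * 100 ^ ⌊1 / τ⌋₊
        ≤ 40 ^ ⌊1 / τ⌋₊ * Real.exp Y * 100 ^ ⌊1 / τ⌋₊ := by gcongr
      _ = Real.exp Y * (40 ^ ⌊1 / τ⌋₊ * 100 ^ ⌊1 / τ⌋₊) := by ring
      _ = _ := by rw [← mul_pow]; norm_num
  · rintro ⟨p, a, ha⟩ r i i' hii
    obtain ⟨g, hg, hag⟩ := hs p a ha r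
    simp only [hag]
    rw [unitClass_eq_of_eq (fun a => hψS a i i' hii) hg]
  · rintro ⟨p, a, ha⟩ r
    obtain ⟨g, hg, hag⟩ := hs p a ha r
    simp only [hag, mul_pow, ← Finset.mul_sum]
    rw [mul_comm]
    gcongr
    exact unitClass_sum_sq_le hφ hn0.le hψ hg
  · rintro ⟨⟨p, hp⟩, a, ha⟩
    have hMτ : (⌊1 / τ⌋₊ : ℝ) * τ ≤ 1 := by
      have := Nat.floor_le (show 0 ≤ 1 / τ by positivity)
      rwa [le_div_iff₀ hτ] at this
    have hterm : ∀ r, p.2 r ^ 2 / ((100 : ℕ) : ℝ) ^ p.1 r ≤ 0.04 * (τ * V) ^ 2 * p.1 r := by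
      intro r
      obtain ⟨h0, h1, h2⟩ := (hP p hp).2.2 r
      rcases mul_add_one_sq_le (p.1 r) with h | h
      · have h' : 25 * ((p.1 r : ℝ) + 1) ^ 2 ≤ p.1 r * 100 ^ p.1 r := by exact_mod_cast h
        rw [div_le_iff₀ (by positivity)]
        calc p.2 r ^ 2 ≤ ((p.1 r + 1) * (τ * V)) ^ 2 := by gcongr
          _ = 0.04 * (τ * V) ^ 2 * (25 * ((p.1 r : ℝ) + 1) ^ 2) := by ring
          _ ≤ 0.04 * (τ * V) ^ 2 * (p.1 r * 100 ^ p.1 r) := by gcongr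
          _ = _ := by push_cast; ring
      · rw [h2 h, h]; simp
    have hsum : ∑ r, (p.1 r : ℝ) ≤ ⌊1 / τ⌋₊ := by exact_mod_cast (hP p hp).1
    calc ∑ r, p.2 r ^ 2 / ((100 : ℕ) : ℝ) ^ p.1 r
        ≤ ∑ r, 0.04 * (τ * V) ^ 2 * (p.1 r : ℝ) := Finset.sum_le_sum fun r _ => hterm r
      _ = 0.04 * (τ * V) ^ 2 * ∑ r, (p.1 r : ℝ) := by rw [Finset.mul_sum]
      _ ≤ 0.04 * (τ * V) ^ 2 * ⌊1 / τ⌋₊ := by gcongr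
      _ = 0.04 * (τ * V ^ 2) * (⌊1 / τ⌋₊ * τ) := by ring
      _ ≤ 0.04 * (τ * V ^ 2) * 1 := by gcongr
      _ ≤ U ^ 2 := by linarith
  · intro f hf
    obtain ⟨v, g, hv, hvV, hg, hfg⟩ := hF f hf
    obtain ⟨p, hp, e, he⟩ := hPv v hv hvV
    have hτV : 0 < τ * V := by positivity
    obtain ⟨b, hb, hbn⟩ := hsn ⟨p, hp⟩ (fun r i => p.2 r * (v (e r) / p.2 r * g (e r) i))
      fun r => ⟨fun i => v (e r) / p.2 r * g (e r) i, by
        refine unitClass_const_mul (hg _) ?_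
        have h0 := ((hP p hp).2.2 r).1
        rw [abs_of_nonneg (div_nonneg (hv _) h0)]
        rcases he r with h | h
        · exact div_le_one_of_le₀ h.2 h0
        · rw [h.2]; simp, rfl⟩
    refine ⟨⟨⟨p, hp⟩, b, hb⟩, e, ?_⟩
    -- A kept row lies in the class scaled by the rounded-up value. A dropped row is zero in the net
    -- and costs `n * v ^ 2`, less than `n * (τ * V) * v`, which is summable.
    have hrow : ∀ r, ∑ i, (f (S i).1 (e r) - b r i) ^ 2 ≤
        ∑ i, (p.2 r * (v (e r) / p.2 r * g (e r) i) - b r i) ^ 2 + n * (τ * V * v (e r)) := by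
      intro r
      have hpos : 0 ≤ n * (τ * V * v (e r)) := by have := hv (e r); positivity
      rcases he r with h | h
      · have hne : p.2 r ≠ 0 := (hτV.trans_le (h.1.trans h.2)).ne'
        have heq : ∀ i, p.2 r * (v (e r) / p.2 r * g (e r) i) = f (S i).1 (e r) := fun i => by
          rw [hfg]; field_simp
        simp only [heq]
        linarith
      · obtain ⟨g', -, hbg⟩ := hs _ b hb r
        have hb0 : ∀ i, b r i = 0 := fun i => by rw [hbg]; simp [h.2]
        simp only [hb0, h.2, hfg, zero_mul, sub_zero]
        have h1 : ∑ i, (v (e r) * g (e r) i) ^ 2 ≤ n * (τ * V * v (e r)) := by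
          simp only [mul_pow, ← Finset.mul_sum]
          calc v (e r) ^ 2 * ∑ i, g (e r) i ^ 2 ≤ v (e r) ^ 2 * n := by
                gcongr; exact unitClass_sum_sq_le hφ hn0.le hψ (hg _)
            _ = n * (v (e r) * v (e r)) := by ring
            _ ≤ n * (τ * V * v (e r)) := by
                have := hv (e r)
                have := h.1
                gcongr
        simpa using h1
    calc ∑ r, ∑ i, (f (S i).1 (e r) - b r i) ^ 2
        ≤ ∑ r, (∑ i, (p.2 r * (v (e r) / p.2 r * g (e r) i) - b r i) ^ 2 +
            n * (τ * V * v (e r))) := Finset.sum_le_sum fun r _ => hrow r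
      _ = ∑ r, ∑ i, (p.2 r * (v (e r) / p.2 r * g (e r) i) - b r i) ^ 2 +
            n * (τ * V * ∑ j, v j) := by
          rw [Finset.sum_add_distrib, ← Finset.mul_sum, ← Finset.mul_sum, Equiv.sum_comp e v]
      _ ≤ n * δ ^ 2 + n * (τ * V * V) := by gcongr
      _ = n * (δ ^ 2 + τ * V ^ 2) := by ring
      _ ≤ n * D ^ 2 := by gcongr

lemma log_hundred_le : Real.log 100 ≤ 4.7 := by
  rw [Real.log_le_iff_le_exp (by norm_num)]
  have he : (2.7182818283 : ℝ) ≤ Real.exp 1 := Real.exp_one_gt_d9.le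
  have h2 : Real.exp 4.7 ^ 10 = Real.exp 1 ^ 47 := by
    rw [← Real.exp_nat_mul, ← Real.exp_nat_mul]; norm_num
  have h3 : (100 : ℝ) ^ 10 ≤ Real.exp 4.7 ^ 10 := by
    rw [h2]
    calc (100 : ℝ) ^ 10 ≤ 2.7182818283 ^ 47 := by norm_num
      _ ≤ _ := by gcongr
  exact le_of_pow_le_pow_left₀ (by norm_num) (Real.exp_pos _).le h3

lemma four_thousand_le_exp : (4000 : ℝ) ≤ Real.exp 8.3 := by
  have he : (2.7182818283 : ℝ) ≤ Real.exp 1 := Real.exp_one_gt_d9.le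
  have h2 : Real.exp 8.3 ^ 10 = Real.exp 1 ^ 83 := by
    rw [← Real.exp_nat_mul, ← Real.exp_nat_mul]; norm_num
  have h3 : (4000 : ℝ) ^ 10 ≤ Real.exp 8.3 ^ 10 := by
    rw [h2]
    calc (4000 : ℝ) ^ 10 ≤ 2.7182818283 ^ 83 := by norm_num
      _ ≤ _ := by gcongr
  exact le_of_pow_le_pow_left₀ (by norm_num) (Real.exp_pos _).le h3

/-- Tight near `ℓ = 0`, where `35.2 / 0.99` must stay below `9 * 2 ^ 2 = 36`. The factor `L ^ 2 ≥ 4`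
is what makes room for the Sudakov constant, unlike for one layer. -/
lemma entropy_const_le (ℓ : ℕ) {t : ℝ} (ht : 0 ≤ t) :
    35.2 / 0.99 * ((ℓ + 2) * Real.log 2 + t) + 8.3 / 0.15 ≤
      9 * ((ℓ : ℝ) + 2) ^ 2 * (ℓ + 3 + t) := by
  have hℓ : (0 : ℝ) ≤ ℓ := Nat.cast_nonneg ℓ
  have h1 : ((ℓ : ℝ) + 2) * Real.log 2 ≤ (ℓ + 2) * 0.6932 := by
    have := Real.log_two_lt_d9
    gcongr
    linarith
  have h2 : 36 * t ≤ 9 * ((ℓ : ℝ) + 2) ^ 2 * t := by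
    gcongr
    nlinarith
  have h3 : 36 * (((ℓ : ℝ) + 2) * 0.6932) + 56 ≤ 9 * ((ℓ : ℝ) + 2) ^ 2 * (ℓ + 3) := by
    have : 0 ≤ 9 * (ℓ : ℝ) ^ 3 + 63 * ℓ ^ 2 + 100 * ℓ := by positivity
    nlinarith
  have h4 : 35.2 / 0.99 * (((ℓ : ℝ) + 2) * Real.log 2 + t) ≤
      36 * (((ℓ : ℝ) + 2) * 0.6932 + t) := by
    gcongr
    norm_num
  norm_num at h1 h2 h3 h4 ⊢
  linarith

/-- The entropy bound for at least two layers. -/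
theorem metricEntropy_le_of_rowClass_succ (hφ : IsActivation φ) (hd : 1 ≤ d) (hk : 2 ≤ k)
    (hn : 1 ≤ n) (S : Fin n → (Fin d → ℝ) × Fin k) (hψ : ∀ a, ∑ i, ψ a i ^ 2 ≤ n)
    (hψS : ∀ a i i', (S i).1 = (S i').1 → ψ a i = ψ a i') (ℓ : ℕ)
    {F : Set ((Fin d → ℝ) → Fin k → ℝ)} {V γ ε : ℝ} (hγ : 0 < γ) (hε : 0 < ε)
    (hVε : γ * ε < V) (hF : IsRowClass φ ψ (ℓ + 1) S V F) :
    metricEntropy ε ((fun f s => ramp γ (-margin (f s.1) s.2)) '' F) S ≤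
      ((9 * (V / (γ * ε)) ^ 2 * (ℓ + 2) ^ 2 * (ℓ + 3 + Real.log d) : ℝ) : EReal) := by
  have hη : 0 < γ * ε := by positivity
  have hV : 0 < V := hη.trans hVε
  have hd1 : (1 : ℝ) ≤ d := by exact_mod_cast hd
  have hlogd : 0 ≤ Real.log d := Real.log_nonneg hd1
  set η := γ * ε with hηdef
  set B := V / η with hB
  have hVB : V = B * η := by rw [hB]; field_simp
  have hB1 : 1 < B := by rw [hB, one_lt_div hη]; exact hVε
  have hB2 : 1 < B ^ 2 := by nlinarith
  have hl2 := Real.log_two_gt_d9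
  have hl2' := Real.log_two_lt_d9
  have hlog : Real.log (2 ^ (ℓ + 1 + 1) * d) = (ℓ + 2) * Real.log 2 + Real.log d := by
    rw [Real.log_mul (by positivity) (by linarith), Real.log_pow]
    push_cast
    ring
  set Λ := (ℓ + 2) * Real.log 2 + Real.log d with hΛ
  have hℓ : (0 : ℝ) ≤ ℓ := Nat.cast_nonneg ℓ
  have hΛ1 : 1.38 ≤ Λ := by nlinarith
  have hδ2 : (√0.275 * η) ^ 2 = 0.275 * η ^ 2 := by
    rw [mul_pow, Real.sq_sqrt (by norm_num)]
  have hτV : 0.15 / B ^ 2 * V ^ 2 = 0.15 * η ^ 2 := by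
    rw [hVB]; field_simp
  have hY1 : Real.log 100 ≤ 35.2 / 0.99 * B ^ 2 * Λ := by
    refine log_hundred_le.trans ?_
    calc (4.7 : ℝ) ≤ 35.2 / 0.99 * 1 * 1.38 := by norm_num
      _ ≤ 35.2 / 0.99 * B ^ 2 * Λ := by gcongr
  have hY2 : 8 * (1.1 * V) ^ 2 * Real.log (2 ^ (ℓ + 1 + 1) * d) ≤
      0.99 * (35.2 / 0.99 * B ^ 2 * Λ) * (√0.275 * η) ^ 2 := by
    rw [hlog, hδ2, hVB]
    refine le_of_eq ?_
    ring
  have hδD : (√0.275 * η) ^ 2 + 0.15 / B ^ 2 * V ^ 2 ≤ (0.652 * η) ^ 2 := by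
    rw [hδ2, hτV]
    nlinarith [sq_nonneg η]
  have hτU : 0.04 * (0.15 / B ^ 2 * V ^ 2) ≤ (0.0775 * η) ^ 2 := by
    rw [hτV]
    nlinarith [sq_nonneg η]
  have hDU : √2 * (0.652 * η) + 0.0775 * η ≤ γ * ε := by
    have h2 : √2 ≤ 1.41422 := Real.sqrt_le_iff.2 ⟨by norm_num, by norm_num⟩
    rw [← hηdef]
    nlinarith
  -- The choices balance three errors: `0.275 + 0.15 ≤ 0.652 ^ 2`, `0.04 * 0.15 ≤ 0.0775 ^ 2` and
  -- `√2 * 0.652 + 0.0775 ≤ 1`. The net then costs `8 * 1.1 ^ 2 / 0.275 = 35.2`, up to the factor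
  -- 0.99.
  obtain ⟨N, hcov, hN⟩ := coveringNumber_le_of_rowClass hφ hd hk hn S hψ hψS (ℓ + 1)
    (τ := 0.15 / B ^ 2) (δ := √0.275 * η) (D := 0.652 * η) (U := 0.0775 * η)
    (Y := 35.2 / 0.99 * B ^ 2 * Λ) hV hγ hε (by positivity) (by positivity) (by positivity) (by positivity) hF hY1 hY2 hδD hτU hDU
  refine metricEntropy_le hcov (hN.trans ?_)
  have hM : (⌊1 / (0.15 / B ^ 2)⌋₊ : ℝ) ≤ B ^ 2 / 0.15 := by
    refine (Nat.floor_le (by positivity)).trans (le_of_eq ?_)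
    field_simp
  calc Real.exp (35.2 / 0.99 * B ^ 2 * Λ) * 4000 ^ ⌊1 / (0.15 / B ^ 2)⌋₊
      ≤ Real.exp (35.2 / 0.99 * B ^ 2 * Λ) * Real.exp 8.3 ^ ⌊1 / (0.15 / B ^ 2)⌋₊ := by
        gcongr; exact four_thousand_le_exp
    _ = Real.exp (35.2 / 0.99 * B ^ 2 * Λ + ⌊1 / (0.15 / B ^ 2)⌋₊ * 8.3) := by
        rw [← Real.exp_nat_mul, ← Real.exp_add]
    _ ≤ _ := by
        refine Real.exp_le_exp.2 ?_
        calc 35.2 / 0.99 * B ^ 2 * Λ + ⌊1 / (0.15 / B ^ 2)⌋₊ * 8.3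
            ≤ 35.2 / 0.99 * B ^ 2 * Λ + B ^ 2 / 0.15 * 8.3 := by gcongr
          _ = B ^ 2 * (35.2 / 0.99 * Λ + 8.3 / 0.15) := by ring
          _ ≤ B ^ 2 * (9 * (ℓ + 2) ^ 2 * (ℓ + 3 + Real.log d)) := by
              refine mul_le_mul_of_nonneg_left ?_ (by positivity)
              exact entropy_const_le ℓ hlogd
          _ = _ := by ring

end Deep

/-! ### Application to the network class -/

lemma isRowClass_networkClass {d k n : ℕ} {φ : ℝ → ℝ} (hφ : IsActivation φ) (hn : 1 ≤ n)
    {q : ℝ} (hq1 : 1 ≤ q) (S : Fin n → (Fin d → ℝ) × Fin k) (ℓ : ℕ) (V ζ : ℝ) :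
    IsRowClass φ (feature q S) ℓ S V (networkClass (ℓ + 1) φ q S V ζ) := by
  rintro _ ⟨N, hNV, -, rfl⟩
  obtain ⟨v, g, hv, hvV, hg, hN⟩ := N.exists_rows hφ hn hq1 S
  exact ⟨v, g, hv, hvV.trans_le hNV, hg, hN⟩

/-- When the variation is below the resolution, one constant function covers the class. -/
lemma metricEntropy_le_zero_of_rowClass {d k n : ℕ} {φ : ℝ → ℝ} {ψ : Fin d → Fin n → ℝ}
    (hφ : IsActivation φ) (hk : 2 ≤ k) (hn : 1 ≤ n)
    (S : Fin n → (Fin d → ℝ) × Fin k) (hψ : ∀ a, ∑ i, ψ a i ^ 2 ≤ n) (ℓ : ℕ)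
    {F : Set ((Fin d → ℝ) → Fin k → ℝ)} {V γ ε : ℝ} (hγ : 0 < γ) (hε : 0 < ε)
    (hVε : V ≤ γ * ε) (hF : IsRowClass φ ψ ℓ S V F) :
    metricEntropy ε ((fun f s => ramp γ (-margin (f s.1) s.2)) '' F) S ≤ ((0 : ℝ) : EReal) := by
  have hn0 : (0 : ℝ) < n := by exact_mod_cast hn
  refine metricEntropy_le (N := 1) ?_ (by simp)
  refine (coveringNumber_le_encard (G := {fun _ => 1}) ?_).trans (by simp)
  rintro _ ⟨f, hf, rfl⟩
  refine ⟨_, rfl, empDist_le_of_sum_sq_le hn hε.le ?_⟩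
  obtain ⟨v, g, hv, hvV, hg, hfg⟩ := hF f hf
  have hv0 : 0 ≤ ∑ j, v j := Finset.sum_nonneg fun j _ => hv j
  have hpt : ∀ i, (ramp γ (-margin (f (S i).1) (S i).2) - 1) ^ 2 ≤
      (∑ j, v j * |g j i|) ^ 2 / γ ^ 2 := by
    intro i
    have h1 := abs_ramp_sub_le hγ (-margin (f (S i).1) (S i).2) 0
    rw [ramp_of_nonneg hγ le_rfl, sub_zero, abs_neg] at h1
    have h2 := abs_margin_le hk (f (S i).1) (S i).2
    simp only [hfg, abs_mul, abs_of_nonneg (hv _)] at h2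
    rw [← sq_abs, ← div_pow]
    gcongr
    exact h1.trans (by gcongr)
  calc ∑ i, (ramp γ (-margin (f (S i).1) (S i).2) - 1) ^ 2
      ≤ ∑ i, (∑ j, v j * |g j i|) ^ 2 / γ ^ 2 := Finset.sum_le_sum fun i _ => hpt i
    _ ≤ ∑ i, ((∑ j, v j) * ∑ j, v j * g j i ^ 2) / γ ^ 2 := by
        gcongr with i
        have := sq_sum_mul_le Finset.univ v (fun j => |g j i|)
        simpa only [abs_of_nonneg (hv _), sq_abs] using this
    _ = (∑ j, v j) * (∑ j, v j * ∑ i, g j i ^ 2) / γ ^ 2 := by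
        rw [← Finset.sum_div, ← Finset.mul_sum, Finset.sum_comm]
        simp only [Finset.mul_sum]
    _ ≤ (∑ j, v j) * (∑ j, v j * n) / γ ^ 2 := by
        gcongr with j
        · exact hv j
        · exact unitClass_sum_sq_le hφ hn0.le hψ (hg j)
    _ = n * (∑ j, v j) ^ 2 / γ ^ 2 := by rw [← Finset.sum_mul]; ring
    _ ≤ n * (γ * ε) ^ 2 / γ ^ 2 := by
        gcongr
        exact hvV.trans hVε
    _ = n * ε ^ 2 := by field_simp

lemma metricEntropy_empty {X : Type*} {n : ℕ} (ε : ℝ) (S : Fin n → X) :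
    metricEntropy ε (∅ : Set (X → ℝ)) S = ⊥ := by
  have h : coveringNumber ε (∅ : Set (X → ℝ)) S ≤ 0 := by
    refine (coveringNumber_le_encard (G := ∅) ?_).trans (by simp)
    rintro f ⟨⟩
  rw [metricEntropy, nonpos_iff_eq_zero.1 h]
  simp

end PathNet

theorem mainTheorem3 (d k L n : ℕ) (hd : 1 ≤ d) (hk : 2 ≤ k) (hL : 1 ≤ L) (hn : 1 ≤ n)
    (φ : ℝ → ℝ) (hφ : PathNet.IsActivation φ)
    (S : Fin n → (Fin d → ℝ) × Fin k)
    (q : ℝ) (hq1 : 1 ≤ q) (hq2 : q ≤ 2)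
    (V ζ : ℝ) (ε γ : ℝ) (hε : 0 < ε) (hγ : 0 < γ) :
    PathNet.metricEntropy ε (PathNet.rampMarginClass L φ q γ S V ζ) S ≤
      ((9 * V ^ 2 * ζ ^ 2 * (L : ℝ) ^ 2 * ((L : ℝ) + Real.log ((d : ℝ) * Real.exp 1))
        / (γ ^ 2 * ε ^ 2) : ℝ) : EReal) := by
  obtain ⟨ℓ, rfl⟩ : ∃ ℓ, L = ℓ + 1 := ⟨L - 1, by omega⟩
  have hd1 : (1 : ℝ) ≤ d := by exact_mod_cast hd
  have hlogd : 0 ≤ Real.log d := Real.log_nonneg hd1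
  have hF := PathNet.isRowClass_networkClass hφ hn hq1 S ℓ V ζ
  have hψ := PathNet.sum_feature_sq_le hn hq1 hq2 S
  have hψS : ∀ a i i', (S i).1 = (S i').1 →
      PathNet.feature q S a i = PathNet.feature q S a i' := fun a i i' h => by
    simp only [PathNet.feature, h]
  rw [Real.log_mul (by linarith) (Real.exp_pos 1).ne', Real.log_exp]
  -- The empty class has entropy `⊥`, which covers every `ζ < 1` and `V < 0`, where the real bound
  -- alone might be too small. Any member of the class certifies `1 ≤ ζ`.
  rcases (PathNet.networkClass (ℓ + 1) φ q S V ζ).eq_empty_or_nonempty with hE | ⟨_, N, -, hNζ, -⟩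
  · rw [PathNet.rampMarginClass, hE, Set.image_empty, PathNet.metricEntropy_empty]
    exact bot_le
  have hζ : 1 ≤ ζ := (N.one_le_pathComplexity q S).trans hNζ
  have hζ2 : 1 ≤ ζ ^ 2 := one_le_pow₀ hζ
  have hrhs : 9 * (V / (γ * ε)) ^ 2 * (ℓ + 1) ^ 2 * (ℓ + 2 + Real.log d) ≤
      9 * V ^ 2 * ζ ^ 2 * ((ℓ + 1 : ℕ) : ℝ) ^ 2 * (((ℓ + 1 : ℕ) : ℝ) + (Real.log d + 1)) /
        (γ ^ 2 * ε ^ 2) := by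
    have h0 : 0 ≤ 9 * (V / (γ * ε)) ^ 2 * (ℓ + 1) ^ 2 * (ℓ + 2 + Real.log d) := by positivity
    calc 9 * (V / (γ * ε)) ^ 2 * (ℓ + 1) ^ 2 * (ℓ + 2 + Real.log d)
        ≤ 9 * (V / (γ * ε)) ^ 2 * (ℓ + 1) ^ 2 * (ℓ + 2 + Real.log d) * ζ ^ 2 :=
          le_mul_of_one_le_right h0 hζ2
      _ = _ := by
          push_cast
          field_simp
          ring
  refine le_trans ?_ (EReal.coe_le_coe_iff.2 hrhs)
  rcases le_or_gt V (γ * ε) with hVε | hVε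
  · refine (PathNet.metricEntropy_le_zero_of_rowClass hφ hk hn S hψ ℓ hγ hε hVε hF).trans
      (EReal.coe_le_coe_iff.2 ?_)
    positivity
  rcases ℓ with _ | ℓ
  · refine (PathNet.metricEntropy_le_of_rowClass_zero hd hk hn S hψ hψS hγ hε hVε hF).trans
      (EReal.coe_le_coe_iff.2 (le_of_eq ?_))
    push_cast
    ring
  · refine (PathNet.metricEntropy_le_of_rowClass_succ hφ hd hk hn S hψ hψS ℓ hγ hε hVε hF).trans
      (EReal.coe_le_coe_iff.2 (le_of_eq ?_))
    push_cast
    ring
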